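/- Let $k$ be a field and let $(H,R)$ be a quasitriangular weak Hopf algebra over $k$ with bijective antipode $S$. Here $H$ is assumed regular: $S^2(x)=x$ for all $x\in H_tH_s$, where $H_t,H_s$ are the images of $\varepsilon_t(h)=\varepsilon(1_1h)1_2$ and $\varepsilon_s(h)=1_1\varepsilon(h1_2)$. Quasitriangular means that $R=R^1\otimes R^2\in\Delta^{cop}(1)(H\otimes H)\Delta(1)$ satisfies $(\mathrm{id}\otimes\Delta)R=R_{13}R_{12}$, $(\Delta\otimes \mathrm{id})R=R_{13}R_{23}$ and $\Delta^{cop}(h)R=R\Delta(h)$ for all $h\in H$, and that there is $\overline R\in\Delta(1)(H\otimes H)\Delta^{cop}(1)$ with $R\overline R=\Delta^{cop}(1)$ and $\overline RR=\Delta(1)$. For left $H$-modules $M,N$ put $M\otimes_tN=\{x\in M\otimes_k N\mid\Delta(1)x=x\}$, with $H$ acting through $\Delta$, and let $m\otimes_t n=1_1\cdot m\otimes 1_2\cdot n$. The left $H$-modules form a monoidal category ${}_H\mathscr M$ under $\otimes_t$, with unit object $H_t$, where $h\cdot z=\varepsilon_t(hz)$; the associativity constraint is the evident one, and the unit constraints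 are $z\otimes m\mapsto z\cdot m$ and $m\otimes z\mapsto S(z)\cdot m$. Let ${}_RH=C_H(H_s)$ be the centralizer of $H_s$ in $H$, an $H$-module under $h\cdot x=h_1xS(h_2)$, with the multiplication and unit of $H$, comultiplication $x\mapsto x_1S(R^2)\otimes R^1\cdot x_2$ and counit $\varepsilon_t$. A left ${}_RH$-comodule is a left $H$-module $M$ with an $H$-linear map $\rho^l:M\to{}_RH\otimes_tM$, $m\mapsto m_{(-1)}\otimes m_{(0)}$, which is coassociative for this comultiplication and satisfies $\varepsilon_t(m_{(-1)})\cdot m_{(0)}=m$. Morphisms are the $H$-linear colinear maps. The coaction on $U\otimes_tV$ is $u\otimes v\mapsto u_{(-1)}(R^2\cdot v_{(-1)})\otimes (R^1\cdot u_{(0)}\otimes_t v_{(0)})$, and the coaction on $H_t$ is $z\mapsto 1\otimes_tz$. A left Yetter–Drinfeld module is a left $H$-module $N$ with a left $H$-comodule structure $\rho^L:N\to H\otimes_tN$, $n\mapsto n_{[-1]}\otimes n_{[0]}$, such that $\rho^L(h\cdot n)=h_1n_{[-1]}S(h_3)\otimes h_2\cdot n_{[0]}$. Morphisms are the $H$-linear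 $H$-colinear maps. The coaction on $U\otimes_tV$ is $u\otimes v\mapsto u_{[-1]}v_{[-1]}\otimes (u_{[0]}\otimes_t v_{[0]})$, and the coaction on $H_t$ is $\Delta$. With the braiding $u\otimes v\mapsto u_{[-1]}\cdot v\otimes u_{[0]}$ these modules form a braided monoidal category ${}^H_H\mathscr{YD}$. Then the category ${}^{{}_RH}({}_H\mathscr M)$ of left ${}_RH$-comodules, with the tensor product $\otimes_t$, the unit object $H_t$ and the constraints of ${}_H\mathscr M$, is a braided monoidal category with braiding $$\widetilde C_{U,V}:U\otimes_tV\to V\otimes_tU,\qquad \widetilde C(u\otimes v)=u_{(-1)}R^2\cdot v\otimes R^1\cdot u_{(0)},$$ whose inverse is $$\widetilde C^{-1}(v\otimes u)=R^1\cdot u_{(0)}\otimes S^{-1}(u_{(-1)}R^2)\cdot v .$$ Moreover, the functor $$\mathcal G:{}^H_H\mathscr{YD}\to{}^{{}_RH}({}_H\mathscr M),\qquad (N,\rho^L)\mapsto(N,\ n\mapsto n_{[-1]}S(R^2)\otimes R^1\cdot n_{[0]}),$$ which is the identity on underlying maps, is an equivalence of categories with quasi-inverse $$\mathcal F:(M,\rho^l)\mapsto(M,\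 m\mapsto m_{(-1)}R^2\otimes R^1\cdot m_{(0)}),$$ and, with identity maps as its monoidal structure, $\mathcal G$ is a braided monoidal equivalence. -/

import Mathlib

open CategoryTheory MonoidalCategory
open scoped TensorProduct

universe w u

/-! ## Weak Hopf algebras -/

section WeakHopfAlgebras

variable (k : Type w) (H : Type u) [Field k] [Ring H] [Algebra k H]

/-- The target map `ε_t(h) = ε(1₁ h) 1₂`. -/
noncomputable def targetMap [Coalgebra k H] : H →ₗ[k] H :=
  (TensorProduct.lid k H).toLinearMap ∘ₗ (Coalgebra.counit (R := k) (A := H)).rTensor H ∘ₗ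
    LinearMap.mulLeft k (Coalgebra.comul (R := k) (1 : H)) ∘ₗ
    (Algebra.TensorProduct.includeLeft : H →ₐ[k] H ⊗[k] H).toLinearMap

/-- The source map `ε_s(h) = 1₁ ε(h 1₂)`. -/
noncomputable def sourceMap [Coalgebra k H] : H →ₗ[k] H :=
  (TensorProduct.rid k H).toLinearMap ∘ₗ (Coalgebra.counit (R := k) (A := H)).lTensor H ∘ₗ
    LinearMap.mulRight k (Coalgebra.comul (R := k) (1 : H)) ∘ₗ
    (Algebra.TensorProduct.includeRight : H →ₐ[k] H ⊗[k] H).toLinearMap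

/-- A weak Hopf algebra over the field `k`: an algebra and a coalgebra with an antipode `S`. -/
class WeakHopfAlgebra extends Coalgebra k H where
  /-- `Δ(ab) = Δ(a)Δ(b)` -/
  comul_mul : ∀ a b : H, comul (a * b) = comul a * comul b
  /-- `Δ²(1) = 1₁ ⊗ 1₂1₁' ⊗ 1₂'` -/
  comul_one_left : comul.lTensor H (comul (1 : H)) =
    TensorProduct.assoc k H H H (comul (1 : H) ⊗ₜ[k] (1 : H)) * ((1 : H) ⊗ₜ[k] comul (1 : H))
  /-- `Δ²(1) = 1₁ ⊗ 1₁'1₂ ⊗ 1₂'` -/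
  comul_one_right : comul.lTensor H (comul (1 : H)) =
    ((1 : H) ⊗ₜ[k] comul (1 : H)) * TensorProduct.assoc k H H H (comul (1 : H) ⊗ₜ[k] (1 : H))
  /-- `ε(abc) = ε(ab₁)ε(b₂c)` -/
  counit_mul_left : ∀ a b c : H, counit (a * b * c) =
    LinearMap.mul' k k (TensorProduct.map (counit ∘ₗ LinearMap.mulLeft k a)
      (counit ∘ₗ LinearMap.mulRight k c) (comul b))
  /-- `ε(abc) = ε(ab₂)ε(b₁c)` -/
  counit_mul_right : ∀ a b c : H, counit (a * b * c) =
    LinearMap.mul' k k (TensorProduct.map (counit ∘ₗ LinearMap.mulRight k c)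
      (counit ∘ₗ LinearMap.mulLeft k a) (comul b))
  /-- The antipode `S`. -/
  antipode : H →ₗ[k] H
  /-- `h₁S(h₂) = ε_t(h)` -/
  mul_antipode : ∀ h : H, LinearMap.mul' k H (antipode.lTensor H (comul h)) = targetMap k H h
  /-- `S(h₁)h₂ = ε_s(h)` -/
  antipode_mul : ∀ h : H, LinearMap.mul' k H (antipode.rTensor H (comul h)) = sourceMap k H h
  /-- `S(h₁)h₂S(h₃) = S(h)` -/
  antipode_mul_antipode : ∀ h : H,
    LinearMap.mul' k H (TensorProduct.map antipode
      (LinearMap.mul' k H ∘ₗ antipode.lTensor H ∘ₗ comul) (comul h)) = antipode h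

namespace WeakHopfAlgebra

variable [WeakHopfAlgebra k H]

/-- The target space `H_t`. -/
noncomputable abbrev targetSpace : Submodule k H := LinearMap.range (targetMap k H)

/-- `H` is regular if `S²(x) = x` for all `x ∈ H_t H_s`. -/
def IsRegular : Prop :=
  ∀ x ∈ targetSpace k H * LinearMap.range (sourceMap k H),
    antipode (k := k) (antipode (k := k) x) = x

variable {k H}

/-- `Δ^cop(h) = h₂ ⊗ h₁` -/
noncomputable def comulCop (h : H) : H ⊗[k] H := TensorProduct.comm k H H (Coalgebra.comul h)

/-- `X₁₂ = X ⊗ 1` in `H ⊗ (H ⊗ H)` -/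
noncomputable def leg12 (X : H ⊗[k] H) : H ⊗[k] (H ⊗[k] H) :=
  TensorProduct.assoc k H H H (X ⊗ₜ[k] 1)

/-- `X₂₃ = 1 ⊗ X` in `H ⊗ (H ⊗ H)` -/
noncomputable def leg23 (X : H ⊗[k] H) : H ⊗[k] (H ⊗[k] H) := 1 ⊗ₜ[k] X

/-- `X₁₃` in `H ⊗ (H ⊗ H)`: `a ⊗ b` is sent to `a ⊗ 1 ⊗ b`. -/
noncomputable def leg13 (X : H ⊗[k] H) : H ⊗[k] (H ⊗[k] H) :=
  TensorProduct.leftComm k H H H (1 ⊗ₜ[k] X)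

/-- `(H, R)` is a quasitriangular weak Hopf algebra; the antipode is part of `H` and has to be
bijective. -/
structure IsQuasitriangular (R : H ⊗[k] H) : Prop where
  antipode_bijective : Function.Bijective (antipode (k := k) : H →ₗ[k] H)
  /-- `R ∈ Δ^cop(1)(H ⊗ H)Δ(1)` -/
  mem : ∃ X : H ⊗[k] H, R = comulCop 1 * X * Coalgebra.comul 1
  /-- `(id ⊗ Δ)R = R₁₃R₁₂` -/
  id_comul : (Coalgebra.comul (R := k)).lTensor H R = leg13 R * leg12 R
  /-- `(Δ ⊗ id)R = R₁₃R₂₃` -/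
  comul_id : TensorProduct.assoc k H H H ((Coalgebra.comul (R := k)).rTensor H R) =
    leg13 R * leg23 R
  /-- `Δ^cop(h)R = RΔ(h)` -/
  cop_mul : ∀ h : H, comulCop h * R = R * Coalgebra.comul h
  /-- the weak inverse of `R`, in `Δ(1)(H ⊗ H)Δ^cop(1)` -/
  exists_inv : ∃ Rbar : H ⊗[k] H,
    (∃ X : H ⊗[k] H, Rbar = Coalgebra.comul 1 * X * comulCop 1) ∧
    R * Rbar = comulCop 1 ∧ Rbar * R = Coalgebra.comul 1

end WeakHopfAlgebra

end WeakHopfAlgebras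

namespace WeakHopfAlgebra

/-! ## Actions on tensor products -/

section Actions

variable {k : Type w} {H : Type u} [Field k] [Ring H] [Algebra k H]

/-- For `k`-linear families of endomorphisms `α` of `M` and `β` of `N`, the element `a ⊗ b` acts
on `M ⊗ N` by `m ⊗ n ↦ α(a)m ⊗ β(b)n`. -/
noncomputable def actBy {M N : Type*} [AddCommGroup M] [Module k M] [AddCommGroup N] [Module k N]
    (α : H →ₗ[k] Module.End k M) (β : H →ₗ[k] Module.End k N) :
    H ⊗[k] H →ₗ[k] Module.End k (M ⊗[k] N) :=
  TensorProduct.homTensorHomMap (RingHom.id k) M N M N ∘ₗ TensorProduct.map α β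

@[simp] theorem actBy_tmul {M N : Type*} [AddCommGroup M] [Module k M] [AddCommGroup N]
    [Module k N] (α : H →ₗ[k] Module.End k M) (β : H →ₗ[k] Module.End k N) (a b : H)
    (m : M) (n : N) : actBy α β (a ⊗ₜ b) (m ⊗ₜ n) = α a m ⊗ₜ[k] β b n := rfl

/-- For `X = ∑ a ⊗ b`, the map `x ⊗ m ↦ ∑ x b ⊗ α(a) m` on `H ⊗ M`. -/
noncomputable def twistBy {M : Type*} [AddCommGroup M] [Module k M]
    (α : H →ₗ[k] Module.End k M) (X : H ⊗[k] H) : H ⊗[k] M →ₗ[k] H ⊗[k] M :=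
  actBy (LinearMap.mul k H).flip α (TensorProduct.comm k H H X)

theorem twistBy_tmul {M : Type*} [AddCommGroup M] [Module k M]
    (α : H →ₗ[k] Module.End k M) (a b x : H) (m : M) :
    twistBy α (a ⊗ₜ b) (x ⊗ₜ m) = (x * b) ⊗ₜ[k] α a m := rfl

section OneModule

variable (k H) (M : Type*) [AddCommGroup M] [Module k M] [Module H M] [IsScalarTower k H M]

/-- The action of `H` on an `H`-module, as a linear map `H → End M`. -/
noncomputable def lact : H →ₗ[k] Module.End k M := (Algebra.lsmul k k M).toLinearMap

@[simp] theorem lact_apply (h : H) (m : M) : lact k H M h m = h • m := rfl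

/-- The action as a map `H ⊗ M → M`, `h ⊗ m ↦ h·m`. -/
noncomputable def actMap : H ⊗[k] M →ₗ[k] M := TensorProduct.lift (lact k H M)

theorem actMap_tmul (h : H) (m : M) : actMap k H M (h ⊗ₜ m) = h • m := rfl

end OneModule

section TwoModules

variable (k H) (M N : Type*) [AddCommGroup M] [Module k M] [Module H M] [IsScalarTower k H M]
  [AddCommGroup N] [Module k N] [Module H N] [IsScalarTower k H N]

/-- The componentwise action of `H ⊗ H` on `M ⊗ N`. -/
noncomputable def act2 : H ⊗[k] H →ₗ[k] Module.End k (M ⊗[k] N) :=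
  actBy (lact k H M) (lact k H N)

theorem act2_mul (x y : H ⊗[k] H) : act2 k H M N (x * y) = act2 k H M N x * act2 k H M N y := by
  induction x with
  | zero => simp
  | add x x' hx hx' => rw [add_mul, map_add, hx, hx', map_add, add_mul]
  | tmul a b =>
    induction y with
    | zero => simp
    | add y y' hy hy' => rw [mul_add, map_add, hy, hy', map_add, mul_add]
    | tmul c d =>
      ext m n
      simp [act2, mul_smul]

variable [WeakHopfAlgebra k H]

/-- `M ⊗_t N = {x ∈ M ⊗ N | Δ(1)x = x}`. -/
noncomputable def tensorT : Submodule k (M ⊗[k] N) :=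
  LinearMap.eqLocus (act2 k H M N (Coalgebra.comul 1)) LinearMap.id

theorem act2_comul_mem (h : H) (x : M ⊗[k] N) :
    act2 k H M N (Coalgebra.comul h) x ∈ tensorT k H M N := by
  change act2 k H M N (Coalgebra.comul 1) (act2 k H M N (Coalgebra.comul h) x) = _
  rw [← Module.End.mul_apply, ← act2_mul, ← comul_mul, one_mul, LinearMap.id_apply]

/-- The projection `M ⊗ N → M ⊗_t N`, `m ⊗ n ↦ m ⊗_t n = 1₁·m ⊗ 1₂·n`. -/
noncomputable def projT : M ⊗[k] N →ₗ[k] tensorT k H M N :=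
  (act2 k H M N (Coalgebra.comul 1)).codRestrict _ (act2_comul_mem k H M N 1)

/-- The `H`-module structure `h·(m ⊗ n) = h₁·m ⊗ h₂·n` on `M ⊗_t N`. -/
@[reducible] noncomputable def tensorTModule : Module H (tensorT k H M N) where
  smul h x := ⟨act2 k H M N (Coalgebra.comul h) x, act2_comul_mem k H M N h x⟩
  one_smul x := Subtype.ext x.2
  mul_smul a b x := Subtype.ext (by
    change act2 k H M N (Coalgebra.comul (a * b)) x = act2 k H M N (Coalgebra.comul a)
      (act2 k H M N (Coalgebra.comul b) x)
    rw [comul_mul, act2_mul, Module.End.mul_apply])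
  smul_zero a := Subtype.ext (map_zero (act2 k H M N (Coalgebra.comul a)))
  smul_add a x y := Subtype.ext (map_add (act2 k H M N (Coalgebra.comul a)) x.1 y.1)
  add_smul a b x := Subtype.ext (by
    change act2 k H M N (Coalgebra.comul (a + b)) x = act2 k H M N (Coalgebra.comul a) x +
      act2 k H M N (Coalgebra.comul b) x
    rw [map_add, map_add, LinearMap.add_apply])
  zero_smul x := Subtype.ext (by
    change act2 k H M N (Coalgebra.comul (0 : H)) x = 0
    rw [map_zero, map_zero, LinearMap.zero_apply])

theorem tensorT_isScalarTower :
    letI := tensorTModule k H M N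
    IsScalarTower k H (tensorT k H M N) :=
  letI := tensorTModule k H M N
  ⟨fun c h x => Subtype.ext (by
    change act2 k H M N (Coalgebra.comul (c • h)) x = c • act2 k H M N (Coalgebra.comul h) x
    rw [map_smul, map_smul, LinearMap.smul_apply])⟩

end TwoModules

end Actions

/-! ## The unit object and the adjoint action -/

section Unit

variable (k : Type w) (H : Type u) [Field k] [Ring H] [Algebra k H] [WeakHopfAlgebra k H]

theorem counit_mul_targetMap (g h : H) :
    Coalgebra.counit (R := k) (g * targetMap k H h) = Coalgebra.counit (R := k) (g * h) := by
  have key := counit_mul_right (k := k) g 1 h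
  rw [mul_one] at key
  rw [key]
  have : ∀ X : H ⊗[k] H, Coalgebra.counit (R := k) (g * TensorProduct.lid k H
      ((Coalgebra.counit (R := k) (A := H)).rTensor H (X * (h ⊗ₜ[k] 1)))) =
      LinearMap.mul' k k (TensorProduct.map (Coalgebra.counit (R := k) ∘ₗ LinearMap.mulRight k h)
      (Coalgebra.counit (R := k) ∘ₗ LinearMap.mulLeft k g) X) := by
    intro X
    induction X with
    | zero => simp
    | add x y hx hy => rw [add_mul, map_add, map_add, mul_add, map_add, hx, hy, map_add, map_add]
    | tmul a b => simp
  exact this _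

theorem targetMap_mul_targetMap (g h : H) :
    targetMap k H (g * targetMap k H h) = targetMap k H (g * h) := by
  have : ∀ X : H ⊗[k] H, TensorProduct.lid k H ((Coalgebra.counit (R := k) (A := H)).rTensor H
      (X * ((g * targetMap k H h) ⊗ₜ[k] 1))) = TensorProduct.lid k H
      ((Coalgebra.counit (R := k) (A := H)).rTensor H (X * ((g * h) ⊗ₜ[k] 1))) := by
    intro X
    induction X with
    | zero => simp
    | add x y hx hy => rw [add_mul, map_add, map_add, hx, hy, add_mul, map_add, map_add]
    | tmul a b => simp [← mul_assoc, counit_mul_targetMap]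
  exact this _

/-- The `H`-action `h·z = ε_t(hz)` on `H_t`, as a linear map `H → End H_t`. -/
noncomputable def targetAct : H →ₗ[k] Module.End k (targetSpace k H) :=
  LinearMap.mk₂ k
    (fun h z => (⟨targetMap k H (h * z), LinearMap.mem_range_self _ _⟩ : targetSpace k H))
    (fun a b z => Subtype.ext (by simp [add_mul]))
    (fun c a z => Subtype.ext (by simp))
    (fun a y z => Subtype.ext (by simp [mul_add]))
    (fun c a z => Subtype.ext (by simp))

/-- The `H`-module structure `h·z = ε_t(hz)` on `H_t`. -/
@[reducible] noncomputable def targetModule : Module H (targetSpace k H) where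
  smul h z := targetAct k H h z
  one_smul z := Subtype.ext (by
    obtain ⟨_, g, rfl⟩ := z
    change targetMap k H (1 * targetMap k H g) = targetMap k H g
    rw [targetMap_mul_targetMap, one_mul])
  mul_smul a b z := Subtype.ext (by
    change targetMap k H (a * b * z) = targetMap k H (a * targetMap k H (b * z))
    rw [targetMap_mul_targetMap, mul_assoc])
  smul_zero a := map_zero (targetAct k H a)
  smul_add a x y := map_add (targetAct k H a) x y
  add_smul a b z := by
    change targetAct k H (a + b) z = targetAct k H a z + targetAct k H b z
    rw [map_add, LinearMap.add_apply]
  zero_smul z := by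
    change targetAct k H 0 z = 0
    rw [map_zero, LinearMap.zero_apply]

theorem target_isScalarTower :
    letI := targetModule k H
    IsScalarTower k H (targetSpace k H) :=
  letI := targetModule k H
  ⟨fun c h z => by
    change targetAct k H (c • h) z = c • targetAct k H h z
    rw [map_smul, LinearMap.smul_apply]⟩

/-- `a ⊗ c ↦ (x ↦ a x S(c))` -/
noncomputable def sandwich : H ⊗[k] H →ₗ[k] Module.End k H :=
  TensorProduct.lift ((LinearMap.mul k (Module.End k H)).compl₁₂ (LinearMap.mul k H)
    ((LinearMap.mul k H).flip ∘ₗ antipode))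

theorem sandwich_tmul (a c x : H) :
    sandwich k H (a ⊗ₜ c) x = a * (x * antipode (k := k) c) := rfl

/-- The adjoint action `h·x = h₁ x S(h₂)`. -/
noncomputable def adj : H →ₗ[k] Module.End k H := sandwich k H ∘ₗ Coalgebra.comul

/-- The algebra `_R H = C_H(H_s)`, the centralizer of the source space. -/
noncomputable def transmuted : Subalgebra k H :=
  Subalgebra.centralizer k (Set.range (sourceMap k H))

/-- `S⁻¹` (meaningful when `S` is bijective). -/
noncomputable def antipodeInv (hS : Function.Bijective (antipode (k := k) : H →ₗ[k] H)) :
    H →ₗ[k] H :=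
  (LinearEquiv.ofBijective (antipode (k := k) : H →ₗ[k] H) hS).symm.toLinearMap

end Unit

/-! ## Modules with a coaction -/

section Coacted

variable (k : Type w) (H : Type u) [Field k] [Ring H] [Algebra k H]

/-- A left `H`-module `M` with a `k`-linear map `M → H ⊗ M`. Yetter-Drinfeld modules and
`_R H`-comodules are the objects of this kind that satisfy the respective axioms. -/
structure CoactedModule where
  carrier : Type u
  [addCommGroup : AddCommGroup carrier]
  [moduleField : Module k carrier]
  [module : Module H carrier]
  [isScalarTower : IsScalarTower k H carrier]
  coact : carrier →ₗ[k] H ⊗[k] carrier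

namespace CoactedModule

attribute [instance] addCommGroup moduleField module isScalarTower

instance : CoeSort (CoactedModule k H) (Type u) := ⟨carrier⟩

variable {k H}

/-- `H`-linear and compatible with the coactions. -/
structure IsMorphism {M N : CoactedModule k H} (f : M →ₗ[k] N) : Prop where
  map_smul : ∀ (h : H) (m : M), f (h • m) = h • f m
  map_coact : ∀ m : M, N.coact (f m) = f.lTensor H (M.coact m)

/-- Morphisms are the linear maps that are `H`-linear and colinear. -/
@[ext] structure Hom (M N : CoactedModule k H) where
  toLin : M →ₗ[k] N
  isMorphism : IsMorphism toLin

instance : Category (CoactedModule k H) where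
  Hom := Hom
  id M := ⟨LinearMap.id, ⟨fun _ _ => rfl, fun m => by simp⟩⟩
  comp f g := ⟨g.toLin ∘ₗ f.toLin,
    ⟨fun h m => by simp [f.isMorphism.map_smul, g.isMorphism.map_smul],
     fun m => by
      rw [LinearMap.comp_apply, g.isMorphism.map_coact, f.isMorphism.map_coact,
        LinearMap.lTensor_comp, LinearMap.comp_apply]⟩⟩

/-- A bijective morphism is an isomorphism. -/
noncomputable def isoOfBijective {M N : CoactedModule k H} (f : M →ₗ[k] N) (hf : IsMorphism f)
    (hb : Function.Bijective f) : M ≅ N where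
  hom := ⟨f, hf⟩
  inv := ⟨(LinearEquiv.ofBijective f hb).symm.toLinearMap,
    ⟨fun h n => hb.1 (by
      have h1 : ∀ n, f ((LinearEquiv.ofBijective f hb).symm n) = n := fun n =>
        (LinearEquiv.ofBijective f hb).apply_symm_apply n
      rw [hf.map_smul, LinearEquiv.coe_coe, h1, h1]),
     fun n => by
      obtain ⟨m, rfl⟩ := hb.2 n
      have h1 : (LinearEquiv.ofBijective f hb).symm (f m) = m :=
        (LinearEquiv.ofBijective f hb).symm_apply_apply m
      have h2 : (LinearEquiv.ofBijective f hb).symm.toLinearMap ∘ₗ f = LinearMap.id :=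
        LinearMap.ext fun m => (LinearEquiv.ofBijective f hb).symm_apply_apply m
      rw [hf.map_coact, ← LinearMap.lTensor_comp_apply, h2, LinearEquiv.coe_coe, h1,
        LinearMap.lTensor_id, LinearMap.id_apply]⟩⟩
  hom_inv_id := Hom.ext (LinearMap.ext fun m => (LinearEquiv.ofBijective f hb).symm_apply_apply m)
  inv_hom_id := Hom.ext (LinearMap.ext fun m => (LinearEquiv.ofBijective f hb).apply_symm_apply m)

end CoactedModule

end Coacted

/-! ## Yetter-Drinfeld modules and comodules over `_R H` -/

section Objects

variable {k : Type w} {H : Type u} [Field k] [Ring H] [Algebra k H] [WeakHopfAlgebra k H]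

/-- `h ↦ (x ⊗ m ↦ h₁ x S(h₃) ⊗ h₂·m)`, an endomorphism of `H ⊗ M` -/
noncomputable def ydAct (M : Type*) [AddCommGroup M] [Module k M] [Module H M]
    [IsScalarTower k H M] : H →ₗ[k] Module.End k (H ⊗[k] M) :=
  TensorProduct.homTensorHomMap (RingHom.id k) H M H M ∘ₗ
    TensorProduct.map (sandwich k H) (lact k H M) ∘ₗ
    (TensorProduct.assoc k H H H).symm.toLinearMap ∘ₗ
    (TensorProduct.comm k H H).toLinearMap.lTensor H ∘ₗ
    (Coalgebra.comul (R := k)).lTensor H ∘ₗ Coalgebra.comul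

/-- `(M, ρ)` is a left Yetter-Drinfeld module over `H`. -/
structure IsYetterDrinfeld (M : CoactedModule k H) : Prop where
  /-- the coaction of `H` is coassociative -/
  coassoc : ∀ m : M, M.coact.lTensor H (M.coact m) =
    TensorProduct.assoc k H H M ((Coalgebra.comul (R := k)).rTensor M (M.coact m))
  /-- the coaction of `H` is counital -/
  counit : ∀ m : M, TensorProduct.lid k M
    ((Coalgebra.counit (R := k) (A := H)).rTensor M (M.coact m)) = m
  /-- `ρ(m) ∈ H ⊗_t M` -/
  coact_mem : ∀ m : M, M.coact m ∈ tensorT k H H M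
  /-- `ρ(h·m) = h₁ m₋₁ S(h₃) ⊗ h₂·m₀` -/
  coact_smul : ∀ (h : H) (m : M), M.coact (h • m) = ydAct M h (M.coact m)

/-- The comultiplication `x ↦ x₁ S(R²) ⊗ R¹·x₂` of `_R H`. -/
noncomputable def transmutedComul (R : H ⊗[k] H) : H →ₗ[k] H ⊗[k] H :=
  twistBy (adj k H) ((antipode (k := k)).lTensor H R) ∘ₗ Coalgebra.comul

/-- `(M, ρ)` is a left `_R H`-comodule in the category of left `H`-modules. As `k` is a field,
`_R H ⊗_t M` and `_R H ⊗ _R H ⊗ M` are regarded as subspaces of `H ⊗ M` and `H ⊗ H ⊗ M`. -/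
structure IsTransmutedComodule (R : H ⊗[k] H) (M : CoactedModule k H) : Prop where
  /-- `ρ(m) ∈ _R H ⊗ M` -/
  coact_mem : ∀ m : M, M.coact m ∈
    LinearMap.range ((transmuted k H).val.toLinearMap.rTensor M)
  /-- `ρ(m) ∈ _R H ⊗_t M`, where `H` acts on `_R H` by the adjoint action -/
  coact_mem_tensorT : ∀ m : M,
    actBy (adj k H) (lact k H M) (Coalgebra.comul 1) (M.coact m) = M.coact m
  /-- `ρ(h·m) = h₁·m₋₁ ⊗ h₂·m₀` -/
  coact_smul : ∀ (h : H) (m : M), M.coact (h • m) =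
    actBy (adj k H) (lact k H M) (Coalgebra.comul h) (M.coact m)
  /-- coassociativity with respect to the comultiplication of `_R H` -/
  coassoc : ∀ m : M, M.coact.lTensor H (M.coact m) =
    TensorProduct.assoc k H H M ((transmutedComul R).rTensor M (M.coact m))
  /-- `ε_t(m₋₁)·m₀ = m` -/
  counit : ∀ m : M, actMap k H M ((targetMap k H).rTensor M (M.coact m)) = m

variable (k H) in
/-- The category of left Yetter-Drinfeld modules. -/
abbrev YetterDrinfeld : Type (max w (u + 1)) :=
  ObjectProperty.FullSubcategory (IsYetterDrinfeld (k := k) (H := H))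

/-- The category of left `_R H`-comodules in the category of left `H`-modules. -/
abbrev TransmutedComodule (R : H ⊗[k] H) : Type (max w (u + 1)) :=
  ObjectProperty.FullSubcategory (IsTransmutedComodule (k := k) (H := H) R)

end Objects

/-! ## The monoidal structures -/

section Monoidal

variable {k : Type w} {H : Type u} [Field k] [Ring H] [Algebra k H] [WeakHopfAlgebra k H]

/-- The module `U ⊗_t V` with the coaction `τ`. -/
noncomputable def tensorObject (U V : CoactedModule k H)
    (τ : tensorT k H U V →ₗ[k] H ⊗[k] tensorT k H U V) : CoactedModule k H :=
  letI := tensorTModule k H U V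
  haveI := tensorT_isScalarTower k H U V
  { carrier := tensorT k H U V, coact := τ }

/-- The module `H_t` with the coaction `ι`. -/
noncomputable def unitObject
    (ι : targetSpace k H →ₗ[k] H ⊗[k] targetSpace k H) : CoactedModule k H :=
  letI := targetModule k H
  haveI := target_isScalarTower k H
  { carrier := targetSpace k H, coact := ι }

/-- A choice of coactions on the modules `U ⊗_t V` and on `H_t`. -/
structure CoactionRule (k : Type w) (H : Type u) [Field k] [Ring H] [Algebra k H]
    [WeakHopfAlgebra k H] where
  tensor : ∀ U V : CoactedModule k H, tensorT k H U V →ₗ[k] H ⊗[k] tensorT k H U V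
  unit : targetSpace k H →ₗ[k] H ⊗[k] targetSpace k H

namespace CoactionRule

variable (τ : CoactionRule k H)

/-- `U ⊗_t V` with the coaction given by the rule. -/
noncomputable def tens (U V : CoactedModule k H) : CoactedModule k H :=
  tensorObject U V (τ.tensor U V)

/-- `H_t` with the coaction given by the rule. -/
noncomputable def one : CoactedModule k H := unitObject τ.unit

/-- `f ⊗_t g : u ⊗ v ↦ f(u) ⊗ g(v)` -/
noncomputable def mapLin {U U' V V' : CoactedModule k H} (f : U →ₗ[k] U') (g : V →ₗ[k] V') :
    τ.tens U V →ₗ[k] τ.tens U' V' :=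
  projT k H U' V' ∘ₗ TensorProduct.map f g ∘ₗ (tensorT k H U V).subtype

/-- The associativity `(u ⊗ v) ⊗ w ↦ u ⊗ (v ⊗ w)` -/
noncomputable def assocLin (U V W : CoactedModule k H) :
    τ.tens (τ.tens U V) W →ₗ[k] τ.tens U (τ.tens V W) :=
  projT k H U (τ.tens V W) ∘ₗ (projT k H V W).lTensor U ∘ₗ
    (TensorProduct.assoc k U V W).toLinearMap ∘ₗ
    (tensorT k H U V).subtype.rTensor W ∘ₗ (tensorT k H (τ.tens U V) W).subtype

/-- The left unit constraint `z ⊗ u ↦ z·u` -/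
noncomputable def leftLin (U : CoactedModule k H) : τ.tens τ.one U →ₗ[k] U :=
  actMap k H U ∘ₗ (targetSpace k H).subtype.rTensor U ∘ₗ (tensorT k H τ.one U).subtype

/-- The right unit constraint `u ⊗ z ↦ S(z)·u` -/
noncomputable def rightLin (U : CoactedModule k H) : τ.tens U τ.one →ₗ[k] U :=
  actMap k H U ∘ₗ (TensorProduct.comm k U H).toLinearMap ∘ₗ
    (antipode (k := k) ∘ₗ (targetSpace k H).subtype).lTensor U ∘ₗ (tensorT k H U τ.one).subtype

/-- The class `P` of objects is closed under tensor products and contains the unit object, and on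
it the tensor products of morphisms are morphisms and the constraints are isomorphisms. -/
structure IsClosed (P : ObjectProperty (CoactedModule k H)) : Prop where
  tens : ∀ U V : CoactedModule k H, P U → P V → P (τ.tens U V)
  one : P τ.one
  map : ∀ (U U' V V' : P.FullSubcategory) (f : U.obj ⟶ U'.obj) (g : V.obj ⟶ V'.obj),
    CoactedModule.IsMorphism (τ.mapLin f.toLin g.toLin)
  assoc : ∀ U V W : P.FullSubcategory, CoactedModule.IsMorphism (τ.assocLin U.obj V.obj W.obj)
  assoc_bijective : ∀ U V W : P.FullSubcategory,
    Function.Bijective (τ.assocLin U.obj V.obj W.obj)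
  left : ∀ U : P.FullSubcategory, CoactedModule.IsMorphism (τ.leftLin U.obj)
  left_bijective : ∀ U : P.FullSubcategory, Function.Bijective (τ.leftLin U.obj)
  right : ∀ U : P.FullSubcategory, CoactedModule.IsMorphism (τ.rightLin U.obj)
  right_bijective : ∀ U : P.FullSubcategory, Function.Bijective (τ.rightLin U.obj)

variable {τ} {P : ObjectProperty (CoactedModule k H)}

/-- The isomorphism in the full subcategory `P` given by a bijective morphism. -/
noncomputable def isoMk {U V : P.FullSubcategory} (f : U.obj →ₗ[k] V.obj)
    (hf : CoactedModule.IsMorphism f) (hb : Function.Bijective f) : U ≅ V :=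
  P.isoMk (CoactedModule.isoOfBijective f hf hb)

/-- The tensor product, unit object and constraints on the full subcategory `P`. -/
@[reducible] noncomputable def IsClosed.struct (h : τ.IsClosed P) :
    MonoidalCategoryStruct P.FullSubcategory where
  tensorObj U V := ⟨τ.tens U.obj V.obj, h.tens _ _ U.property V.property⟩
  tensorUnit := ⟨τ.one, h.one⟩
  tensorHom {U U' V V'} f g := ObjectProperty.homMk
    ⟨τ.mapLin f.hom.toLin g.hom.toLin, h.map U U' V V' f.hom g.hom⟩
  whiskerLeft U {V V'} g := ObjectProperty.homMk
    ⟨τ.mapLin LinearMap.id g.hom.toLin, h.map U U V V' (𝟙 _) g.hom⟩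
  whiskerRight {U U'} f V := ObjectProperty.homMk
    ⟨τ.mapLin f.hom.toLin LinearMap.id, h.map U U' V V f.hom (𝟙 _)⟩
  associator U V W := isoMk (τ.assocLin U.obj V.obj W.obj) (h.assoc U V W)
    (h.assoc_bijective U V W)
  leftUnitor U := isoMk (τ.leftLin U.obj) (h.left U) (h.left_bijective U)
  rightUnitor U := isoMk (τ.rightLin U.obj) (h.right U) (h.right_bijective U)

/-- The tensor product `⊗_t` with the coactions of the rule `τ`, the unit object `H_t` and the
constraints above are well defined on `P` and make `P` a monoidal category. -/
structure IsMonoidal (τ : CoactionRule k H) (P : ObjectProperty (CoactedModule k H)) : Prop where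
  isClosed : τ.IsClosed P
  lawful : ∃ m : MonoidalCategory P.FullSubcategory,
    m.toMonoidalCategoryStruct = isClosed.struct

/-- The monoidal category with the given tensor product, unit object and constraints. -/
@[reducible] noncomputable def IsMonoidal.category (h : τ.IsMonoidal P) :
    MonoidalCategory P.FullSubcategory :=
  { h.isClosed.struct with
    tensorHom_def := by
      obtain ⟨m, hm⟩ := h.lawful
      rw [← hm]; exact m.tensorHom_def
    id_tensorHom_id := by
      obtain ⟨m, hm⟩ := h.lawful
      rw [← hm]; exact m.id_tensorHom_id
    tensorHom_comp_tensorHom := by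
      obtain ⟨m, hm⟩ := h.lawful
      rw [← hm]; exact m.tensorHom_comp_tensorHom
    whiskerLeft_id := by
      obtain ⟨m, hm⟩ := h.lawful
      rw [← hm]; exact m.whiskerLeft_id
    id_whiskerRight := by
      obtain ⟨m, hm⟩ := h.lawful
      rw [← hm]; exact m.id_whiskerRight
    associator_naturality := by
      obtain ⟨m, hm⟩ := h.lawful
      rw [← hm]; exact m.associator_naturality
    leftUnitor_naturality := by
      obtain ⟨m, hm⟩ := h.lawful
      rw [← hm]; exact m.leftUnitor_naturality
    rightUnitor_naturality := by
      obtain ⟨m, hm⟩ := h.lawful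
      rw [← hm]; exact m.rightUnitor_naturality
    pentagon := by
      obtain ⟨m, hm⟩ := h.lawful
      rw [← hm]; exact m.pentagon
    triangle := by
      obtain ⟨m, hm⟩ := h.lawful
      rw [← hm]; exact m.triangle }

end CoactionRule

/-- The coaction `u ⊗ v ↦ u₋₁ v₋₁ ⊗ (u₀ ⊗_t v₀)` on a tensor product of Yetter-Drinfeld modules
and the coaction `Δ` on the unit object `H_t`. -/
noncomputable def ydRule (k : Type w) (H : Type u) [Field k] [Ring H] [Algebra k H]
    [WeakHopfAlgebra k H] : CoactionRule k H where
  tensor U V := TensorProduct.map (LinearMap.mul' k H) (projT k H U V) ∘ₗ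
    (TensorProduct.tensorTensorTensorComm k H U H V).toLinearMap ∘ₗ
    TensorProduct.map U.coact V.coact ∘ₗ (tensorT k H U V).subtype
  unit := (targetMap k H).rangeRestrict.lTensor H ∘ₗ Coalgebra.comul ∘ₗ (targetSpace k H).subtype

/-- `(h ⊗ u) ⊗ (g ⊗ v) ↦ h (R²·g) ⊗ (R¹·u ⊗ v)`: the braiding `u ⊗ g ↦ R²·g ⊗ R¹·u` of `H`-modules
in the middle (`H` acts on the factor `g` by the adjoint action), followed by the
multiplication. -/
noncomputable def braidMul (R : H ⊗[k] H) (U V : CoactedModule k H) :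
    (H ⊗[k] U) ⊗[k] (H ⊗[k] V) →ₗ[k] H ⊗[k] (U ⊗[k] V) :=
  (LinearMap.mul' k H).rTensor (U ⊗[k] V) ∘ₗ
    actBy (LinearMap.lTensorHom H ∘ₗ adj k H) (LinearMap.rTensorHom V ∘ₗ lact k H U)
      (TensorProduct.comm k H H R) ∘ₗ
    (TensorProduct.tensorTensorTensorComm k H U H V).toLinearMap

theorem braidMul_tmul (U V : CoactedModule k H) (a b h g : H) (x : U) (y : V) :
    braidMul (a ⊗ₜ b) U V ((h ⊗ₜ x) ⊗ₜ (g ⊗ₜ y)) = (h * adj k H b g) ⊗ₜ[k] ((a • x) ⊗ₜ[k] y) := rfl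

/-- The coaction `u ⊗ v ↦ u₋₁ (R²·v₋₁) ⊗ (R¹·u₀ ⊗_t v₀)` on a tensor product of `_R H`-comodules
and the trivial coaction `z ↦ 1 ⊗_t z` on the unit object `H_t`. -/
noncomputable def comoduleRule (R : H ⊗[k] H) : CoactionRule k H where
  tensor U V := (projT k H U V).lTensor H ∘ₗ braidMul R U V ∘ₗ
    TensorProduct.map U.coact V.coact ∘ₗ (tensorT k H U V).subtype
  unit := actBy (adj k H) (targetAct k H) (Coalgebra.comul 1) ∘ₗ
    TensorProduct.mk k H (targetSpace k H) 1

/-! ## Braidings and functors -/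

/-- `(h ⊗ u) ⊗ v ↦ h·v ⊗ u` -/
noncomputable def actSwap (U V : CoactedModule k H) : (H ⊗[k] U) ⊗[k] V →ₗ[k] V ⊗[k] U :=
  (TensorProduct.comm k U V).toLinearMap ∘ₗ (actMap k H V).lTensor U ∘ₗ
    (TensorProduct.leftComm k H U V).toLinearMap ∘ₗ (TensorProduct.assoc k H U V).toLinearMap

set_option linter.unusedSectionVars false in
theorem actSwap_tmul (U V : CoactedModule k H) (h : H) (x : U) (y : V) :
    actSwap U V ((h ⊗ₜ x) ⊗ₜ y) = (h • y) ⊗ₜ[k] x := rfl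

/-- The formula `u ⊗ v ↦ u₋₁·v ⊗ u₀` -/
noncomputable def ydBraiding (U V : CoactedModule k H) : U ⊗[k] V →ₗ[k] V ⊗[k] U :=
  actSwap U V ∘ₗ U.coact.rTensor V

/-- The formula `u ⊗ v ↦ u₋₁R²·v ⊗ R¹·u₀` -/
noncomputable def comoduleBraiding (R : H ⊗[k] H) (U V : CoactedModule k H) :
    U ⊗[k] V →ₗ[k] V ⊗[k] U :=
  actSwap U V ∘ₗ (twistBy (lact k H U) R ∘ₗ U.coact).rTensor V

/-- The formula `v ⊗ u ↦ R¹·u₀ ⊗ S⁻¹(u₋₁R²)·v` -/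
noncomputable def comoduleBraidingInv (R : H ⊗[k] H)
    (hS : Function.Bijective (antipode (k := k) : H →ₗ[k] H)) (U V : CoactedModule k H) :
    V ⊗[k] U →ₗ[k] U ⊗[k] V :=
  (TensorProduct.comm k V U).toLinearMap ∘ₗ actSwap U V ∘ₗ
    ((antipodeInv k H hS).rTensor U ∘ₗ twistBy (lact k H U) R ∘ₗ U.coact).rTensor V ∘ₗ
    (TensorProduct.comm k V U).toLinearMap

/-- The module `M` with the coaction `m ↦ m₋₁R² ⊗ R¹·m₀`. -/
@[reducible] noncomputable def objF (R : H ⊗[k] H) (M : CoactedModule k H) : CoactedModule k H where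
  carrier := M
  coact := twistBy (lact k H M) R ∘ₗ M.coact

/-- The module `N` with the coaction `n ↦ n₋₁S(R²) ⊗ R¹·n₀`. -/
@[reducible] noncomputable def objG (R : H ⊗[k] H) (N : CoactedModule k H) : CoactedModule k H where
  carrier := N
  coact := twistBy (lact k H N) ((antipode (k := k)).lTensor H R) ∘ₗ N.coact

set_option linter.unusedSectionVars false in
/-- A morphism `f` stays a morphism for the coactions `(twist by X) ∘ ρ`. -/
theorem twistBy_map {M N : CoactedModule k H} (X : H ⊗[k] H) (f : M ⟶ N) (m : M) :
    twistBy (lact k H N) X (N.coact (f.toLin m)) =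
      f.toLin.lTensor H (twistBy (lact k H M) X (M.coact m)) := by
  rw [f.isMorphism.map_coact]
  generalize M.coact m = y
  induction X with
  | zero => simp [twistBy]
  | add a b ha hb =>
    have h1 : ∀ L : CoactedModule k H, twistBy (lact k H L) (a + b) =
        twistBy (lact k H L) a + twistBy (lact k H L) b := fun L => by simp [twistBy]
    rw [h1, h1, LinearMap.add_apply, LinearMap.add_apply, ha, hb, map_add]
  | tmul a b =>
    induction y with
    | zero => simp
    | add y z hy hz => simp only [map_add, hy, hz]
    | tmul h y => simp [twistBy_tmul, f.isMorphism.map_smul]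

/-- The functor `G : (N, ρ) ↦ (N, n ↦ n₋₁S(R²) ⊗ R¹·n₀)`, the identity on underlying maps. -/
noncomputable def functorG (R : H ⊗[k] H)
    (hG : ∀ N : CoactedModule k H, IsYetterDrinfeld N → IsTransmutedComodule R (objG R N)) :
    YetterDrinfeld k H ⥤ TransmutedComodule R where
  obj N := ⟨objG R N.obj, hG N.obj N.property⟩
  map f := ObjectProperty.homMk ⟨f.hom.toLin, ⟨f.hom.isMorphism.map_smul,
    fun m => twistBy_map _ f.hom m⟩⟩

/-- The functor `F : (M, ρ) ↦ (M, m ↦ m₋₁R² ⊗ R¹·m₀)`, the identity on underlying maps. -/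
noncomputable def functorF (R : H ⊗[k] H)
    (hF : ∀ M : CoactedModule k H, IsTransmutedComodule R M → IsYetterDrinfeld (objF R M)) :
    TransmutedComodule R ⥤ YetterDrinfeld k H where
  obj M := ⟨objF R M.obj, hF M.obj M.property⟩
  map f := ObjectProperty.homMk ⟨f.hom.toLin, ⟨f.hom.isMorphism.map_smul,
    fun m => twistBy_map _ f.hom m⟩⟩

end Monoidal

end WeakHopfAlgebra

/-!
Both categories consist of the same kind of data, an `H`-module `M` with a map `M → H ⊗ M`, and
the theorem says that they differ by a change of coaction. For `X = ∑ a ⊗ b` let `X` act on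
`H ⊗ M` by `x ⊗ m ↦ xb ⊗ a·m` (`twistBy`). The functor `G` is the twist by `R¹ ⊗ S(R²)` and `F` is
the twist by `R`. By quasitriangularity the composites are the twists by
`r¹R¹ ⊗ S(R²)r² = 1₁ ⊗ S(1₂)` and `r¹R¹ ⊗ R²S(r²) = S(1₁) ⊗ 1₂` (`sum_antipode_mul`,
`sum_mul_antipode`); the first of these fixes the coactions of Yetter-Drinfeld modules
(`IsYetterDrinfeld.twistBy_coact`), the second those of `_R H`-comodules, as these have values in
`_R H ⊗_t M`. So `F` and `G` are inverse to each other on objects.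

The monoidal structure and the braiding are constructed only for Yetter-Drinfeld modules. Their
compatibility condition is replaced by `h₁n₋₁ ⊗ h₂n₀ = (h₁n)₋₁h₂ ⊗ (h₁n)₀`, which does not involve
the antipode (`IsCrossed`, `IsYetterDrinfeld.isCrossed`, `IsCrossed.coact_smul`) and passes
directly to tensor products (`IsCrossed.cross_coactTens`). Together with the `H`-linearity and
bijectivity of the constraints this gives the monoidal category (`ydRule_isClosed`,
`CoactionRule.IsClosed.isMonoidal`). The map `u ⊗ v ↦ u₋₁·v ⊗ u₀` is a braiding (`ydBraided`): it
is `H`-linear by the same condition, colinear by `coactTens_ydBraiding`, and it has the inverse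
`v ⊗ u ↦ u₀ ⊗ S⁻¹(u₋₁)·v` by `ydBraiding_ydBraidingInv` and `ydBraidingInv_ydBraiding`.

The twist by `R¹ ⊗ S(R²)` carries the coaction on `U ⊗_t V` and on `H_t` in one category to that
in the other (`comoduleRule_tensor`, `comoduleRule_unit`). What has been proved so far is the
hypothesis of `IsTwistEquiv` (`isTwistEquiv`), under which the closedness under tensor products, the
equivalence of categories and its monoidal structure with identity structure maps follow formally
(`IsTwistEquiv.isClosed`, `IsTwistEquiv.equivalence`, `IsTwistEquiv.coreMonoidal`). The braiding of
`_R H`-comodules is the braiding of the Yetter-Drinfeld modules obtained by `F`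
(`comoduleBraided`); since `F` is faithful and monoidal, the hexagon identities are inherited, and
the formulas for the braiding and its inverse are those for Yetter-Drinfeld modules with
`u₋₁R² ⊗ R¹·u₀` in place of the coaction.
-/

namespace WeakHopfAlgebra

/-! ### Shortcut instances for linear maps and rings `A ⊗ B` -/

section ShortcutInstances

-- These instances are found by unification alone and spare `simp` long searches through the
-- hierarchy of algebraic classes.

variable {k : Type w} [Field k]

instance instZeroHomClassLinearMap {M N : Type*} [AddCommGroup M] [Module k M] [AddCommGroup N]
    [Module k N] : ZeroHomClass (M →ₗ[k] N) M N := inferInstance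

instance instZeroHomClassLinearEquiv {M N : Type*} [AddCommGroup M] [Module k M] [AddCommGroup N]
    [Module k N] : ZeroHomClass (M ≃ₗ[k] N) M N := inferInstance

instance instAddHomClassLinearEquiv {M N : Type*} [AddCommGroup M] [Module k M] [AddCommGroup N]
    [Module k N] : AddHomClass (M ≃ₗ[k] N) M N := inferInstance

variable {A B : Type*} [Ring A] [Algebra k A] [Ring B] [Algebra k B]

instance instNonUnitalNonAssocSemiringTensorProduct : NonUnitalNonAssocSemiring (A ⊗[k] B) :=
  inferInstance

instance instNonUnitalSemiringTensorProduct : NonUnitalSemiring (A ⊗[k] B) := inferInstance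

instance instSemigroupTensorProduct : Semigroup (A ⊗[k] B) := inferInstance

instance instMulTensorProduct : Mul (A ⊗[k] B) := inferInstance

instance instOneTensorProduct : One (A ⊗[k] B) := inferInstance

end ShortcutInstances

/-! ### Maps given by multilinear expressions -/

section Multilinear

variable {k : Type w} [Field k] {A B C D : Type*} [AddCommGroup A] [Module k A]
  [AddCommGroup B] [Module k B] [AddCommGroup C] [Module k C] [AddCommGroup D] [Module k D]

/-- `LinearMap.mk₂` with the four linearity proofs found by `simp`. -/
def bilin (f : A → B → D)
    (h₁ : ∀ a a' b, f (a + a') b = f a b + f a' b := by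
      as_aux_lemma =>
      intros
      first
      | simp only [map_add, add_mul, mul_add, add_smul, smul_add, TensorProduct.add_tmul,
          TensorProduct.tmul_add, LinearMap.add_apply]; done
      | simp [add_mul, mul_add, add_smul, TensorProduct.add_tmul, TensorProduct.tmul_add])
    (h₂ : ∀ (c : k) a b, f (c • a) b = c • f a b := by
      as_aux_lemma =>
      intros
      first
      | simp only [map_smul, smul_mul_assoc, mul_smul_comm, ← TensorProduct.smul_tmul',
          TensorProduct.tmul_smul, LinearMap.smul_apply, smul_assoc, smul_eq_mul]; done
      | simp only [map_smul, smul_mul_assoc, mul_smul_comm, ← TensorProduct.smul_tmul',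
          TensorProduct.tmul_smul, LinearMap.smul_apply, smul_assoc, smul_eq_mul, smul_smul,
          mul_comm, mul_left_comm]; done
      | simp [← TensorProduct.smul_tmul', smul_algebra_smul_comm])
    (h₃ : ∀ a b b', f a (b + b') = f a b + f a b' := by
      as_aux_lemma =>
      intros
      first
      | simp only [map_add, add_mul, mul_add, add_smul, smul_add, TensorProduct.add_tmul,
          TensorProduct.tmul_add, LinearMap.add_apply]; done
      | simp [add_mul, mul_add, add_smul, TensorProduct.add_tmul, TensorProduct.tmul_add])
    (h₄ : ∀ (c : k) a b, f a (c • b) = c • f a b := by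
      as_aux_lemma =>
      intros
      first
      | simp only [map_smul, smul_mul_assoc, mul_smul_comm, ← TensorProduct.smul_tmul',
          TensorProduct.tmul_smul, LinearMap.smul_apply, smul_assoc, smul_eq_mul]; done
      | simp only [map_smul, smul_mul_assoc, mul_smul_comm, ← TensorProduct.smul_tmul',
          TensorProduct.tmul_smul, LinearMap.smul_apply, smul_assoc, smul_eq_mul, smul_smul,
          mul_comm, mul_left_comm]; done
      | simp [← TensorProduct.smul_tmul', smul_algebra_smul_comm]) :
    A →ₗ[k] B →ₗ[k] D :=
  LinearMap.mk₂ k f h₁ h₂ h₃ h₄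

/-- The trilinear analogue of `bilin`. -/
def trilin (f : A → B → C → D)
    (h₁ : ∀ a a' b c, f (a + a') b c = f a b c + f a' b c := by
      as_aux_lemma =>
      intros
      first
      | simp only [map_add, add_mul, mul_add, add_smul, smul_add, TensorProduct.add_tmul,
          TensorProduct.tmul_add, LinearMap.add_apply]; done
      | simp [add_mul, mul_add, add_smul, TensorProduct.add_tmul, TensorProduct.tmul_add])
    (h₂ : ∀ (r : k) a b c, f (r • a) b c = r • f a b c := by
      as_aux_lemma =>
      intros
      first
      | simp only [map_smul, smul_mul_assoc, mul_smul_comm, ← TensorProduct.smul_tmul',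
          TensorProduct.tmul_smul, LinearMap.smul_apply, smul_assoc, smul_eq_mul]; done
      | simp only [map_smul, smul_mul_assoc, mul_smul_comm, ← TensorProduct.smul_tmul',
          TensorProduct.tmul_smul, LinearMap.smul_apply, smul_assoc, smul_eq_mul, smul_smul,
          mul_comm, mul_left_comm]; done
      | simp [← TensorProduct.smul_tmul', smul_algebra_smul_comm])
    (h₃ : ∀ a b b' c, f a (b + b') c = f a b c + f a b' c := by
      as_aux_lemma =>
      intros
      first
      | simp only [map_add, add_mul, mul_add, add_smul, smul_add, TensorProduct.add_tmul,
          TensorProduct.tmul_add, LinearMap.add_apply]; done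
      | simp [add_mul, mul_add, add_smul, TensorProduct.add_tmul, TensorProduct.tmul_add])
    (h₄ : ∀ (r : k) a b c, f a (r • b) c = r • f a b c := by
      as_aux_lemma =>
      intros
      first
      | simp only [map_smul, smul_mul_assoc, mul_smul_comm, ← TensorProduct.smul_tmul',
          TensorProduct.tmul_smul, LinearMap.smul_apply, smul_assoc, smul_eq_mul]; done
      | simp only [map_smul, smul_mul_assoc, mul_smul_comm, ← TensorProduct.smul_tmul',
          TensorProduct.tmul_smul, LinearMap.smul_apply, smul_assoc, smul_eq_mul, smul_smul,
          mul_comm, mul_left_comm]; done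
      | simp [← TensorProduct.smul_tmul', smul_algebra_smul_comm])
    (h₅ : ∀ a b c c', f a b (c + c') = f a b c + f a b c' := by
      as_aux_lemma =>
      intros
      first
      | simp only [map_add, add_mul, mul_add, add_smul, smul_add, TensorProduct.add_tmul,
          TensorProduct.tmul_add, LinearMap.add_apply]; done
      | simp [add_mul, mul_add, add_smul, TensorProduct.add_tmul, TensorProduct.tmul_add])
    (h₆ : ∀ (r : k) a b c, f a b (r • c) = r • f a b c := by
      as_aux_lemma =>
      intros
      first
      | simp only [map_smul, smul_mul_assoc, mul_smul_comm, ← TensorProduct.smul_tmul',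
          TensorProduct.tmul_smul, LinearMap.smul_apply, smul_assoc, smul_eq_mul]; done
      | simp only [map_smul, smul_mul_assoc, mul_smul_comm, ← TensorProduct.smul_tmul',
          TensorProduct.tmul_smul, LinearMap.smul_apply, smul_assoc, smul_eq_mul, smul_smul,
          mul_comm, mul_left_comm]; done
      | simp [← TensorProduct.smul_tmul', smul_algebra_smul_comm]) :
    A →ₗ[k] B →ₗ[k] C →ₗ[k] D :=
  LinearMap.mk₂ k (fun a b => ⟨⟨f a b, h₅ a b⟩, fun r => h₆ r a b⟩)
    (fun a a' b => LinearMap.ext fun c => h₁ a a' b c)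
    (fun r a b => LinearMap.ext fun c => h₂ r a b c)
    (fun a b b' => LinearMap.ext fun c => h₃ a b b' c)
    (fun r a b => LinearMap.ext fun c => h₄ r a b c)

variable (f : A → B → D) (g : A → B → C → D)

@[simp] theorem bilin_apply (h₁ h₂ h₃ h₄) (a : A) (b : B) :
    bilin (k := k) f h₁ h₂ h₃ h₄ a b = f a b := rfl

@[simp] theorem trilin_apply (h₁ h₂ h₃ h₄ h₅ h₆) (a : A) (b : B) (c : C) :
    trilin (k := k) g h₁ h₂ h₃ h₄ h₅ h₆ a b c = g a b c := rfl

/-- The linear map on `A ⊗ B` given by a bilinear expression. -/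
noncomputable def lift₂ (F : A →ₗ[k] B →ₗ[k] D) : A ⊗[k] B →ₗ[k] D := TensorProduct.lift F

/-- The linear map on `A ⊗ (B ⊗ C)` given by a trilinear expression. -/
noncomputable def lift₃ (G : A →ₗ[k] B →ₗ[k] C →ₗ[k] D) : A ⊗[k] (B ⊗[k] C) →ₗ[k] D :=
  TensorProduct.lift (TensorProduct.uncurry (RingHom.id k) B C D ∘ₗ G)

@[simp] theorem lift₂_tmul (F : A →ₗ[k] B →ₗ[k] D) (a : A) (b : B) :
    lift₂ F (a ⊗ₜ b) = F a b := rfl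

@[simp] theorem lift₃_tmul (G : A →ₗ[k] B →ₗ[k] C →ₗ[k] D) (a : A) (b : B) (c : C) :
    lift₃ G (a ⊗ₜ (b ⊗ₜ c)) = G a b c := rfl

theorem lift₂_congr {F F' : A →ₗ[k] B →ₗ[k] D} (t : A ⊗[k] B) (h : ∀ a b, F a b = F' a b) :
    lift₂ F t = lift₂ F' t := by
  rw [show F = F' from LinearMap.ext₂ h]

theorem map_lift₂ {E : Type*} [AddCommGroup E] [Module k E] {F : A →ₗ[k] B →ₗ[k] D}
    {F' : A →ₗ[k] B →ₗ[k] E} (L : D →ₗ[k] E) (t : A ⊗[k] B) (h : ∀ a b, L (F a b) = F' a b) :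
    L (lift₂ F t) = lift₂ F' t := by
  induction t with
  | zero => simp
  | add x y hx hy => simp only [map_add, hx, hy]
  | tmul a b => exact h a b

end Multilinear

/-! ### Sweedler notation -/

section Sweedler

variable {k : Type w} {H : Type u} [Field k] [Ring H] [Algebra k H]
  {N D : Type*} [AddCommGroup N] [Module k N] [AddCommGroup D] [Module k D]

/-- Right multiplication on the first factor of `H ⊗ N`, linear in the multiplier. -/
noncomputable def rmul (N : Type*) [AddCommGroup N] [Module k N] :
    H →ₗ[k] Module.End k (H ⊗[k] N) :=
  LinearMap.rTensorHom N ∘ₗ (LinearMap.mul k H).flip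

/-- Left multiplication on the first factor of `H ⊗ N`, linear in the multiplier. -/
noncomputable def lmul (N : Type*) [AddCommGroup N] [Module k N] :
    H →ₗ[k] Module.End k (H ⊗[k] N) :=
  LinearMap.rTensorHom N ∘ₗ LinearMap.mul k H

@[simp] theorem rmul_tmul (a x : H) (n : N) : rmul (k := k) N a (x ⊗ₜ n) = (x * a) ⊗ₜ n := rfl

@[simp] theorem lmul_tmul (a x : H) (n : N) : lmul (k := k) N a (x ⊗ₜ n) = (a * x) ⊗ₜ n := rfl

/-- Coassociativity in Sweedler form: `∑ G(n₋₂, n₋₁, n₀)` may be computed by splitting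
either factor of `ρ(n)`. -/
theorem sum_coassoc [Coalgebra k H] {ρ : N →ₗ[k] H ⊗[k] N}
    (hρ : ∀ n, ρ.lTensor H (ρ n) =
      TensorProduct.assoc k H H N ((Coalgebra.comul (R := k)).rTensor N (ρ n)))
    (F₁ F₂ : H →ₗ[k] N →ₗ[k] D) (G : H →ₗ[k] H →ₗ[k] N →ₗ[k] D)
    (h₁ : ∀ a n, F₁ a n = lift₂ G (Coalgebra.comul a) n)
    (h₂ : ∀ a n, F₂ a n = lift₂ (G a) (ρ n)) (n : N) :
    lift₂ F₁ (ρ n) = lift₂ F₂ (ρ n) := by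
  have e₁ : ∀ y : H ⊗[k] N, lift₂ F₁ y = lift₃ G (TensorProduct.assoc k H H N
      ((Coalgebra.comul (R := k)).rTensor N y)) := by
    intro y
    induction y with
    | zero => simp
    | add y z hy hz => simp only [map_add, hy, hz]
    | tmul a n =>
      rw [lift₂_tmul, h₁, LinearMap.rTensor_tmul]
      induction Coalgebra.comul (R := k) a with
      | zero => simp
      | add y z hy hz => simp only [map_add, hy, hz, TensorProduct.add_tmul, LinearMap.add_apply]
      | tmul b c => simp
  have e₂ : ∀ y : H ⊗[k] N, lift₂ F₂ y = lift₃ G (ρ.lTensor H y) := by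
    intro y
    induction y with
    | zero => simp
    | add y z hy hz => simp only [map_add, hy, hz]
    | tmul a n =>
      rw [lift₂_tmul, h₂, LinearMap.lTensor_tmul]
      induction ρ n with
      | zero => simp
      | add y z hy hz => simp only [map_add, hy, hz, TensorProduct.tmul_add]
      | tmul b c => simp
  rw [e₁, e₂, hρ]

/-- The case `ρ = Δ` of `sum_coassoc`. -/
theorem sum_comul_comul [Coalgebra k H]
    (F₁ F₂ : H →ₗ[k] H →ₗ[k] D) (G : H →ₗ[k] H →ₗ[k] H →ₗ[k] D)
    (h₁ : ∀ a b, F₁ a b = lift₂ G (Coalgebra.comul (R := k) a) b)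
    (h₂ : ∀ a b, F₂ a b = lift₂ (G a) (Coalgebra.comul (R := k) b)) (h : H) :
    lift₂ F₁ (Coalgebra.comul (R := k) h) = lift₂ F₂ (Coalgebra.comul (R := k) h) :=
  have hΔ : ∀ n : H, (Coalgebra.comul (R := k)).lTensor H (Coalgebra.comul (R := k) n) =
      TensorProduct.assoc k H H H ((Coalgebra.comul (R := k)).rTensor H
        (Coalgebra.comul (R := k) n)) := fun n => (Coalgebra.coassoc_apply n).symm
  sum_coassoc (N := H) (ρ := Coalgebra.comul (R := k)) hΔ F₁ F₂ G h₁ h₂ h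

end Sweedler

/-! ### The target and source maps of a weak Hopf algebra -/

section Basics

variable {k : Type w} {H : Type u} [Field k] [Ring H] [Algebra k H] [WeakHopfAlgebra k H]

local notation "Δ" => Coalgebra.comul (R := k) (A := H)
local notation "ϵ" => Coalgebra.counit (R := k) (A := H)
local notation "εt" => targetMap k H
local notation "εs" => sourceMap k H

theorem targetMap_eq_sum (h : H) : εt h = lift₂ (bilin fun a b => ϵ (a * h) • b) (Δ 1) := by
  simp only [targetMap, LinearMap.comp_apply, LinearMap.mulLeft_apply]
  induction Δ 1 with
  | zero => simp
  | add x y hx hy => simp only [add_mul, map_add, hx, hy]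
  | tmul a b => simp

theorem sourceMap_eq_sum (h : H) : εs h = lift₂ (bilin fun a b => ϵ (h * b) • a) (Δ 1) := by
  simp only [sourceMap, LinearMap.comp_apply, LinearMap.mulRight_apply]
  induction Δ 1 with
  | zero => simp
  | add x y hx hy => simp only [mul_add, map_add, hx, hy]
  | tmul a b => simp

theorem sum_counit_left (h : H) : lift₂ (bilin fun a b => ϵ a • b) (Δ h) = h := by
  have e : ∀ t : H ⊗[k] H, lift₂ (bilin fun a b => ϵ a • b) t =
      TensorProduct.lid k H ((ϵ).rTensor H t) := by
    intro t
    induction t with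
    | zero => simp
    | add x y hx hy => simp only [map_add, hx, hy]
    | tmul a b => simp
  rw [e, Coalgebra.rTensor_counit_comul]
  simp

theorem sum_counit_right (h : H) : lift₂ (bilin fun a b => ϵ b • a) (Δ h) = h := by
  have e : ∀ t : H ⊗[k] H, lift₂ (bilin fun a b => ϵ b • a) t =
      TensorProduct.rid k H ((ϵ).lTensor H t) := by
    intro t
    induction t with
    | zero => simp
    | add x y hx hy => simp only [map_add, hx, hy]
    | tmul a b => simp
  rw [e, Coalgebra.lTensor_counit_comul]
  simp

theorem comul_one_mul (h : H) : Δ 1 * Δ h = Δ h := by rw [← comul_mul, one_mul]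

theorem comul_mul_one (h : H) : Δ h * Δ 1 = Δ h := by rw [← comul_mul, mul_one]

omit [WeakHopfAlgebra k H] in
theorem assoc_mul (x y : (H ⊗[k] H) ⊗[k] H) : TensorProduct.assoc k H H H (x * y) =
    TensorProduct.assoc k H H H x * TensorProduct.assoc k H H H y :=
  map_mul (Algebra.TensorProduct.assoc k k k H H H) x y

theorem comul_rTensor_mul (x y : H ⊗[k] H) :
    (Δ).rTensor H (x * y) = (Δ).rTensor H x * (Δ).rTensor H y := by
  induction x with
  | zero => simp
  | add x x' hx hx' => simp only [add_mul, map_add, hx, hx']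
  | tmul a b =>
    induction y with
    | zero => simp
    | add y y' hy hy' => simp only [mul_add, map_add, hy, hy']
    | tmul c d => simp [comul_mul]

theorem comul_lTensor_mul (x y : H ⊗[k] H) :
    (Δ).lTensor H (x * y) = (Δ).lTensor H x * (Δ).lTensor H y := by
  induction x with
  | zero => simp
  | add x x' hx hx' => simp only [add_mul, map_add, hx, hx']
  | tmul a b =>
    induction y with
    | zero => simp
    | add y y' hy hy' => simp only [mul_add, map_add, hy, hy']
    | tmul c d => simp [comul_mul]

theorem coassoc' (h : H) :
    TensorProduct.assoc k H H H ((Δ).rTensor H (Δ h)) = (Δ).lTensor H (Δ h) :=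
  Coalgebra.coassoc_apply h

/-- `ε` applied to the middle factor undoes `Δ ⊗ id`. -/
theorem counit_middle_rTensor (t : H ⊗[k] H) :
    lift₃ (trilin fun a b c : H => ϵ b • (a ⊗ₜ[k] c))
      (TensorProduct.assoc k H H H ((Δ).rTensor H t)) = t := by
  induction t with
  | zero => simp
  | add x y hx hy => simp only [map_add, hx, hy]
  | tmul x y =>
    have : ∀ s : H ⊗[k] H, lift₃ (trilin fun a b c : H => ϵ b • (a ⊗ₜ[k] c))
        (TensorProduct.assoc k H H H (s ⊗ₜ y)) =
        (lift₂ (bilin fun a b => ϵ b • a) s) ⊗ₜ y := by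
      intro s
      induction s with
      | zero => simp
      | add x y hx hy => simp only [TensorProduct.add_tmul, map_add, hx, hy]
      | tmul a b => simp [TensorProduct.smul_tmul']
    rw [LinearMap.rTensor_tmul, this, sum_counit_right]

/-- `ε` applied to the middle factor undoes `id ⊗ Δ`. -/
theorem counit_middle_lTensor (t : H ⊗[k] H) :
    lift₃ (trilin fun a b c : H => ϵ b • (a ⊗ₜ[k] c)) ((Δ).lTensor H t) = t := by
  induction t with
  | zero => simp
  | add x y hx hy => simp only [map_add, hx, hy]
  | tmul x y =>
    have : ∀ s : H ⊗[k] H, lift₃ (trilin fun a b c : H => ϵ b • (a ⊗ₜ[k] c))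
        (x ⊗ₜ s) = x ⊗ₜ (lift₂ (bilin fun a b => ϵ a • b) s) := by
      intro s
      induction s with
      | zero => simp
      | add x y hx hy => simp only [TensorProduct.tmul_add, map_add, hx, hy]
      | tmul a b => simp
    rw [LinearMap.lTensor_tmul, this, sum_counit_left]

/-- `h₁ ⊗ ε_t(h₂) = 1₁h ⊗ 1₂` -/
theorem lTensor_targetMap_comul (h : H) : (εt).lTensor H (Δ h) = Δ 1 * (h ⊗ₜ 1) := by
  have e : TensorProduct.assoc k H H H ((Δ).rTensor H (Δ 1 * (h ⊗ₜ 1))) =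
      ((1 : H) ⊗ₜ Δ 1) * TensorProduct.assoc k H H H (Δ h ⊗ₜ (1 : H)) := by
    rw [comul_rTensor_mul, assoc_mul, coassoc', comul_one_right, mul_assoc, ← assoc_mul,
      LinearMap.rTensor_tmul, Algebra.TensorProduct.tmul_mul_tmul, comul_one_mul, one_mul]
  rw [← counit_middle_rTensor (Δ 1 * (h ⊗ₜ 1)), e]
  induction Δ h with
  | zero => simp
  | add x y hx hy => simp only [TensorProduct.add_tmul, map_add, hx, hy, mul_add]
  | tmul a b =>
    rw [LinearMap.lTensor_tmul, targetMap_eq_sum]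
    induction Δ 1 with
    | zero => simp
    | add x y hx hy => simp only [TensorProduct.tmul_add, map_add, hx, hy, add_mul]
    | tmul c d => simp

/-- `ε_s(h₁) ⊗ h₂ = 1₁ ⊗ h1₂` -/
theorem rTensor_sourceMap_comul (h : H) : (εs).rTensor H (Δ h) = (1 ⊗ₜ h) * Δ 1 := by
  have e : (Δ).lTensor H ((1 ⊗ₜ h) * Δ 1) =
      ((1 : H) ⊗ₜ Δ h) * TensorProduct.assoc k H H H (Δ 1 ⊗ₜ (1 : H)) := by
    rw [comul_lTensor_mul, comul_one_right, ← mul_assoc,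
      LinearMap.lTensor_tmul, Algebra.TensorProduct.tmul_mul_tmul, comul_mul_one, one_mul]
  rw [← counit_middle_lTensor ((1 ⊗ₜ h) * Δ 1), e]
  induction Δ h with
  | zero => simp
  | add x y hx hy => simp only [TensorProduct.tmul_add, map_add, hx, hy, add_mul]
  | tmul a b =>
    rw [LinearMap.rTensor_tmul, sourceMap_eq_sum]
    induction Δ 1 with
    | zero => simp
    | add x y hx hy => simp only [TensorProduct.add_tmul, map_add, hx, hy, mul_add]
    | tmul c d => simp [TensorProduct.smul_tmul']

/-- `ε(ah₁)h₂ = ε(a1₁)1₂h`. With `ν = ε(a1₁)1₂`, the axiom for `ε(abc)` gives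
`ε(a1₁p)1₂q = ε(ν₁p)ν₂q` for all `p ⊗ q`; take `p ⊗ q = Δ(h)` and use `Δ(ν)Δ(h) = Δ(νh)`. -/
theorem sum_counit_mul_left (a h : H) :
    lift₂ (bilin fun p q => ϵ (a * p) • q) (Δ h) =
      lift₂ (bilin fun p q => ϵ (a * p) • q) (Δ 1) * h := by
  set ν := lift₂ (bilin fun p q => ϵ (a * p) • q) (Δ 1)
  have key : ∀ s : H ⊗[k] H, lift₂ (bilin fun p q => ϵ (a * p) • q) (Δ 1 * s) =
      lift₂ (bilin fun p q : H => ϵ p • q) (Δ ν * s) := by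
    intro s
    induction s with
    | zero => simp
    | add x y hx hy => simp only [mul_add, map_add, hx, hy]
    | tmul x y =>
      have e₁ : ∀ t : H ⊗[k] H, lift₂ (bilin fun p q => ϵ (a * p) • q) (t * (x ⊗ₜ y)) =
          lift₂ (bilin fun p q => ϵ (a * p * x) • (q * y)) t := by
        intro t
        induction t with
        | zero => simp
        | add x y hx hy => simp only [add_mul, map_add, hx, hy]
        | tmul p q => simp [mul_assoc]
      have e₂ : ∀ t : H ⊗[k] H, lift₂ (bilin fun p q : H => ϵ p • q) (t * (x ⊗ₜ y)) =
          lift₂ (bilin fun p q => ϵ (p * x) • (q * y)) t := by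
        intro t
        induction t with
        | zero => simp
        | add x y hx hy => simp only [add_mul, map_add, hx, hy]
        | tmul p q => simp
      rw [e₁, e₂]
      let L : H →ₗ[k] H := lift₂ (bilin fun p q => ϵ (p * x) • (q * y)) ∘ₗ Δ
      change _ = L ν
      rw [map_lift₂ (F' := bilin fun p q => ϵ (a * p) • L q) L (Δ 1) (by simp)]
      refine sum_comul_comul _ _
        (trilin fun p q r => (ϵ (a * p) * ϵ (q * x)) • (r * y)) ?_ ?_ 1
      · intro p r
        rw [bilin_apply, counit_mul_left]
        induction Δ p with
        | zero => simp
        | add x y hx hy => simp only [add_smul, map_add, hx, hy, LinearMap.add_apply]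
        | tmul p q => simp
      · intro p q
        simp only [bilin_apply, L, LinearMap.comp_apply]
        induction Δ q with
        | zero => simp
        | add x y hx hy => simp only [smul_add, map_add, hx, hy]
        | tmul p q => simp [mul_smul]
  have := key (Δ h)
  rwa [← comul_mul, ← comul_mul, one_mul, sum_counit_left] at this

/-- `ε(h₂a)h₁ = hε(1₂a)1₁` -/
theorem sum_counit_mul_right (a h : H) :
    lift₂ (bilin fun p q => ϵ (q * a) • p) (Δ h) =
      h * lift₂ (bilin fun p q => ϵ (q * a) • p) (Δ 1) := by
  set ν := lift₂ (bilin fun p q => ϵ (q * a) • p) (Δ 1)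
  have key : ∀ s : H ⊗[k] H, lift₂ (bilin fun p q => ϵ (q * a) • p) (s * Δ 1) =
      lift₂ (bilin fun p q : H => ϵ q • p) (s * Δ ν) := by
    intro s
    induction s with
    | zero => simp
    | add x y hx hy => simp only [add_mul, map_add, hx, hy]
    | tmul x y =>
      have e₁ : ∀ t : H ⊗[k] H, lift₂ (bilin fun p q => ϵ (q * a) • p) ((x ⊗ₜ y) * t) =
          lift₂ (bilin fun p q => ϵ (y * q * a) • (x * p)) t := by
        intro t
        induction t with
        | zero => simp
        | add x y hx hy => simp only [mul_add, map_add, hx, hy]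
        | tmul p q => simp
      have e₂ : ∀ t : H ⊗[k] H, lift₂ (bilin fun p q : H => ϵ q • p) ((x ⊗ₜ y) * t) =
          lift₂ (bilin fun p q => ϵ (y * q) • (x * p)) t := by
        intro t
        induction t with
        | zero => simp
        | add x y hx hy => simp only [mul_add, map_add, hx, hy]
        | tmul p q => simp
      rw [e₁, e₂]
      let L : H →ₗ[k] H := lift₂ (bilin fun p q => ϵ (y * q) • (x * p)) ∘ₗ Δ
      change _ = L ν
      rw [map_lift₂ (F' := bilin fun p q => ϵ (q * a) • L p) L (Δ 1) (by simp)]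
      refine (sum_comul_comul _ _
        (trilin fun p q r => (ϵ (y * q) * ϵ (r * a)) • (x * p)) ?_ ?_ 1).symm
      · intro p q
        simp only [bilin_apply, L, LinearMap.comp_apply]
        induction Δ p with
        | zero => simp
        | add x y hx hy => simp only [smul_add, map_add, hx, hy, LinearMap.add_apply]
        | tmul p q => simp [smul_smul, mul_comm]
      · intro p r
        rw [bilin_apply, counit_mul_left]
        induction Δ r with
        | zero => simp
        | add x y hx hy => simp only [add_smul, map_add, hx, hy]
        | tmul p q => simp
  have := key (Δ h)
  rwa [← comul_mul, ← comul_mul, mul_one, sum_counit_right] at this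

/-- `ε_t(h₁) ⊗ h₂ = ε_t(1₁) ⊗ 1₂h` -/
theorem rTensor_targetMap_comul (h : H) :
    (εt).rTensor H (Δ h) = (εt).rTensor H (Δ 1) * (1 ⊗ₜ h) := by
  have e : εt = lift₂ (trilin fun a b p => ϵ (a * p) • b) (Δ 1) := by
    ext p
    rw [targetMap_eq_sum]
    induction Δ 1 with
    | zero => simp
    | add x y hx hy => simp only [map_add, LinearMap.add_apply, hx, hy]
    | tmul a b => simp
  have pure : ∀ (a b : H) (t : H ⊗[k] H), ((trilin fun a b p : H => ϵ (a * p) • b) a b).rTensor H t =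
      b ⊗ₜ lift₂ (bilin fun p q => ϵ (a * p) • q) t := by
    intro a b t
    induction t with
    | zero => simp
    | add x y hx hy => simp only [map_add, TensorProduct.tmul_add, hx, hy]
    | tmul p q => simp [TensorProduct.smul_tmul']
  rw [e]
  have : ∀ t : H ⊗[k] H, (lift₂ (trilin fun a b p : H => ϵ (a * p) • b) t).rTensor H (Δ h) =
      (lift₂ (trilin fun a b p : H => ϵ (a * p) • b) t).rTensor H (Δ 1) * (1 ⊗ₜ h) := by
    intro t
    induction t with
    | zero => simp
    | add x y hx hy => simp only [map_add, LinearMap.rTensor_add, LinearMap.add_apply, hx, hy, add_mul]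
    | tmul a b => rw [lift₂_tmul, pure, pure, sum_counit_mul_left, Algebra.TensorProduct.tmul_mul_tmul, mul_one]
  exact this _

/-- `h₁ ⊗ ε_s(h₂) = h1₁ ⊗ ε_s(1₂)` -/
theorem lTensor_sourceMap_comul (h : H) :
    (εs).lTensor H (Δ h) = (h ⊗ₜ 1) * (εs).lTensor H (Δ 1) := by
  have e : εs = lift₂ (trilin fun a b p => ϵ (p * b) • a) (Δ 1) := by
    ext p
    rw [sourceMap_eq_sum]
    induction Δ 1 with
    | zero => simp
    | add x y hx hy => simp only [map_add, LinearMap.add_apply, hx, hy]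
    | tmul a b => simp
  have pure : ∀ (a b : H) (t : H ⊗[k] H), ((trilin fun a b p : H => ϵ (p * b) • a) a b).lTensor H t =
      lift₂ (bilin fun p q => ϵ (q * b) • p) t ⊗ₜ a := by
    intro a b t
    induction t with
    | zero => simp
    | add x y hx hy => simp only [map_add, TensorProduct.add_tmul, hx, hy]
    | tmul p q => simp [TensorProduct.smul_tmul']
  rw [e]
  have : ∀ t : H ⊗[k] H, (lift₂ (trilin fun a b p : H => ϵ (p * b) • a) t).lTensor H (Δ h) =
      (h ⊗ₜ 1) * (lift₂ (trilin fun a b p : H => ϵ (p * b) • a) t).lTensor H (Δ 1) := by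
    intro t
    induction t with
    | zero => simp
    | add x y hx hy => simp only [map_add, LinearMap.lTensor_add, LinearMap.add_apply, hx, hy, mul_add]
    | tmul a b => rw [lift₂_tmul, pure, pure, sum_counit_mul_right, Algebra.TensorProduct.tmul_mul_tmul, one_mul]
  exact this _

end Basics

/-! ### The convolution product -/

section Convolution

variable {k : Type w} [Field k] {C A : Type*} [AddCommGroup C] [Module k C] [Coalgebra k C]
  [Ring A] [Algebra k A]

/-- The convolution product `(f * g)(c) = f(c₁)g(c₂)`. -/
noncomputable def conv (f g : C →ₗ[k] A) : C →ₗ[k] A :=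
  LinearMap.mul' k A ∘ₗ TensorProduct.map f g ∘ₗ Coalgebra.comul

theorem conv_apply (f g : C →ₗ[k] A) (c : C) :
    conv f g c = LinearMap.mul' k A (TensorProduct.map f g (Coalgebra.comul c)) := rfl

theorem conv_assoc (f g h : C →ₗ[k] A) : conv (conv f g) h = conv f (conv g h) :=
  congrArg WithConv.ofConv
    (mul_assoc (WithConv.toConv f) (WithConv.toConv g) (WithConv.toConv h))

end Convolution

/-! ### The target and source spaces -/

section Antipode

variable {k : Type w} {H : Type u} [Field k] [Ring H] [Algebra k H] [WeakHopfAlgebra k H]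

variable (k H) in
/-- The source space `H_s`. -/
noncomputable abbrev sourceSpace : Submodule k H := LinearMap.range (sourceMap k H)

local notation "Δ" => Coalgebra.comul (R := k) (A := H)
local notation "ϵ" => Coalgebra.counit (R := k) (A := H)
local notation "𝒮" => antipode (k := k) (H := H)
local notation "εt" => targetMap k H
local notation "εs" => sourceMap k H
local notation "Hₜ" => targetSpace k H
local notation "Hₛ" => sourceSpace k H

theorem targetMap_mem (h : H) : εt h ∈ Hₜ := LinearMap.mem_range_self _ h

theorem sourceMap_mem (h : H) : εs h ∈ Hₛ := LinearMap.mem_range_self _ h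

theorem targetMap_one : εt 1 = 1 := by
  rw [targetMap_eq_sum, lift₂_congr (F' := bilin fun a b => ϵ a • b) _ (by simp), sum_counit_left]

theorem sourceMap_one : εs 1 = 1 := by
  rw [sourceMap_eq_sum, lift₂_congr (F' := bilin fun a b => ϵ b • a) _ (by simp), sum_counit_right]

theorem one_mem_target : (1 : H) ∈ Hₜ := ⟨1, targetMap_one⟩

theorem one_mem_source : (1 : H) ∈ Hₛ := ⟨1, sourceMap_one⟩

theorem targetMap_targetMap (h : H) : εt (εt h) = εt h := by
  simpa using targetMap_mul_targetMap k H 1 h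

theorem targetMap_of_mem {z : H} (hz : z ∈ Hₜ) : εt z = z := by
  obtain ⟨h, rfl⟩ := hz
  exact targetMap_targetMap h

theorem counit_sourceMap_mul (g h : H) : ϵ (εs g * h) = ϵ (g * h) := by
  have key := counit_mul_right (k := k) g 1 h
  rw [mul_one] at key
  rw [key, sourceMap_eq_sum]
  induction Δ 1 with
  | zero => simp
  | add x y hx hy => simp only [map_add, add_mul, hx, hy]
  | tmul a b => simp [mul_comm]

theorem sourceMap_sourceMap_mul (g h : H) : εs (εs g * h) = εs (g * h) := by
  rw [sourceMap_eq_sum, sourceMap_eq_sum (g * h)]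
  exact lift₂_congr _ fun a b => by simp [mul_assoc, counit_sourceMap_mul]

theorem comul_of_mem_target' {z : H} (hz : z ∈ Hₜ) : Δ z = Δ 1 * (z ⊗ₜ 1) := by
  obtain ⟨h, rfl⟩ := hz
  have e₁ : ∀ t : H ⊗[k] H, Δ (lift₂ (bilin fun a b => ϵ (a * h) • b) t) =
      lift₃ (trilin fun a b c => ϵ (a * h) • (b ⊗ₜ[k] c)) ((Δ).lTensor H t) := by
    intro t
    induction t with
    | zero => simp
    | add x y hx hy => simp only [map_add, hx, hy]
    | tmul a b =>
      simp only [lift₂_tmul, bilin_apply, map_smul, LinearMap.lTensor_tmul]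
      induction Δ b with
      | zero => simp
      | add x y hx hy => simp only [TensorProduct.tmul_add, map_add, smul_add, hx, hy]
      | tmul p q => simp
  have e₂ : ∀ s t : H ⊗[k] H, lift₃ (trilin fun a b c => ϵ (a * h) • (b ⊗ₜ[k] c))
      (((1 : H) ⊗ₜ[k] s) * TensorProduct.assoc k H H H (t ⊗ₜ (1 : H))) =
      s * (lift₂ (bilin fun a b => ϵ (a * h) • b) t ⊗ₜ 1) := by
    intro s t
    induction s with
    | zero => simp
    | add x y hx hy => simp only [TensorProduct.tmul_add, map_add, add_mul, hx, hy]
    | tmul p q =>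
      induction t with
      | zero => simp
      | add x y hx hy => simp only [TensorProduct.add_tmul, map_add, mul_add, hx, hy]
      | tmul a b => simp [TensorProduct.smul_tmul']
  rw [targetMap_eq_sum, e₁, comul_one_right, e₂]

theorem comul_of_mem_target {z : H} (hz : z ∈ Hₜ) : Δ z = (z ⊗ₜ 1) * Δ 1 := by
  obtain ⟨h, rfl⟩ := hz
  have e₁ : ∀ t : H ⊗[k] H, Δ (lift₂ (bilin fun a b => ϵ (a * h) • b) t) =
      lift₃ (trilin fun a b c => ϵ (a * h) • (b ⊗ₜ[k] c)) ((Δ).lTensor H t) := by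
    intro t
    induction t with
    | zero => simp
    | add x y hx hy => simp only [map_add, hx, hy]
    | tmul a b =>
      simp only [lift₂_tmul, bilin_apply, map_smul, LinearMap.lTensor_tmul]
      induction Δ b with
      | zero => simp
      | add x y hx hy => simp only [TensorProduct.tmul_add, map_add, smul_add, hx, hy]
      | tmul p q => simp
  have e₂ : ∀ s t : H ⊗[k] H, lift₃ (trilin fun a b c => ϵ (a * h) • (b ⊗ₜ[k] c))
      (TensorProduct.assoc k H H H (t ⊗ₜ (1 : H)) * ((1 : H) ⊗ₜ[k] s)) =
      (lift₂ (bilin fun a b => ϵ (a * h) • b) t ⊗ₜ 1) * s := by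
    intro s t
    induction s with
    | zero => simp
    | add x y hx hy => simp only [TensorProduct.tmul_add, map_add, mul_add, hx, hy]
    | tmul p q =>
      induction t with
      | zero => simp
      | add x y hx hy => simp only [TensorProduct.add_tmul, map_add, add_mul, hx, hy]
      | tmul a b => simp [TensorProduct.smul_tmul']
  rw [targetMap_eq_sum, e₁, comul_one_left, e₂]

theorem comul_of_mem_source' {y : H} (hy : y ∈ Hₛ) : Δ y = Δ 1 * (1 ⊗ₜ y) := by
  obtain ⟨h, rfl⟩ := hy
  have e₁ : ∀ t : H ⊗[k] H, Δ (lift₂ (bilin fun a b => ϵ (h * b) • a) t) =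
      lift₃ (trilin fun a b c => ϵ (h * c) • (a ⊗ₜ[k] b))
        (TensorProduct.assoc k H H H ((Δ).rTensor H t)) := by
    intro t
    induction t with
    | zero => simp
    | add x y hx hy => simp only [map_add, hx, hy]
    | tmul a b =>
      simp only [lift₂_tmul, bilin_apply, map_smul, LinearMap.rTensor_tmul]
      induction Δ a with
      | zero => simp
      | add x y hx hy => simp only [TensorProduct.add_tmul, map_add, smul_add, hx, hy]
      | tmul p q => simp
  have e₂ : ∀ s t : H ⊗[k] H, lift₃ (trilin fun a b c => ϵ (h * c) • (a ⊗ₜ[k] b))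
      (TensorProduct.assoc k H H H (s ⊗ₜ (1 : H)) * ((1 : H) ⊗ₜ[k] t)) =
      s * (1 ⊗ₜ lift₂ (bilin fun a b => ϵ (h * b) • a) t) := by
    intro s t
    induction s with
    | zero => simp
    | add x y hx hy => simp only [TensorProduct.add_tmul, map_add, add_mul, hx, hy]
    | tmul p q =>
      induction t with
      | zero => simp
      | add x y hx hy => simp only [TensorProduct.tmul_add, map_add, mul_add, hx, hy]
      | tmul a b => simp
  rw [sourceMap_eq_sum, e₁, coassoc', comul_one_left, e₂]

theorem comul_of_mem_source {y : H} (hy : y ∈ Hₛ) : Δ y = (1 ⊗ₜ y) * Δ 1 := by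
  obtain ⟨h, rfl⟩ := hy
  have e₁ : ∀ t : H ⊗[k] H, Δ (lift₂ (bilin fun a b => ϵ (h * b) • a) t) =
      lift₃ (trilin fun a b c => ϵ (h * c) • (a ⊗ₜ[k] b))
        (TensorProduct.assoc k H H H ((Δ).rTensor H t)) := by
    intro t
    induction t with
    | zero => simp
    | add x y hx hy => simp only [map_add, hx, hy]
    | tmul a b =>
      simp only [lift₂_tmul, bilin_apply, map_smul, LinearMap.rTensor_tmul]
      induction Δ a with
      | zero => simp
      | add x y hx hy => simp only [TensorProduct.add_tmul, map_add, smul_add, hx, hy]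
      | tmul p q => simp
  have e₂ : ∀ s t : H ⊗[k] H, lift₃ (trilin fun a b c => ϵ (h * c) • (a ⊗ₜ[k] b))
      (((1 : H) ⊗ₜ[k] t) * TensorProduct.assoc k H H H (s ⊗ₜ (1 : H))) =
      (1 ⊗ₜ lift₂ (bilin fun a b => ϵ (h * b) • a) t) * s := by
    intro s t
    induction s with
    | zero => simp
    | add x y hx hy => simp only [TensorProduct.add_tmul, map_add, mul_add, hx, hy]
    | tmul p q =>
      induction t with
      | zero => simp
      | add x y hx hy => simp only [TensorProduct.tmul_add, map_add, add_mul, hx, hy]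
      | tmul a b => simp
  rw [sourceMap_eq_sum, e₁, coassoc', comul_one_right, e₂]

theorem comul_mul_target (h : H) {z : H} (hz : z ∈ Hₜ) : Δ (h * z) = Δ h * (z ⊗ₜ 1) := by
  rw [comul_mul, comul_of_mem_target' hz, ← mul_assoc, comul_mul_one]

theorem comul_target_mul (h : H) {z : H} (hz : z ∈ Hₜ) : Δ (z * h) = (z ⊗ₜ 1) * Δ h := by
  rw [comul_mul, comul_of_mem_target hz, mul_assoc, comul_one_mul]

theorem comul_mul_source (h : H) {y : H} (hy : y ∈ Hₛ) : Δ (h * y) = Δ h * (1 ⊗ₜ y) := by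
  rw [comul_mul, comul_of_mem_source' hy, ← mul_assoc, comul_mul_one]

theorem comul_source_mul (h : H) {y : H} (hy : y ∈ Hₛ) : Δ (y * h) = (1 ⊗ₜ y) * Δ h := by
  rw [comul_mul, comul_of_mem_source hy, mul_assoc, comul_one_mul]

/-- `H_t` and `H_s` commute. -/
theorem target_mul_source {z y : H} (hz : z ∈ Hₜ) (hy : y ∈ Hₛ) : z * y = y * z := by
  obtain ⟨h, rfl⟩ := hy
  have e₁ : ∀ t : H ⊗[k] H, lift₂ (bilin fun a b => ϵ (h * b) • a) ((z ⊗ₜ 1) * t) =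
      z * lift₂ (bilin fun a b => ϵ (h * b) • a) t := by
    intro t
    induction t with
    | zero => simp
    | add x y hx hy => simp only [map_add, mul_add, hx, hy]
    | tmul a b => simp
  have e₂ : ∀ t : H ⊗[k] H, lift₂ (bilin fun a b => ϵ (h * b) • a) (t * (z ⊗ₜ 1)) =
      lift₂ (bilin fun a b => ϵ (h * b) • a) t * z := by
    intro t
    induction t with
    | zero => simp
    | add x y hx hy => simp only [map_add, add_mul, hx, hy]
    | tmul a b => simp
  rw [sourceMap_eq_sum, ← e₁, ← e₂, ← comul_of_mem_target hz, comul_of_mem_target' hz]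

/-! ### Convolution identities for the antipode -/

theorem conv_id_antipode : conv LinearMap.id 𝒮 = εt := LinearMap.ext mul_antipode

theorem conv_antipode_id : conv 𝒮 LinearMap.id = εs := LinearMap.ext antipode_mul

theorem conv_antipode_targetMap : conv 𝒮 εt = 𝒮 := by
  rw [← conv_id_antipode]
  exact LinearMap.ext antipode_mul_antipode

theorem conv_sourceMap_antipode : conv εs 𝒮 = 𝒮 := by
  rw [← conv_antipode_id, conv_assoc, conv_id_antipode, conv_antipode_targetMap]

theorem conv_targetMap_id : conv εt LinearMap.id = LinearMap.id := by
  ext h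
  have : ∀ s : H ⊗[k] H, LinearMap.mul' k H (TensorProduct.map εt LinearMap.id s) =
      lift₂ (bilin fun a b => ϵ a • b) (Δ 1 * s) := by
    intro s
    induction s with
    | zero => simp
    | add x y hx hy => simp only [map_add, mul_add, hx, hy]
    | tmul a b =>
      rw [TensorProduct.map_tmul, LinearMap.mul'_apply, targetMap_eq_sum]
      induction Δ 1 with
      | zero => simp
      | add x y hx hy => simp only [map_add, add_mul, hx, hy]
      | tmul a b => simp
  rw [conv_apply, this, comul_one_mul, sum_counit_left, LinearMap.id_apply]

theorem conv_id_sourceMap : conv LinearMap.id εs = LinearMap.id := by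
  ext h
  have : ∀ s : H ⊗[k] H, LinearMap.mul' k H (TensorProduct.map LinearMap.id εs s) =
      lift₂ (bilin fun a b => ϵ b • a) (s * Δ 1) := by
    intro s
    induction s with
    | zero => simp
    | add x y hx hy => simp only [map_add, add_mul, hx, hy]
    | tmul a b =>
      rw [TensorProduct.map_tmul, LinearMap.mul'_apply, sourceMap_eq_sum]
      induction Δ 1 with
      | zero => simp
      | add x y hx hy => simp only [map_add, mul_add, hx, hy]
      | tmul a b => simp
  rw [conv_apply, this, comul_mul_one, sum_counit_right, LinearMap.id_apply]

theorem targetMap_target_mul {z : H} (hz : z ∈ Hₜ) (h : H) : εt (z * h) = z * εt h := by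
  rw [← mul_antipode, ← mul_antipode, comul_target_mul h hz]
  induction Δ h with
  | zero => simp
  | add x y hx hy => simp only [map_add, mul_add, hx, hy]
  | tmul a b => simp [mul_assoc]

theorem sourceMap_mul_source {y : H} (hy : y ∈ Hₛ) (h : H) : εs (h * y) = εs h * y := by
  rw [← antipode_mul, ← antipode_mul, comul_mul_source h hy]
  induction Δ h with
  | zero => simp
  | add x y hx hy => simp only [map_add, add_mul, hx, hy]
  | tmul a b => simp [mul_assoc]

theorem target_mul_mem {z z' : H} (hz : z ∈ Hₜ) (hz' : z' ∈ Hₜ) : z * z' ∈ Hₜ :=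
  ⟨z * z', by rw [targetMap_target_mul hz, targetMap_of_mem hz']⟩

/-- `ε_t(hz) = h₁zS(h₂)` -/
theorem targetMap_mul_target {z : H} (hz : z ∈ Hₜ) :
    εt ∘ₗ LinearMap.mulRight k z = conv (LinearMap.mulRight k z) 𝒮 := by
  ext h
  rw [LinearMap.comp_apply, LinearMap.mulRight_apply, ← mul_antipode, conv_apply,
    comul_mul_target h hz]
  induction Δ h with
  | zero => simp
  | add x y hx hy => simp only [map_add, add_mul, hx, hy]
  | tmul a b => simp

/-- `ε_s(yh) = S(h₁)yh₂` -/
theorem sourceMap_source_mul {y : H} (hy : y ∈ Hₛ) :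
    εs ∘ₗ LinearMap.mulLeft k y = conv 𝒮 (LinearMap.mulLeft k y) := by
  ext h
  rw [LinearMap.comp_apply, LinearMap.mulLeft_apply, ← antipode_mul, conv_apply,
    comul_source_mul h hy]
  induction Δ h with
  | zero => simp
  | add x y hx hy => simp only [map_add, mul_add, hx, hy]
  | tmul a b => simp

/-- `ε_s(1₂) ⊗ ε_t(1₁) = 1₁ ⊗ 1₂`. By `ε(ab) = ε(a1₁)ε(1₂b)` the left side is `1₁ ⊗ ε_t(1₂)`. -/
theorem map_source_target_comm :
    TensorProduct.map εs εt (TensorProduct.comm k H H (Δ 1)) = Δ 1 := by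
  have e : ∀ s t : H ⊗[k] H, TensorProduct.map
      (lift₂ (trilin fun a b p : H => ϵ (p * b) • a) s)
      (lift₂ (trilin fun a b p : H => ϵ (a * p) • b) t) (TensorProduct.comm k H H (Δ 1)) =
      (lift₂ (trilin fun a b p : H => ϵ (a * p) • b) t).lTensor H s := by
    intro s t
    induction s with
    | zero => simp
    | add x y hx hy =>
      simp only [map_add, TensorProduct.map_add_left, LinearMap.add_apply, hx, hy]
    | tmul c d =>
      induction t with
      | zero => simp
      | add x y hx hy =>
        simp only [map_add, TensorProduct.map_add_right, LinearMap.lTensor_add,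
          LinearMap.add_apply, hx, hy]
      | tmul a b =>
        have := counit_mul_left (k := k) a 1 d
        rw [mul_one] at this
        simp only [lift₂_tmul, LinearMap.lTensor_tmul, trilin_apply, this]
        induction Δ 1 with
        | zero => simp
        | add x y hx hy => simp only [map_add, add_smul, TensorProduct.tmul_add, hx, hy]
        | tmul p q => simp [TensorProduct.smul_tmul', smul_smul]
  have e₁ : εs = lift₂ (trilin fun a b p => ϵ (p * b) • a) (Δ 1) := by
    ext p
    rw [sourceMap_eq_sum]
    induction Δ 1 with
    | zero => simp
    | add x y hx hy => simp only [map_add, LinearMap.add_apply, hx, hy]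
    | tmul a b => simp
  have e₂ : εt = lift₂ (trilin fun a b p => ϵ (a * p) • b) (Δ 1) := by
    ext p
    rw [targetMap_eq_sum]
    induction Δ 1 with
    | zero => simp
    | add x y hx hy => simp only [map_add, LinearMap.add_apply, hx, hy]
    | tmul a b => simp
  conv_lhs => rw [e₁, e₂]
  rw [e, ← e₂, lTensor_targetMap_comul]
  exact mul_one _

end Antipode

/-! ### The antipode reverses products and coproducts -/

section AntipodeProperties

variable {k : Type w} {H : Type u} [Field k] [Ring H] [Algebra k H] [WeakHopfAlgebra k H]

local notation "Δ" => Coalgebra.comul (R := k) (A := H)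
local notation "𝒮" => antipode (k := k) (H := H)
local notation "εt" => targetMap k H
local notation "εs" => sourceMap k H
local notation "Hₜ" => targetSpace k H
local notation "Hₛ" => sourceSpace k H

theorem conv_comp_mul (f g : H →ₗ[k] H) :
    conv (f ∘ₗ LinearMap.mul' k H) (g ∘ₗ LinearMap.mul' k H) = conv f g ∘ₗ LinearMap.mul' k H := by
  ext a b
  have : ∀ s t : H ⊗[k] H, LinearMap.mul' k H (TensorProduct.map (f ∘ₗ LinearMap.mul' k H)
      (g ∘ₗ LinearMap.mul' k H) (TensorProduct.AlgebraTensorModule.tensorTensorTensorComm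
        k k k k H H H H (s ⊗ₜ t))) = LinearMap.mul' k H (TensorProduct.map f g (s * t)) := by
    intro s t
    induction s with
    | zero => simp
    | add x y hx hy => simp only [map_add, TensorProduct.add_tmul, add_mul, hx, hy]
    | tmul a b =>
      induction t with
      | zero => simp
      | add x y hx hy => simp only [map_add, TensorProduct.tmul_add, mul_add, hx, hy]
      | tmul c d => simp
  simp only [TensorProduct.AlgebraTensorModule.curry_apply, LinearMap.restrictScalars_self,
    TensorProduct.curry_apply, LinearMap.comp_apply, LinearMap.mul'_apply, conv_apply, comul_mul,
    TensorProduct.comul_tmul, this]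

theorem conv_comp_comul (f g : H →ₗ[k] H) : conv (Δ ∘ₗ f) (Δ ∘ₗ g) = Δ ∘ₗ conv f g := by
  ext h
  simp only [conv_apply, LinearMap.comp_apply]
  induction Δ h with
  | zero => simp
  | add x y hx hy => simp only [map_add, hx, hy]
  | tmul a b => simp [comul_mul]

/-- `S(gh) = S(h)S(g)`. Let `m` be the multiplication and `B(g ⊗ h) = S(h)S(g)`. For the convolution
product, `S ∘ m = (ε_s ∘ m) * (S ∘ m) = B * m * (S ∘ m) = B * (ε_t ∘ m) = B`. -/
theorem antipode_mul_rev (g h : H) : 𝒮 (g * h) = 𝒮 h * 𝒮 g := by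
  let m := LinearMap.mul' k H
  let B := m ∘ₗ TensorProduct.map 𝒮 𝒮 ∘ₗ (TensorProduct.comm k H H).toLinearMap
  -- `S(h₁)S(g₁)g₂h₂ = S(h₁)ε_s(g)h₂ = ε_s(ε_s(g)h) = ε_s(gh)`
  have h₁ : conv B m = εs ∘ₗ m := by
    ext g h
    have : ∀ s t : H ⊗[k] H, LinearMap.mul' k H (TensorProduct.map B m
        (TensorProduct.AlgebraTensorModule.tensorTensorTensorComm k k k k H H H H (s ⊗ₜ t))) =
        LinearMap.mul' k H (TensorProduct.map 𝒮 (LinearMap.mulLeft k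
          (LinearMap.mul' k H ((𝒮).rTensor H s))) t) := by
      intro s t
      induction t with
      | zero => simp
      | add x y hx hy => simp only [map_add, TensorProduct.tmul_add, hx, hy]
      | tmul c d =>
        induction s with
        | zero => simp
        | add x y hx hy =>
          rw [TensorProduct.add_tmul]
          simp only [map_add, hx, hy]
          simp [add_mul, mul_add]
        | tmul a b => simp [B, m, mul_assoc]
    simp only [TensorProduct.AlgebraTensorModule.curry_apply, LinearMap.restrictScalars_self,
      TensorProduct.curry_apply, LinearMap.comp_apply, conv_apply, TensorProduct.comul_tmul, this]
    rw [antipode_mul, ← conv_apply, ← sourceMap_source_mul (sourceMap_mem g)]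
    simp [m, sourceMap_sourceMap_mul]
  -- `S(h₁)S(g₁)ε_t(g₂h₂)` is computed from `ε_t(gz) = g₁zS(g₂)` for `z = ε_t(h₂)`.
  have h₂ : conv B (εt ∘ₗ m) = B := by
    ext g h
    have e₁ : ∀ (a b : H) (s : H ⊗[k] H), LinearMap.mul' k H (TensorProduct.map B (εt ∘ₗ m)
        (TensorProduct.AlgebraTensorModule.tensorTensorTensorComm k k k k H H H H
          (s ⊗ₜ (a ⊗ₜ b)))) = 𝒮 a * LinearMap.mul' k H
            (TensorProduct.map 𝒮 (εt ∘ₗ LinearMap.mulRight k (εt b)) s) := by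
      intro a b s
      induction s with
      | zero => simp
      | add x y hx hy => simp only [map_add, TensorProduct.add_tmul, mul_add, hx, hy]
      | tmul c d => simp [B, m, mul_assoc, targetMap_mul_targetMap]
    -- `S(g₁)ε_t(g₂z) = S(g₁)g₂zS(g₃) = ε_s(g₁)zS(g₂) = zS(g)`
    have e₂ : ∀ b : H, conv 𝒮 (εt ∘ₗ LinearMap.mulRight k (εt b)) g = εt b * 𝒮 g := by
      intro b
      have e₃ : conv 𝒮 (LinearMap.mulRight k (εt b)) = LinearMap.mulRight k (εt b) ∘ₗ εs := by
        ext g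
        rw [LinearMap.comp_apply, conv_apply, ← antipode_mul]
        induction Δ g with
        | zero => simp
        | add x y hx hy => simp only [map_add, hx, hy]
        | tmul a b => simp [mul_assoc]
      rw [targetMap_mul_target (targetMap_mem b), ← conv_assoc, e₃]
      conv_rhs => rw [← conv_sourceMap_antipode]
      rw [conv_apply, conv_apply]
      induction Δ g with
      | zero => simp
      | add x y hx hy => simp only [map_add, mul_add, hx, hy]
      | tmul p q =>
        simp [← target_mul_source (targetMap_mem b) (sourceMap_mem p), mul_assoc]
    have e₄ : ∀ t : H ⊗[k] H, LinearMap.mul' k H (TensorProduct.map B (εt ∘ₗ m)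
        (TensorProduct.AlgebraTensorModule.tensorTensorTensorComm k k k k H H H H
          (Δ g ⊗ₜ t))) = LinearMap.mul' k H (TensorProduct.map 𝒮 εt t) * 𝒮 g := by
      intro t
      induction t with
      | zero => simp
      | add x y hx hy => simp only [map_add, TensorProduct.tmul_add, add_mul, hx, hy]
      | tmul a b => rw [e₁, ← conv_apply, e₂]; simp [mul_assoc]
    simp only [TensorProduct.AlgebraTensorModule.curry_apply, LinearMap.restrictScalars_self,
      TensorProduct.curry_apply, conv_apply, TensorProduct.comul_tmul, e₄]
    rw [← conv_apply, conv_antipode_targetMap]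
    simp [B, m]
  have h₃ : conv m (𝒮 ∘ₗ m) = εt ∘ₗ m := by
    have := conv_comp_mul (k := k) (H := H) LinearMap.id 𝒮
    rwa [LinearMap.id_comp, conv_id_antipode] at this
  have h₄ : 𝒮 ∘ₗ m = B := by
    rw [← h₂, ← h₃, ← conv_assoc, h₁]
    have := conv_comp_mul (k := k) (H := H) εs 𝒮
    rwa [conv_sourceMap_antipode, eq_comm] at this
  simpa [B, m] using LinearMap.congr_fun h₄ (g ⊗ₜ h)

theorem antipode_of_source {y : H} (hy : y ∈ Hₛ) : 𝒮 y = εt y := by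
  have e : ∀ t : H ⊗[k] H, LinearMap.mul' k H ((𝒮).lTensor H ((1 ⊗ₜ y) * t)) =
      LinearMap.mul' k H ((𝒮).lTensor H t) * 𝒮 y := by
    intro t
    induction t with
    | zero => simp
    | add x y hx hy => simp only [map_add, mul_add, add_mul, hx, hy]
    | tmul a b => simp [antipode_mul_rev, mul_assoc]
  rw [← mul_antipode, comul_of_mem_source hy, e, mul_antipode, targetMap_one, one_mul]

theorem antipode_of_target {z : H} (hz : z ∈ Hₜ) : 𝒮 z = εs z := by
  have e : ∀ t : H ⊗[k] H, LinearMap.mul' k H ((𝒮).rTensor H (t * (z ⊗ₜ 1))) =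
      𝒮 z * LinearMap.mul' k H ((𝒮).rTensor H t) := by
    intro t
    induction t with
    | zero => simp
    | add x y hx hy => simp only [map_add, mul_add, add_mul, hx, hy]
    | tmul a b => simp [antipode_mul_rev, mul_assoc]
  rw [← antipode_mul, comul_of_mem_target' hz, e, antipode_mul, sourceMap_one, mul_one]

theorem antipode_one : 𝒮 1 = 1 := by rw [antipode_of_target one_mem_target, sourceMap_one]

theorem antipode_source_mem {y : H} (hy : y ∈ Hₛ) : 𝒮 y ∈ Hₜ := by
  rw [antipode_of_source hy]; exact targetMap_mem y

theorem antipode_target_mem {z : H} (hz : z ∈ Hₜ) : 𝒮 z ∈ Hₛ := by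
  rw [antipode_of_target hz]; exact sourceMap_mem z

/-- `Δ(1) ∈ H_s ⊗ H_t` -/
theorem map_source_target_comul_one : TensorProduct.map εs εt (Δ 1) = Δ 1 := by
  have h₁ : (εs).rTensor H (Δ 1) = Δ 1 := by rw [rTensor_sourceMap_comul]; exact one_mul _
  have h₂ : (εt).lTensor H (Δ 1) = Δ 1 := by rw [lTensor_targetMap_comul]; exact mul_one _
  rw [← LinearMap.rTensor_comp_lTensor, LinearMap.comp_apply, h₂, h₁]

/-- To prove an identity for `Δ(1)` it suffices to consider `y ⊗ z` with `y ∈ H_s`, `z ∈ H_t`. -/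
theorem comul_one_induction {D : Type*} [AddCommGroup D] [Module k D]
    {f g : H ⊗[k] H →ₗ[k] D} (h : ∀ y ∈ Hₛ, ∀ z ∈ Hₜ, f (y ⊗ₜ z) = g (y ⊗ₜ z)) :
    f (Δ 1) = g (Δ 1) := by
  rw [← map_source_target_comul_one]
  induction Δ 1 with
  | zero => simp
  | add x y hx hy => simp only [map_add, hx, hy]
  | tmul a b => exact h _ (sourceMap_mem a) _ (targetMap_mem b)

/-- `S(1₂) ⊗ S(1₁) = 1₁ ⊗ 1₂` -/
theorem map_antipode_comm_comul_one :
    TensorProduct.map 𝒮 𝒮 (TensorProduct.comm k H H (Δ 1)) = Δ 1 := by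
  conv_rhs => rw [← map_source_target_comm]
  refine comul_one_induction
    (f := TensorProduct.map 𝒮 𝒮 ∘ₗ (TensorProduct.comm k H H).toLinearMap)
    (g := TensorProduct.map εs εt ∘ₗ (TensorProduct.comm k H H).toLinearMap) ?_
  intro y hy z hz
  simp [antipode_of_source hy, antipode_of_target hz]

/-- `Δ(S(h)) = S(h₂) ⊗ S(h₁)`. With `B(h) = S(h₂) ⊗ S(h₁)`, the convolution product gives
`Δ ∘ S = (Δ ∘ ε_s) * (Δ ∘ S) = B * Δ * (Δ ∘ S) = B * (Δ ∘ ε_t) = B`. -/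
theorem comul_antipode (h : H) :
    Δ (𝒮 h) = TensorProduct.comm k H H (TensorProduct.map 𝒮 𝒮 (Δ h)) := by
  let B : H →ₗ[k] H ⊗[k] H :=
    (TensorProduct.comm k H H).toLinearMap ∘ₗ TensorProduct.map 𝒮 𝒮 ∘ₗ Δ
  -- `S(q₁)q₂ ⊗ q₃ = ε_s(q₁) ⊗ q₂ = 1₁ ⊗ q1₂`
  have inner : ∀ q : H, lift₂ (bilin fun a b => (𝒮 a ⊗ₜ[k] (1 : H)) * Δ b) (Δ q) =
      (1 ⊗ₜ q) * Δ 1 := by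
    intro q
    rw [← rTensor_sourceMap_comul]
    have : ∀ t : H ⊗[k] H, (εs).rTensor H t = lift₂ (bilin fun a b => εs a ⊗ₜ[k] b) t := by
      intro t
      induction t with
      | zero => simp
      | add x y hx hy => simp only [map_add, hx, hy]
      | tmul a b => simp
    rw [this]
    refine (sum_comul_comul _ _ (trilin fun a b c => (𝒮 a * b) ⊗ₜ[k] c) ?_ ?_ q).symm
    · intro a c
      rw [bilin_apply, ← antipode_mul]
      induction Δ a with
      | zero => simp
      | add x y hx hy => simp only [map_add, TensorProduct.add_tmul, LinearMap.add_apply, hx, hy]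
      | tmul a b => simp
    · intro a c
      rw [bilin_apply]
      induction Δ c with
      | zero => simp
      | add x y hx hy => simp only [map_add, mul_add, hx, hy]
      | tmul a b => simp
  have h₁ : conv B Δ = Δ ∘ₗ εs := by
    ext h
    have e₀ : ∀ t : H ⊗[k] H, LinearMap.mul' k (H ⊗[k] H) (TensorProduct.map B Δ t) =
        lift₂ (bilin fun p q => B p * Δ q) t := by
      intro t
      induction t with
      | zero => simp
      | add x y hx hy => simp only [map_add, hx, hy]
      | tmul a b => simp
    rw [conv_apply, e₀, sum_comul_comul _
      (bilin fun p q => ((1 : H) ⊗ₜ[k] 𝒮 p) * ((1 ⊗ₜ q) * Δ 1))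
      (trilin fun a b c => (𝒮 b ⊗ₜ[k] 𝒮 a) * Δ c)]
    · have e₁ : ∀ t : H ⊗[k] H, lift₂ (bilin fun p q => ((1 : H) ⊗ₜ[k] 𝒮 p) * ((1 ⊗ₜ q) * Δ 1)) t =
          (1 ⊗ₜ LinearMap.mul' k H ((𝒮).rTensor H t)) * Δ 1 := by
        intro t
        induction t with
        | zero => simp
        | add x y hx hy => simp only [map_add, TensorProduct.tmul_add, add_mul, hx, hy]
        | tmul a b => simp [← mul_assoc]
      rw [e₁, antipode_mul, ← comul_of_mem_source (sourceMap_mem h), LinearMap.comp_apply]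
    · intro p q
      simp only [bilin_apply, B, LinearMap.comp_apply]
      induction Δ p with
      | zero => simp
      | add x y hx hy => simp only [map_add, LinearMap.add_apply, add_mul, hx, hy]
      | tmul a b => simp
    · intro p q
      rw [bilin_apply, ← inner]
      have := map_lift₂ (F := bilin fun a b => (𝒮 a ⊗ₜ[k] (1 : H)) * Δ b)
        (F' := bilin fun a b => ((1 : H) ⊗ₜ[k] 𝒮 p) * ((𝒮 a ⊗ₜ[k] (1 : H)) * Δ b))
        (LinearMap.mulLeft k ((1 : H) ⊗ₜ[k] 𝒮 p)) (Δ q) (by simp)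
      rw [LinearMap.mulLeft_apply] at this
      rw [this]
      exact lift₂_congr _ fun a b => by simp [← mul_assoc]
  have h₂ : conv B (Δ ∘ₗ εt) = LinearMap.mulRight k (Δ 1) ∘ₗ B := by
    ext h
    have e₀ : ∀ t : H ⊗[k] H, LinearMap.mul' k (H ⊗[k] H) (TensorProduct.map B (Δ ∘ₗ εt) t) =
        lift₂ (bilin fun p q => B p * (εt q ⊗ₜ 1)) t * Δ 1 := by
      intro t
      induction t with
      | zero => simp
      | add x y hx hy => simp only [map_add, add_mul, hx, hy]
      | tmul a b => simp [comul_of_mem_target (targetMap_mem b), mul_assoc]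
    rw [conv_apply, e₀, sum_comul_comul _ (bilin fun p q => 𝒮 q ⊗ₜ[k] 𝒮 p)
      (trilin fun a b c => (𝒮 b * εt c) ⊗ₜ[k] 𝒮 a)]
    · simp only [LinearMap.comp_apply, LinearMap.mulRight_apply, B]
      congr 1
      induction Δ h with
      | zero => simp
      | add x y hx hy => simp only [map_add, hx, hy]
      | tmul a b => simp
    · intro p q
      simp only [bilin_apply, B, LinearMap.comp_apply]
      induction Δ p with
      | zero => simp
      | add x y hx hy => simp only [map_add, LinearMap.add_apply, add_mul, hx, hy]
      | tmul a b => simp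
    · intro p q
      have : ∀ t : H ⊗[k] H, lift₂ ((trilin fun a b c => (𝒮 b * εt c) ⊗ₜ[k] 𝒮 a) p) t =
          LinearMap.mul' k H (TensorProduct.map 𝒮 εt t) ⊗ₜ 𝒮 p := by
        intro t
        induction t with
        | zero => simp
        | add x y hx hy => simp only [map_add, TensorProduct.add_tmul, hx, hy]
        | tmul a b => simp
      rw [this, ← conv_apply, conv_antipode_targetMap, bilin_apply]
  have h₃ : LinearMap.mulRight k (Δ 1) ∘ₗ B = B := by
    ext h
    have : ∀ s t : H ⊗[k] H, TensorProduct.comm k H H (TensorProduct.map 𝒮 𝒮 (s * t)) =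
        TensorProduct.comm k H H (TensorProduct.map 𝒮 𝒮 t) *
          TensorProduct.map 𝒮 𝒮 (TensorProduct.comm k H H s) := by
      intro s t
      induction s with
      | zero => simp
      | add x y hx hy => simp only [map_add, add_mul, mul_add, hx, hy]
      | tmul a b =>
        induction t with
        | zero => simp
        | add x y hx hy => simp only [map_add, add_mul, mul_add, hx, hy]
        | tmul c d => simp [antipode_mul_rev]
    have e := this (Δ 1) (Δ h)
    rw [comul_one_mul, map_antipode_comm_comul_one] at e
    exact e.symm
  have h₄ : Δ ∘ₗ 𝒮 = B := by
    rw [← h₃, ← h₂, ← conv_id_antipode, ← conv_comp_comul, ← conv_assoc, LinearMap.comp_id, h₁,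
      conv_comp_comul, conv_sourceMap_antipode]
  exact LinearMap.congr_fun h₄ h

theorem targetMap_antipode (h : H) : εt (𝒮 h) = 𝒮 (εs h) := by
  rw [← mul_antipode, ← antipode_mul, comul_antipode]
  induction Δ h with
  | zero => simp
  | add x y hx hy => simp only [map_add, hx, hy]
  | tmul a b => simp [antipode_mul_rev]

end AntipodeProperties

/-! ### The element `Δ(1)` of a regular weak Hopf algebra -/

section Regular

variable {k : Type w} {H : Type u} [Field k] [Ring H] [Algebra k H] [WeakHopfAlgebra k H]

local notation "Δ" => Coalgebra.comul (R := k) (A := H)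
local notation "𝒮" => antipode (k := k) (H := H)
local notation "εt" => targetMap k H
local notation "εs" => sourceMap k H
local notation "Hₜ" => targetSpace k H
local notation "Hₛ" => sourceSpace k H

theorem IsRegular.target (hreg : IsRegular k H) {z : H} (hz : z ∈ Hₜ) : 𝒮 (𝒮 z) = z := by
  simpa using hreg (z * 1) (Submodule.mul_mem_mul hz one_mem_source)

theorem IsRegular.source (hreg : IsRegular k H) {y : H} (hy : y ∈ Hₛ) : 𝒮 (𝒮 y) = y := by
  simpa using hreg (1 * y) (Submodule.mul_mem_mul one_mem_target hy)

/-- `1₁ ⊗ S(1₂) = S(1₂) ⊗ 1₁` -/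
theorem IsRegular.comm_lTensor_antipode (hreg : IsRegular k H) :
    TensorProduct.comm k H H ((𝒮).lTensor H (Δ 1)) = (𝒮).lTensor H (Δ 1) := by
  conv_rhs => rw [← map_antipode_comm_comul_one]
  refine comul_one_induction (f := (TensorProduct.comm k H H).toLinearMap ∘ₗ (𝒮).lTensor H)
    (g := (𝒮).lTensor H ∘ₗ TensorProduct.map 𝒮 𝒮 ∘ₗ (TensorProduct.comm k H H).toLinearMap) ?_
  intro y hy z hz
  simp [hreg.source hy]

/-- `S(1₁) ⊗ 1₂ = 1₂ ⊗ S(1₁)` -/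
theorem IsRegular.comm_rTensor_antipode (hreg : IsRegular k H) :
    TensorProduct.comm k H H ((𝒮).rTensor H (Δ 1)) = (𝒮).rTensor H (Δ 1) := by
  conv_rhs => rw [← map_antipode_comm_comul_one]
  refine comul_one_induction (f := (TensorProduct.comm k H H).toLinearMap ∘ₗ (𝒮).rTensor H)
    (g := (𝒮).rTensor H ∘ₗ TensorProduct.map 𝒮 𝒮 ∘ₗ (TensorProduct.comm k H H).toLinearMap) ?_
  intro y hy z hz
  simp [hreg.target hz]

theorem IsRegular.lTensor_lTensor (hreg : IsRegular k H) :
    (𝒮).lTensor H ((𝒮).lTensor H (Δ 1)) = Δ 1 := by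
  refine comul_one_induction (f := (𝒮).lTensor H ∘ₗ (𝒮).lTensor H) (g := LinearMap.id) ?_
  intro y hy z hz
  simp [hreg.target hz]

theorem lTensor_sourceMap_comul_one : (εs).lTensor H (Δ 1) = (𝒮).lTensor H (Δ 1) := by
  refine comul_one_induction (f := (εs).lTensor H) (g := (𝒮).lTensor H) ?_
  intro y hy z hz
  simp [antipode_of_target hz]

theorem rTensor_targetMap_comul_one : (εt).rTensor H (Δ 1) = (𝒮).rTensor H (Δ 1) := by
  refine comul_one_induction (f := (εt).rTensor H) (g := (𝒮).rTensor H) ?_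
  intro y hy z hz
  simp [antipode_of_source hy]

/-- `y1₁ ⊗ S(1₂) = 1₁ ⊗ S(1₂)y` for `y ∈ H_s` -/
theorem source_separability {y : H} (hy : y ∈ Hₛ) :
    (y ⊗ₜ 1) * (𝒮).lTensor H (Δ 1) = (𝒮).lTensor H (Δ 1) * (1 ⊗ₜ y) := by
  rw [← lTensor_sourceMap_comul_one, ← lTensor_sourceMap_comul, comul_of_mem_source' hy]
  induction Δ 1 with
  | zero => simp
  | add x y hx hy => simp only [map_add, add_mul, hx, hy]
  | tmul a b => simp [sourceMap_mul_source hy]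

/-- `zS(1₁) ⊗ 1₂ = S(1₁) ⊗ 1₂z` for `z ∈ H_t` -/
theorem target_separability {z : H} (hz : z ∈ Hₜ) :
    (z ⊗ₜ 1) * (𝒮).rTensor H (Δ 1) = (𝒮).rTensor H (Δ 1) * (1 ⊗ₜ z) := by
  rw [← rTensor_targetMap_comul_one, ← rTensor_targetMap_comul, comul_of_mem_target hz]
  induction Δ 1 with
  | zero => simp
  | add x y hx hy => simp only [map_add, mul_add, hx, hy]
  | tmul a b => simp [targetMap_target_mul hz]

omit [WeakHopfAlgebra k H] in
theorem comm_mul (x y : H ⊗[k] H) : TensorProduct.comm k H H (x * y) =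
    TensorProduct.comm k H H x * TensorProduct.comm k H H y :=
  map_mul (Algebra.TensorProduct.comm k H H) x y

/-- `y1₁ ⊗ 1₂ = 1₁ ⊗ S(y)1₂` for `y ∈ H_s` -/
theorem IsRegular.source_mul_comul_one (hreg : IsRegular k H) {y : H} (hy : y ∈ Hₛ) :
    (y ⊗ₜ 1) * Δ 1 = (1 ⊗ₜ 𝒮 y) * Δ 1 := by
  have e := congrArg ((𝒮).lTensor H) (source_separability (k := k) hy)
  have e₁ : ∀ t : H ⊗[k] H, (𝒮).lTensor H ((y ⊗ₜ 1) * t) = (y ⊗ₜ 1) * (𝒮).lTensor H t := by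
    intro t
    induction t with
    | zero => simp
    | add x y hx hy => simp only [map_add, mul_add, hx, hy]
    | tmul a b => simp
  have e₂ : ∀ t : H ⊗[k] H, (𝒮).lTensor H (t * (1 ⊗ₜ y)) = (1 ⊗ₜ 𝒮 y) * (𝒮).lTensor H t := by
    intro t
    induction t with
    | zero => simp
    | add x y hx hy => simp only [map_add, mul_add, add_mul, hx, hy]
    | tmul a b => simp [antipode_mul_rev]
  rwa [e₁, e₂, hreg.lTensor_lTensor] at e

/-- `1₁y ⊗ 1₂ = 1₁ ⊗ 1₂S(y)` for `y ∈ H_s` -/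
theorem IsRegular.comul_one_mul_source (hreg : IsRegular k H) {y : H} (hy : y ∈ Hₛ) :
    Δ 1 * (y ⊗ₜ 1) = Δ 1 * (1 ⊗ₜ 𝒮 y) := by
  have e := congrArg (fun t => (𝒮).lTensor H (TensorProduct.comm k H H t))
    (source_separability (k := k) hy)
  simp only [comm_mul, hreg.comm_lTensor_antipode, TensorProduct.comm_tmul] at e
  have e₁ : ∀ t : H ⊗[k] H, (𝒮).lTensor H (t * (y ⊗ₜ 1)) = (𝒮).lTensor H t * (y ⊗ₜ 1) := by
    intro t
    induction t with
    | zero => simp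
    | add x y hx hy => simp only [map_add, add_mul, hx, hy]
    | tmul a b => simp
  have e₂ : ∀ t : H ⊗[k] H, (𝒮).lTensor H ((1 ⊗ₜ y) * t) = (𝒮).lTensor H t * (1 ⊗ₜ 𝒮 y) := by
    intro t
    induction t with
    | zero => simp
    | add x y hx hy => simp only [map_add, mul_add, add_mul, hx, hy]
    | tmul a b => simp [antipode_mul_rev]
  rw [e₁, e₂, hreg.lTensor_lTensor] at e
  exact e.symm

/-- `S(1₂)1₁ = 1` -/
theorem IsRegular.antipode_mul_comul_one (hreg : IsRegular k H) :
    lift₂ (bilin fun a b => 𝒮 b * a) (Δ 1) = 1 := by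
  have : ∀ t : H ⊗[k] H, lift₂ (bilin fun a b => 𝒮 b * a) t =
      LinearMap.mul' k H (TensorProduct.comm k H H ((𝒮).lTensor H t)) := by
    intro t
    induction t with
    | zero => simp
    | add x y hx hy => simp only [map_add, hx, hy]
    | tmul a b => simp
  rw [this, hreg.comm_lTensor_antipode, mul_antipode, targetMap_one]

end Regular

/-! ### The universal `R`-matrix -/

section RMatrix

variable {k : Type w} {H : Type u} [Field k] [Ring H] [Algebra k H] [WeakHopfAlgebra k H]

local notation "Δ" => Coalgebra.comul (R := k) (A := H)
local notation "ϵ" => Coalgebra.counit (R := k) (A := H)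
local notation "𝒮" => antipode (k := k) (H := H)
local notation "εt" => targetMap k H
local notation "εs" => sourceMap k H
local notation "Hₜ" => targetSpace k H
local notation "Hₛ" => sourceSpace k H

namespace IsQuasitriangular

variable {R : H ⊗[k] H} (hR : IsQuasitriangular R)

include hR

theorem cop_one_mul : comulCop 1 * R = R := by
  obtain ⟨X, rfl⟩ := hR.mem
  rw [← mul_assoc, ← mul_assoc, comulCop, ← comm_mul, comul_one_mul]

theorem mul_comul_one : R * Δ 1 = R := by
  rw [← hR.cop_mul, hR.cop_one_mul]

/-- `(1 ⊗ z)R = R(z ⊗ 1)` for `z ∈ H_t` -/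
theorem target_mul {z : H} (hz : z ∈ Hₜ) : (1 ⊗ₜ z) * R = R * (z ⊗ₜ 1) := by
  have h := hR.cop_mul z
  rw [comul_of_mem_target' hz, ← mul_assoc, hR.mul_comul_one, comulCop, comul_of_mem_target hz,
    comm_mul, mul_assoc] at h
  rw [← h]
  congr 1
  exact hR.cop_one_mul.symm

/-- `(y ⊗ 1)R = R(1 ⊗ y)` for `y ∈ H_s` -/
theorem source_mul {y : H} (hy : y ∈ Hₛ) : (y ⊗ₜ 1) * R = R * (1 ⊗ₜ y) := by
  have h := hR.cop_mul y
  rw [comul_of_mem_source' hy, ← mul_assoc, hR.mul_comul_one, comulCop, comul_of_mem_source hy,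
    comm_mul, mul_assoc] at h
  rw [← h]
  congr 1
  exact hR.cop_one_mul.symm

/-- `(1 ⊗ y)R = (S(y) ⊗ 1)R` for `y ∈ H_s` -/
theorem source_mul_right (hreg : IsRegular k H) {y : H} (hy : y ∈ Hₛ) :
    (1 ⊗ₜ y) * R = (𝒮 y ⊗ₜ 1) * R := by
  rw [← hR.cop_one_mul, ← mul_assoc, ← mul_assoc]
  congr 1
  simpa [comm_mul, comulCop] using
    congrArg (TensorProduct.comm k H H) (hreg.source_mul_comul_one hy)

/-- `R(1 ⊗ z) = R(S(z) ⊗ 1)` for `z ∈ H_t` -/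
theorem mul_target_right (hreg : IsRegular k H) {z : H} (hz : z ∈ Hₜ) :
    R * (1 ⊗ₜ z) = R * (𝒮 z ⊗ₜ 1) := by
  rw [← hR.mul_comul_one, mul_assoc, mul_assoc,
    hreg.comul_one_mul_source (antipode_target_mem hz), hreg.target hz]

/-- `ε(R¹)R² = 1`. For `w = ε(R¹)R²`, applying `ε` to the first factor of `(Δ ⊗ id)R = R₁₃R₂₃` gives
`R = (1 ⊗ w)R`, and here `R` can be cancelled. -/
theorem counit_left : lift₂ (bilin fun a b => ϵ a • b) R = 1 := by
  let f : H ⊗[k] (H ⊗[k] H) →ₗ[k] H ⊗[k] H := lift₃ (trilin fun a b c => ϵ a • (b ⊗ₜ[k] c))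
  set w := lift₂ (bilin fun a b => ϵ a • b) R
  have e₁ : ∀ t : H ⊗[k] H, f (TensorProduct.assoc k H H H ((Δ).rTensor H t)) = t := by
    intro t
    induction t with
    | zero => simp
    | add x y hx hy => simp only [map_add, hx, hy]
    | tmul a b =>
      have : ∀ s : H ⊗[k] H, f (TensorProduct.assoc k H H H (s ⊗ₜ b)) =
          lift₂ (bilin fun a b => ϵ a • b) s ⊗ₜ b := by
        intro s
        induction s with
        | zero => simp
        | add x y hx hy => simp only [map_add, TensorProduct.add_tmul, hx, hy]
        | tmul p q => simp [f, TensorProduct.smul_tmul']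
      rw [LinearMap.rTensor_tmul, this, sum_counit_left]
  have e₂ : ∀ s t : H ⊗[k] H, f (leg13 s * leg23 t) =
      (1 ⊗ₜ lift₂ (bilin fun a b => ϵ a • b) s) * t := by
    intro s t
    induction s with
    | zero => simp [leg13]
    | add x y hx hy =>
      simp only [leg13, map_add, TensorProduct.tmul_add, add_mul] at hx hy ⊢
      rw [hx, hy]
    | tmul a b =>
      induction t with
      | zero => simp [leg23]
      | add x y hx hy =>
        simp only [leg23, map_add, TensorProduct.tmul_add, mul_add] at hx hy ⊢
        rw [hx, hy]
      | tmul c d => simp [leg13, leg23, f]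
  -- multiplication by the weak inverse on the right removes `R` up to `Δ^cop(1)`
  have e : (1 ⊗ₜ w) * R = R := by rw [← e₂, ← hR.comul_id, e₁]
  obtain ⟨Rbar, -, h₁, -⟩ := hR.exists_inv
  have h₂ : (1 ⊗ₜ w) * comulCop 1 = comulCop (k := k) (1 : H) := by rw [← h₁, ← mul_assoc, e]
  have e₃ : ∀ t : H ⊗[k] H, lift₂ (bilin fun a b => ϵ a • b)
      ((1 ⊗ₜ w) * TensorProduct.comm k H H t) = w * lift₂ (bilin fun a b => ϵ b • a) t := by
    intro t
    induction t with
    | zero => simp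
    | add x y hx hy => simp only [map_add, mul_add, hx, hy]
    | tmul a b => simp
  have h₃ := e₃ (Δ 1)
  have h₄ := e₃ (Δ 1)
  rw [← comulCop, h₂, sum_counit_right, mul_one] at h₃
  rw [← h₃]
  have e₄ : ∀ t : H ⊗[k] H, lift₂ (bilin fun a b : H => ϵ a • b)
      (TensorProduct.comm k H H t) = lift₂ (bilin fun a b => ϵ b • a) t := by
    intro t
    induction t with
    | zero => simp
    | add x y hx hy => simp only [map_add, hx, hy]
    | tmul a b => simp
  rw [comulCop, e₄, sum_counit_right]

/-- `R¹ε(R²) = 1` -/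
theorem counit_right : lift₂ (bilin fun a b => ϵ b • a) R = 1 := by
  let f : H ⊗[k] (H ⊗[k] H) →ₗ[k] H ⊗[k] H := lift₃ (trilin fun a b c => ϵ c • (a ⊗ₜ[k] b))
  set w := lift₂ (bilin fun a b => ϵ b • a) R
  have e₁ : ∀ t : H ⊗[k] H, f ((Δ).lTensor H t) = t := by
    intro t
    induction t with
    | zero => simp
    | add x y hx hy => simp only [map_add, hx, hy]
    | tmul a b =>
      have : ∀ s : H ⊗[k] H, f (a ⊗ₜ s) = a ⊗ₜ lift₂ (bilin fun a b => ϵ b • a) s := by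
        intro s
        induction s with
        | zero => simp
        | add x y hx hy => simp only [map_add, TensorProduct.tmul_add, hx, hy]
        | tmul p q => simp [f]
      rw [LinearMap.lTensor_tmul, this, sum_counit_right]
  have e₂ : ∀ s t : H ⊗[k] H, f (leg13 s * leg12 t) =
      (lift₂ (bilin fun a b => ϵ b • a) s ⊗ₜ 1) * t := by
    intro s t
    induction s with
    | zero => simp [leg13]
    | add x y hx hy =>
      simp only [leg13, map_add, TensorProduct.tmul_add, TensorProduct.add_tmul, add_mul]
        at hx hy ⊢
      rw [hx, hy]
    | tmul a b =>
      induction t with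
      | zero => simp [leg12]
      | add x y hx hy =>
        simp only [leg12, map_add, TensorProduct.add_tmul, mul_add] at hx hy ⊢
        rw [hx, hy]
      | tmul c d => simp [leg13, leg12, f, TensorProduct.smul_tmul']
  have e : (w ⊗ₜ 1) * R = R := by rw [← e₂, ← hR.id_comul, e₁]
  obtain ⟨Rbar, -, h₁, -⟩ := hR.exists_inv
  have h₂ : (w ⊗ₜ 1) * comulCop 1 = comulCop (k := k) (1 : H) := by rw [← h₁, ← mul_assoc, e]
  have e₃ : ∀ t : H ⊗[k] H, lift₂ (bilin fun a b => ϵ b • a)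
      ((w ⊗ₜ 1) * TensorProduct.comm k H H t) = w * lift₂ (bilin fun a b => ϵ a • b) t := by
    intro t
    induction t with
    | zero => simp
    | add x y hx hy => simp only [map_add, mul_add, hx, hy]
    | tmul a b => simp
  have h₃ := e₃ (Δ 1)
  rw [← comulCop, h₂, sum_counit_left, mul_one] at h₃
  rw [← h₃]
  have e₄ : ∀ t : H ⊗[k] H, lift₂ (bilin fun a b : H => ϵ b • a)
      (TensorProduct.comm k H H t) = lift₂ (bilin fun a b => ϵ a • b) t := by
    intro t
    induction t with
    | zero => simp
    | add x y hx hy => simp only [map_add, hx, hy]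
    | tmul a b => simp
  rw [comulCop, e₄, sum_counit_left]

/-- `R¹ ⊗ ε_t(R²) = S(1₁) ⊗ 1₂` -/
theorem lTensor_targetMap (hreg : IsRegular k H) :
    (εt).lTensor H R = (𝒮).rTensor H (Δ 1) := by
  have e₂ : εt = lift₂ (trilin fun a b p => ϵ (a * p) • b) (Δ 1) := by
    ext p
    rw [targetMap_eq_sum]
    induction Δ 1 with
    | zero => simp
    | add x y hx hy => simp only [map_add, LinearMap.add_apply, hx, hy]
    | tmul a b => simp
  rw [e₂]
  have key := comul_one_induction (k := k) (H := H)
    (f := (LinearMap.applyₗ R) ∘ₗ LinearMap.lTensorHom H ∘ₗ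
      lift₂ (trilin fun a b p => ϵ (a * p) • b)) (g := (𝒮).rTensor H) ?_
  · simpa only [LinearMap.comp_apply, LinearMap.applyₗ_apply_apply, LinearMap.coe_lTensorHom,
      LinearMap.coe_rTensorHom, LinearEquiv.coe_coe, comulCop] using key
  intro y hy z hz
  have : ∀ t : H ⊗[k] H, ((trilin fun a b p => ϵ (a * p) • b) y z).lTensor H t =
      lift₂ (bilin fun a b => ϵ b • a) ((1 ⊗ₜ y) * t) ⊗ₜ z := by
    intro t
    induction t with
    | zero => simp
    | add x y hx hy => simp only [map_add, mul_add, TensorProduct.add_tmul, hx, hy]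
    | tmul p q => simp [TensorProduct.smul_tmul']
  have e₃ : ∀ t : H ⊗[k] H, lift₂ (bilin fun a b => ϵ b • a) ((𝒮 y ⊗ₜ 1) * t) =
      𝒮 y * lift₂ (bilin fun a b => ϵ b • a) t := by
    intro t
    induction t with
    | zero => simp
    | add x y hx hy => simp only [map_add, mul_add, hx, hy]
    | tmul p q => simp
  simp only [LinearMap.comp_apply, LinearMap.applyₗ_apply_apply, LinearMap.coe_lTensorHom,
    lift₂_tmul, LinearMap.rTensor_tmul]
  rw [this, hR.source_mul_right hreg hy, e₃, hR.counit_right, mul_one]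

/-- `ε_t(R¹) ⊗ R² = 1₂ ⊗ 1₁` -/
theorem rTensor_targetMap : (εt).rTensor H R = comulCop 1 := by
  have e₂ : εt = lift₂ (trilin fun a b p => ϵ (a * p) • b) (Δ 1) := by
    ext p
    rw [targetMap_eq_sum]
    induction Δ 1 with
    | zero => simp
    | add x y hx hy => simp only [map_add, LinearMap.add_apply, hx, hy]
    | tmul a b => simp
  rw [e₂]
  have key := comul_one_induction (k := k) (H := H)
    (f := (LinearMap.applyₗ R) ∘ₗ LinearMap.rTensorHom H ∘ₗ
      lift₂ (trilin fun a b p => ϵ (a * p) • b)) (g := (TensorProduct.comm k H H).toLinearMap) ?_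
  · simpa only [LinearMap.comp_apply, LinearMap.applyₗ_apply_apply, LinearMap.coe_lTensorHom,
      LinearMap.coe_rTensorHom, LinearEquiv.coe_coe, comulCop] using key
  intro y hy z hz
  have : ∀ t : H ⊗[k] H, ((trilin fun a b p => ϵ (a * p) • b) y z).rTensor H t =
      z ⊗ₜ lift₂ (bilin fun a b => ϵ a • b) ((y ⊗ₜ 1) * t) := by
    intro t
    induction t with
    | zero => simp
    | add x y hx hy => simp only [map_add, mul_add, TensorProduct.tmul_add, hx, hy]
    | tmul p q => simp [TensorProduct.smul_tmul']
  have e₃ : ∀ t : H ⊗[k] H, lift₂ (bilin fun a b => ϵ a • b) (t * (1 ⊗ₜ y)) =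
      lift₂ (bilin fun a b => ϵ a • b) t * y := by
    intro t
    induction t with
    | zero => simp
    | add x y hx hy => simp only [map_add, add_mul, hx, hy]
    | tmul p q => simp
  simp only [LinearMap.comp_apply, LinearMap.applyₗ_apply_apply, LinearMap.coe_rTensorHom,
    lift₂_tmul, LinearEquiv.coe_coe, TensorProduct.comm_tmul]
  rw [this, hR.source_mul hy, e₃, hR.counit_left, one_mul]

/-- `R¹ ⊗ ε_s(R²) = 1₁ ⊗ S(1₂)` -/
theorem lTensor_sourceMap (hreg : IsRegular k H) :
    (εs).lTensor H R = (𝒮).lTensor H (Δ 1) := by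
  have e₁ : εs = lift₂ (trilin fun a b p => ϵ (p * b) • a) (Δ 1) := by
    ext p
    rw [sourceMap_eq_sum]
    induction Δ 1 with
    | zero => simp
    | add x y hx hy => simp only [map_add, LinearMap.add_apply, hx, hy]
    | tmul a b => simp
  rw [e₁, ← hreg.comm_lTensor_antipode]
  have key := comul_one_induction (k := k) (H := H)
    (f := (LinearMap.applyₗ R) ∘ₗ LinearMap.lTensorHom H ∘ₗ
      lift₂ (trilin fun a b p => ϵ (p * b) • a))
    (g := (TensorProduct.comm k H H).toLinearMap ∘ₗ (𝒮).lTensor H) ?_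
  · simpa only [LinearMap.comp_apply, LinearMap.applyₗ_apply_apply, LinearMap.coe_lTensorHom,
      LinearMap.coe_rTensorHom, LinearEquiv.coe_coe, comulCop] using key
  intro y hy z hz
  have : ∀ t : H ⊗[k] H, ((trilin fun a b p => ϵ (p * b) • a) y z).lTensor H t =
      lift₂ (bilin fun a b => ϵ b • a) (t * (1 ⊗ₜ z)) ⊗ₜ y := by
    intro t
    induction t with
    | zero => simp
    | add x y hx hy => simp only [map_add, add_mul, TensorProduct.add_tmul, hx, hy]
    | tmul p q => simp [TensorProduct.smul_tmul']
  have e₃ : ∀ t : H ⊗[k] H, lift₂ (bilin fun a b => ϵ b • a) (t * (𝒮 z ⊗ₜ 1)) =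
      lift₂ (bilin fun a b => ϵ b • a) t * 𝒮 z := by
    intro t
    induction t with
    | zero => simp
    | add x y hx hy => simp only [map_add, add_mul, hx, hy]
    | tmul p q => simp
  simp only [LinearMap.comp_apply, LinearMap.applyₗ_apply_apply, LinearMap.coe_lTensorHom,
    lift₂_tmul, LinearMap.lTensor_tmul, LinearEquiv.coe_coe, TensorProduct.comm_tmul]
  rw [this, hR.mul_target_right hreg hz, e₃, hR.counit_right, one_mul]

/-- `r¹R¹ ⊗ S(R²)r² = 1₁ ⊗ S(1₂)` -/
theorem sum_antipode_mul (hreg : IsRegular k H) :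
    lift₃ (trilin fun a b c => a ⊗ₜ[k] (𝒮 b * c)) (leg13 R * leg12 R) =
      (𝒮).lTensor H (Δ 1) := by
  rw [← hR.id_comul, ← hR.lTensor_sourceMap hreg]
  clear hR hreg
  induction R with
  | zero => simp
  | add x y hx hy => simp only [map_add, hx, hy]
  | tmul a b =>
    rw [LinearMap.lTensor_tmul, LinearMap.lTensor_tmul, ← antipode_mul]
    induction Δ b with
    | zero => simp
    | add x y hx hy => simp only [map_add, TensorProduct.tmul_add, hx, hy]
    | tmul p q => simp

/-- `r¹R¹ ⊗ R²S(r²) = S(1₁) ⊗ 1₂` -/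
theorem sum_mul_antipode (hreg : IsRegular k H) :
    lift₃ (trilin fun a b c => a ⊗ₜ[k] (b * 𝒮 c)) (leg13 R * leg12 R) =
      (𝒮).rTensor H (Δ 1) := by
  rw [← hR.id_comul, ← hR.lTensor_targetMap hreg]
  clear hR hreg
  induction R with
  | zero => simp
  | add x y hx hy => simp only [map_add, hx, hy]
  | tmul a b =>
    rw [LinearMap.lTensor_tmul, LinearMap.lTensor_tmul, ← mul_antipode]
    induction Δ b with
    | zero => simp
    | add x y hx hy => simp only [map_add, TensorProduct.tmul_add, hx, hy]
    | tmul p q => simp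

end IsQuasitriangular

end RMatrix

/-! ### The tensor product `U ⊗_t V` -/

section TensorProducts

variable {k : Type w} {H : Type u} [Field k] [Ring H] [Algebra k H] [WeakHopfAlgebra k H]

local notation "Δ" => Coalgebra.comul (R := k) (A := H)
local notation "𝒮" => antipode (k := k) (H := H)
local notation "εt" => targetMap k H
local notation "Hₜ" => targetSpace k H

omit [WeakHopfAlgebra k H] in
@[simp] theorem act2_tmul {M N : Type*} [AddCommGroup M] [Module k M] [Module H M]
    [IsScalarTower k H M] [AddCommGroup N] [Module k N] [Module H N] [IsScalarTower k H N]
    (a b : H) (m : M) (n : N) : act2 k H M N (a ⊗ₜ b) (m ⊗ₜ n) = (a • m) ⊗ₜ[k] (b • n) := rfl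

namespace CoactionRule

variable (τ : CoactionRule k H)

/-- The projection `U ⊗ V → U ⊗_t V`. -/
noncomputable def proj (U V : CoactedModule k H) : U ⊗[k] V →ₗ[k] τ.tens U V := projT k H U V

/-- The inclusion `U ⊗_t V → U ⊗ V`. -/
noncomputable def incl (U V : CoactedModule k H) : τ.tens U V →ₗ[k] U ⊗[k] V :=
  (tensorT k H U V).subtype

variable {U V W U' V' : CoactedModule k H}

/-- The element `u ⊗_t v`. -/
noncomputable def pt (u : U) (v : V) : τ.tens U V := τ.proj U V (u ⊗ₜ v)

theorem proj_tmul (u : U) (v : V) : τ.proj U V (u ⊗ₜ v) = τ.pt u v := rfl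

theorem incl_proj (x : U ⊗[k] V) : τ.incl U V (τ.proj U V x) = act2 k H U V (Δ 1) x := rfl

theorem proj_incl (x : τ.tens U V) : τ.proj U V (τ.incl U V x) = x := Subtype.ext x.2

theorem incl_injective : Function.Injective (τ.incl U V) := Subtype.val_injective

theorem proj_comul_one (x : U ⊗[k] V) : τ.proj U V (act2 k H U V (Δ 1) x) = τ.proj U V x :=
  τ.proj_incl (τ.proj U V x)

theorem comul_one_incl (x : τ.tens U V) : act2 k H U V (Δ 1) (τ.incl U V x) = τ.incl U V x := x.2

theorem act2_comul_comul_one (h : H) (x : U ⊗[k] V) :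
    act2 k H U V (Δ h) (act2 k H U V (Δ 1) x) = act2 k H U V (Δ h) x := by
  rw [← Module.End.mul_apply, ← act2_mul, comul_mul_one]

theorem incl_smul_proj (h : H) (x : U ⊗[k] V) :
    τ.incl U V (h • τ.proj U V x) = act2 k H U V (Δ h) x :=
  act2_comul_comul_one h x

theorem incl_smul (h : H) (x : τ.tens U V) :
    τ.incl U V (h • x) = act2 k H U V (Δ h) (τ.incl U V x) := rfl

theorem smul_proj (h : H) (x : U ⊗[k] V) :
    h • τ.proj U V x = τ.proj U V (act2 k H U V (Δ h) x) := by
  rw [← incl_smul_proj τ h x, proj_incl]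

theorem pt_add_left (u u' : U) (v : V) : τ.pt (u + u') v = τ.pt u v + τ.pt u' v := by
  simp only [pt, TensorProduct.add_tmul, map_add]

theorem pt_add_right (u : U) (v v' : V) : τ.pt u (v + v') = τ.pt u v + τ.pt u v' := by
  simp only [pt, TensorProduct.tmul_add, map_add]

theorem pt_zero_left (v : V) : τ.pt (0 : U) v = 0 := by
  simp only [pt, TensorProduct.zero_tmul, map_zero]

theorem pt_zero_right (u : U) : τ.pt u (0 : V) = 0 := by
  simp only [pt, TensorProduct.tmul_zero, map_zero]

/-- `U ⊗_t V` is spanned by the elements `u ⊗_t v`. -/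
theorem tens_induction {motive : τ.tens U V → Prop} (zero : motive 0)
    (add : ∀ x y, motive x → motive y → motive (x + y)) (pt : ∀ u v, motive (τ.pt u v))
    (x : τ.tens U V) : motive x := by
  rw [← τ.proj_incl x]
  induction τ.incl U V x with
  | zero => rw [map_zero]; exact zero
  | add x y hx hy => rw [map_add]; exact add _ _ hx hy
  | tmul u v => exact pt u v

theorem hom_ext_pt {D : Type*} [AddCommGroup D] [Module k D] {f g : τ.tens U V →ₗ[k] D}
    (h : ∀ u v, f (τ.pt u v) = g (τ.pt u v)) (x : τ.tens U V) : f x = g x := by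
  induction x using τ.tens_induction with
  | zero => simp
  | add x y hx hy => simp only [map_add, hx, hy]
  | pt u v => exact h u v

theorem hom_ext_pt_left {D : Type*} [AddCommGroup D] [Module k D]
    {f g : τ.tens (τ.tens U V) W →ₗ[k] D}
    (h : ∀ u v w, f (τ.pt (τ.pt u v) w) = g (τ.pt (τ.pt u v) w)) (x) : f x = g x := by
  refine τ.hom_ext_pt (fun x w => ?_) x
  induction x using τ.tens_induction with
  | zero => simp [pt_zero_left]
  | add x y hx hy => simp only [pt_add_left, map_add, hx, hy]
  | pt u v => exact h u v w

theorem hom_ext_pt_right {D : Type*} [AddCommGroup D] [Module k D]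
    {f g : τ.tens U (τ.tens V W) →ₗ[k] D}
    (h : ∀ u v w, f (τ.pt u (τ.pt v w)) = g (τ.pt u (τ.pt v w))) (x) : f x = g x := by
  refine τ.hom_ext_pt (fun u x => ?_) x
  induction x using τ.tens_induction with
  | zero => simp [pt_zero_right]
  | add x y hx hy => simp only [pt_add_right, map_add, hx, hy]
  | pt v w => exact h u v w

/-- `S(z)·u ⊗_t v = u ⊗_t z·v` for `z ∈ H_t` -/
theorem pt_antipode_smul (hreg : IsRegular k H) {z : H} (hz : z ∈ Hₜ) (u : U) (v : V) :
    τ.pt (𝒮 z • u) v = τ.pt u (z • v) := by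
  have e : ∀ a b : H, τ.pt (a • u) (b • v) = τ.proj U V (act2 k H U V (Δ 1 * (a ⊗ₜ b)) (u ⊗ₜ v)) :=
    fun a b => by
      rw [act2_mul, Module.End.mul_apply, proj_comul_one]
      rfl
  have e₁ := e (𝒮 z) 1
  have e₂ := e 1 z
  rw [one_smul] at e₁ e₂
  rw [e₁, e₂, hreg.comul_one_mul_source (antipode_target_mem hz), hreg.target hz]

/-! ### Tensor products of maps -/

section Map

variable {f : U →ₗ[k] U'} {g : V →ₗ[k] V'} (hf : ∀ (h : H) u, f (h • u) = h • f u)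
  (hg : ∀ (h : H) v, g (h • v) = h • g v)

include hf hg

omit [WeakHopfAlgebra k H] in
theorem map_act2 (t : H ⊗[k] H) (x : U ⊗[k] V) :
    TensorProduct.map f g (act2 k H U V t x) = act2 k H U' V' t (TensorProduct.map f g x) := by
  induction x with
  | zero => simp
  | add x y hx hy => simp only [map_add, hx, hy]
  | tmul u v =>
    induction t with
    | zero => simp
    | add x y hx hy => simp only [map_add, LinearMap.add_apply, hx, hy]
    | tmul a b => simp [hf, hg]

theorem mapLin_proj (x : U ⊗[k] V) :
    τ.mapLin f g (τ.proj U V x) = τ.proj U' V' (TensorProduct.map f g x) := by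
  change τ.proj U' V' (TensorProduct.map f g (act2 k H U V (Δ 1) x)) = _
  rw [map_act2 hf hg, proj_comul_one]

theorem mapLin_pt (u : U) (v : V) : τ.mapLin f g (τ.pt u v) = τ.pt (f u) (g v) :=
  τ.mapLin_proj hf hg _

theorem mapLin_smul (h : H) (x : τ.tens U V) : τ.mapLin f g (h • x) = h • τ.mapLin f g x := by
  rw [← τ.proj_incl x, smul_proj, mapLin_proj τ hf hg, mapLin_proj τ hf hg, smul_proj,
    map_act2 hf hg]

end Map

/-! ### The associativity constraint -/

/-- The componentwise action of `H ⊗ (H ⊗ H)` on `U ⊗ (V ⊗ W)`. -/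
noncomputable def act3 (U V W : CoactedModule k H) :
    H ⊗[k] (H ⊗[k] H) →ₗ[k] Module.End k (U ⊗[k] (V ⊗[k] W)) :=
  TensorProduct.homTensorHomMap (RingHom.id k) U (V ⊗[k] W) U (V ⊗[k] W) ∘ₗ
    TensorProduct.map (lact k H U) (act2 k H V W)

omit [WeakHopfAlgebra k H] in
@[simp] theorem act3_tmul (a : H) (t : H ⊗[k] H) (u : U) (x : V ⊗[k] W) :
    act3 U V W (a ⊗ₜ t) (u ⊗ₜ x) = (a • u) ⊗ₜ[k] (act2 k H V W t x) := rfl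

theorem assoc_incl_act2 (t : H ⊗[k] H) (u : U) (v : V) (w : W) :
    TensorProduct.assoc k U V W ((τ.incl U V).rTensor W
      (act2 k H (τ.tens U V) W t (τ.pt u v ⊗ₜ w))) =
      act3 U V W (TensorProduct.assoc k H H H ((Δ).rTensor H t)) (u ⊗ₜ (v ⊗ₜ w)) := by
  induction t with
  | zero => simp
  | add x y hx hy => simp only [map_add, LinearMap.add_apply, hx, hy]
  | tmul a b =>
    rw [act2_tmul, LinearMap.rTensor_tmul, pt, incl_smul_proj, LinearMap.rTensor_tmul]
    induction Δ a with
    | zero => simp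
    | add x y hx hy =>
      simp only [map_add, LinearMap.add_apply, TensorProduct.add_tmul, hx, hy]
    | tmul p q => simp

theorem assoc_symm_incl_act2 (t : H ⊗[k] H) (u : U) (v : V) (w : W) :
    (τ.incl V W).lTensor U (act2 k H U (τ.tens V W) t (u ⊗ₜ τ.pt v w)) =
      act3 U V W ((Δ).lTensor H t) (u ⊗ₜ (v ⊗ₜ w)) := by
  induction t with
  | zero => simp
  | add x y hx hy => simp only [map_add, LinearMap.add_apply, hx, hy]
  | tmul a b =>
    rw [act2_tmul, LinearMap.lTensor_tmul, pt, incl_smul_proj, LinearMap.lTensor_tmul, act3_tmul]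

theorem lTensor_proj_act3 (t : H ⊗[k] H) (u : U) (v : V) (w : W) :
    (τ.proj V W).lTensor U (act3 U V W ((Δ).lTensor H t) (u ⊗ₜ (v ⊗ₜ w))) =
      act2 k H U (τ.tens V W) t (u ⊗ₜ τ.pt v w) := by
  induction t with
  | zero => simp
  | add x y hx hy => simp only [map_add, LinearMap.add_apply, hx, hy]
  | tmul a b => rw [act2_tmul, LinearMap.lTensor_tmul, act3_tmul, LinearMap.lTensor_tmul, pt,
      smul_proj]

theorem rTensor_proj_act3 (t : H ⊗[k] H) (u : U) (v : V) (w : W) :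
    (τ.proj U V).rTensor W ((TensorProduct.assoc k U V W).symm (act3 U V W
      (TensorProduct.assoc k H H H ((Δ).rTensor H t)) (u ⊗ₜ (v ⊗ₜ w)))) =
      act2 k H (τ.tens U V) W t (τ.pt u v ⊗ₜ w) := by
  induction t with
  | zero => simp
  | add x y hx hy => simp only [map_add, LinearMap.add_apply, hx, hy]
  | tmul a b =>
    rw [act2_tmul, LinearMap.rTensor_tmul, pt, smul_proj]
    induction Δ a with
    | zero => simp
    | add x y hx hy =>
      simp only [map_add, LinearMap.add_apply, TensorProduct.add_tmul, hx, hy]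
    | tmul p q => simp

theorem assocLin_smul_pt (h : H) (u : U) (v : V) (w : W) :
    τ.assocLin U V W (h • τ.pt (τ.pt u v) w) = h • τ.pt u (τ.pt v w) := by
  change τ.proj U (τ.tens V W) ((τ.proj V W).lTensor U (TensorProduct.assoc k U V W
    ((τ.incl U V).rTensor W (τ.incl (τ.tens U V) W
      (h • τ.proj (τ.tens U V) W (τ.pt u v ⊗ₜ w)))))) = _
  rw [incl_smul_proj, assoc_incl_act2, coassoc', lTensor_proj_act3, ← smul_proj]
  rfl

theorem assocLin_pt (u : U) (v : V) (w : W) :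
    τ.assocLin U V W (τ.pt (τ.pt u v) w) = τ.pt u (τ.pt v w) := by
  simpa using τ.assocLin_smul_pt 1 u v w

theorem assocLin_smul (h : H) (x) : τ.assocLin U V W (h • x) = h • τ.assocLin U V W x := by
  refine τ.hom_ext_pt_left (f := τ.assocLin U V W ∘ₗ lact k H _ h)
    (g := lact k H _ h ∘ₗ τ.assocLin U V W) (fun u v w => ?_) x
  change τ.assocLin U V W (h • τ.pt (τ.pt u v) w) = h • τ.assocLin U V W (τ.pt (τ.pt u v) w)
  rw [assocLin_smul_pt, assocLin_pt]

/-- The inverse `u ⊗ (v ⊗ w) ↦ (u ⊗ v) ⊗ w` of the associativity constraint -/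
noncomputable def assocInvLin (U V W : CoactedModule k H) :
    τ.tens U (τ.tens V W) →ₗ[k] τ.tens (τ.tens U V) W :=
  τ.proj (τ.tens U V) W ∘ₗ (τ.proj U V).rTensor W ∘ₗ
    (TensorProduct.assoc k U V W).symm.toLinearMap ∘ₗ
    (τ.incl V W).lTensor U ∘ₗ τ.incl U (τ.tens V W)

theorem assocInvLin_pt (u : U) (v : V) (w : W) :
    τ.assocInvLin U V W (τ.pt u (τ.pt v w)) = τ.pt (τ.pt u v) w := by
  change τ.proj (τ.tens U V) W ((τ.proj U V).rTensor W ((TensorProduct.assoc k U V W).symm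
    ((τ.incl V W).lTensor U (τ.incl U (τ.tens V W)
      (τ.proj U (τ.tens V W) (u ⊗ₜ τ.pt v w)))))) = _
  rw [incl_proj, assoc_symm_incl_act2, ← coassoc', rTensor_proj_act3, proj_comul_one]
  rfl

theorem assocInvLin_assocLin (x) : τ.assocInvLin U V W (τ.assocLin U V W x) = x :=
  τ.hom_ext_pt_left (f := τ.assocInvLin U V W ∘ₗ τ.assocLin U V W) (g := LinearMap.id)
    (fun u v w => by
      rw [LinearMap.comp_apply, assocLin_pt, assocInvLin_pt, LinearMap.id_apply]) x

theorem assocLin_assocInvLin (x) : τ.assocLin U V W (τ.assocInvLin U V W x) = x :=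
  τ.hom_ext_pt_right (f := τ.assocLin U V W ∘ₗ τ.assocInvLin U V W) (g := LinearMap.id)
    (fun u v w => by
      rw [LinearMap.comp_apply, assocInvLin_pt, assocLin_pt, LinearMap.id_apply]) x

theorem assocLin_bijective : Function.Bijective (τ.assocLin U V W) :=
  Function.bijective_iff_has_inverse.2
    ⟨τ.assocInvLin U V W, τ.assocInvLin_assocLin, τ.assocLin_assocInvLin⟩

/-! ### The unit constraints -/

/-- The inclusion of the unit object into `H`. -/
noncomputable def oneIncl : τ.one →ₗ[k] H := (Hₜ).subtype

/-- The map `ε_t` from `H` onto the unit object. -/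
noncomputable def oneProj : H →ₗ[k] τ.one := (εt).rangeRestrict

theorem oneIncl_oneProj (h : H) : τ.oneIncl (τ.oneProj h) = εt h := rfl

theorem oneIncl_mem (z : τ.one) : τ.oneIncl z ∈ Hₜ := z.2

theorem oneProj_oneIncl (z : τ.one) : τ.oneProj (τ.oneIncl z) = z :=
  Subtype.ext (targetMap_of_mem z.2)

theorem oneProj_targetMap (h : H) : τ.oneProj (εt h) = τ.oneProj h :=
  Subtype.ext (targetMap_targetMap h)

theorem smul_one_eq (h : H) (z : τ.one) : h • z = τ.oneProj (h * τ.oneIncl z) := rfl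

theorem leftLin_proj_aux (t : H ⊗[k] H) (z : τ.one) (u : U) :
    actMap k H U ((τ.oneIncl).rTensor U (act2 k H τ.one U t (z ⊗ₜ u))) =
      LinearMap.mul' k H (TensorProduct.map εt LinearMap.id (t * (τ.oneIncl z ⊗ₜ 1))) • u := by
  induction t with
  | zero => simp
  | add x y hx hy => simp only [map_add, LinearMap.add_apply, add_mul, add_smul, hx, hy]
  | tmul a b =>
    simp [actMap_tmul, smul_one_eq, oneIncl_oneProj, mul_smul]

theorem leftLin_smul_pt (h : H) (z : τ.one) (u : U) :
    τ.leftLin U (h • τ.pt z u) = (h * τ.oneIncl z) • u := by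
  change actMap k H U ((τ.oneIncl).rTensor U (τ.incl τ.one U (h • τ.proj τ.one U (z ⊗ₜ u)))) = _
  rw [incl_smul_proj, leftLin_proj_aux, ← comul_mul_target h (τ.oneIncl_mem z), ← conv_apply,
    conv_targetMap_id, LinearMap.id_apply]

theorem leftLin_pt (z : τ.one) (u : U) : τ.leftLin U (τ.pt z u) = τ.oneIncl z • u := by
  simpa using τ.leftLin_smul_pt 1 z u

theorem leftLin_smul (h : H) (x) : τ.leftLin U (h • x) = h • τ.leftLin U x := by
  refine τ.hom_ext_pt (f := τ.leftLin U ∘ₗ lact k H _ h) (g := lact k H _ h ∘ₗ τ.leftLin U)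
    (fun z u => ?_) x
  change τ.leftLin U (h • τ.pt z u) = h • τ.leftLin U (τ.pt z u)
  rw [leftLin_smul_pt, leftLin_pt, mul_smul]

theorem pt_oneProj_one (hreg : IsRegular k H) (z : τ.one) (u : U) :
    τ.pt (τ.oneProj 1) (τ.oneIncl z • u) = τ.pt z u := by
  rw [← τ.pt_antipode_smul hreg (τ.oneIncl_mem z), smul_one_eq, oneIncl_oneProj, targetMap_one,
    mul_one, ← oneProj_targetMap, ← antipode_of_source (antipode_target_mem (τ.oneIncl_mem z)),
    hreg.target (τ.oneIncl_mem z), oneProj_oneIncl]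

theorem leftLin_bijective (hreg : IsRegular k H) : Function.Bijective (τ.leftLin U) := by
  refine Function.bijective_iff_has_inverse.2 ⟨fun u => τ.pt (τ.oneProj 1) u, fun x => ?_,
    fun u => ?_⟩
  · induction x using τ.tens_induction with
    | zero => simp only [map_zero, pt_zero_right]
    | add x y hx hy => simp only [map_add, pt_add_right, hx, hy]
    | pt z u => simp only [leftLin_pt, pt_oneProj_one τ hreg]
  · simp only [leftLin_pt, oneIncl_oneProj, targetMap_one, one_smul]

theorem rightLin_proj_aux (hreg : IsRegular k H) (t : H ⊗[k] H) (z : τ.one) (u : U) :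
    actMap k H U (TensorProduct.comm k U H ((𝒮 ∘ₗ τ.oneIncl).lTensor U
      (act2 k H U τ.one t (u ⊗ₜ z)))) = lift₂ (bilin fun a b => 𝒮 b * a)
        ((εt).lTensor H (t * (1 ⊗ₜ 𝒮 (τ.oneIncl z)))) • u := by
  have hz : τ.oneIncl z = εt (𝒮 (τ.oneIncl z)) := by
    rw [← antipode_of_source (antipode_target_mem (τ.oneIncl_mem z)),
      hreg.target (τ.oneIncl_mem z)]
  induction t with
  | zero => simp
  | add x y hx hy => simp only [map_add, LinearMap.add_apply, add_mul, add_smul, hx, hy]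
  | tmul a b =>
    simp [actMap_tmul, smul_one_eq, oneIncl_oneProj, mul_smul]
    conv_lhs => rw [hz, targetMap_mul_targetMap]

theorem rightLin_smul_pt (hreg : IsRegular k H) (h : H) (u : U) (z : τ.one) :
    τ.rightLin U (h • τ.pt u z) = (h * 𝒮 (τ.oneIncl z)) • u := by
  change actMap k H U (TensorProduct.comm k U H ((𝒮 ∘ₗ τ.oneIncl).lTensor U
    (τ.incl U τ.one (h • τ.proj U τ.one (u ⊗ₜ z))))) = _
  rw [incl_smul_proj, rightLin_proj_aux τ hreg,
    ← comul_mul_source h (antipode_target_mem (τ.oneIncl_mem z)), lTensor_targetMap_comul]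
  generalize h * 𝒮 (τ.oneIncl z) = g
  have : ∀ t : H ⊗[k] H, lift₂ (bilin fun a b => 𝒮 b * a) (t * (g ⊗ₜ 1)) =
      lift₂ (bilin fun a b => 𝒮 b * a) t * g := by
    intro t
    induction t with
    | zero => simp
    | add x y hx hy => simp only [map_add, add_mul, hx, hy]
    | tmul a b => simp [mul_assoc]
  rw [this, hreg.antipode_mul_comul_one, one_mul]

theorem rightLin_pt (hreg : IsRegular k H) (u : U) (z : τ.one) :
    τ.rightLin U (τ.pt u z) = 𝒮 (τ.oneIncl z) • u := by
  simpa using τ.rightLin_smul_pt hreg 1 u z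

theorem rightLin_smul (hreg : IsRegular k H) (h : H) (x) :
    τ.rightLin U (h • x) = h • τ.rightLin U x := by
  refine τ.hom_ext_pt (f := τ.rightLin U ∘ₗ lact k H _ h) (g := lact k H _ h ∘ₗ τ.rightLin U)
    (fun u z => ?_) x
  change τ.rightLin U (h • τ.pt u z) = h • τ.rightLin U (τ.pt u z)
  rw [rightLin_smul_pt τ hreg, rightLin_pt τ hreg, mul_smul]

theorem pt_one (hreg : IsRegular k H) (u : U) (z : τ.one) :
    τ.pt (𝒮 (τ.oneIncl z) • u) (τ.oneProj 1) = τ.pt u z := by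
  rw [τ.pt_antipode_smul hreg (τ.oneIncl_mem z), smul_one_eq, oneIncl_oneProj, targetMap_one,
    mul_one, oneProj_oneIncl]

theorem rightLin_bijective (hreg : IsRegular k H) : Function.Bijective (τ.rightLin U) := by
  refine Function.bijective_iff_has_inverse.2 ⟨fun u => τ.pt u (τ.oneProj 1), fun x => ?_,
    fun u => ?_⟩
  · induction x using τ.tens_induction with
    | zero => simp only [map_zero, pt_zero_left]
    | add x y hx hy => simp only [map_add, pt_add_left, hx, hy]
    | pt u z => simp only [rightLin_pt τ hreg, pt_one τ hreg]
  · simp only [rightLin_pt τ hreg, oneIncl_oneProj, targetMap_one, antipode_one, one_smul]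

end CoactionRule

end TensorProducts

/-! ### The monoidal category axioms -/

section Coherence

variable {k : Type w} {H : Type u} [Field k] [Ring H] [Algebra k H] [WeakHopfAlgebra k H]

namespace CoactionRule

variable {τ : CoactionRule k H} {P : ObjectProperty (CoactedModule k H)}

omit [WeakHopfAlgebra k H] in
theorem map_smul_hom {U V : P.FullSubcategory} (f : U ⟶ V) (h : H) (x : U.obj) :
    f.hom.toLin (h • x) = h • f.hom.toLin x :=
  f.hom.isMorphism.map_smul h x

omit [WeakHopfAlgebra k H] in
theorem map_smul_id (U : CoactedModule k H) (h : H) (x : U) :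
    (LinearMap.id : U →ₗ[k] U) (h • x) = h • (LinearMap.id : U →ₗ[k] U) x := rfl

omit [WeakHopfAlgebra k H] in
/-- The inverse of `isoMk f` at `y` is any preimage of `y` under `f`. -/
theorem isoMk_inv_apply {U V : P.FullSubcategory} {f : U.obj →ₗ[k] V.obj}
    {hf : CoactedModule.IsMorphism f} {hb : Function.Bijective f} {g : V.obj → U.obj}
    {y : V.obj} (hg : f (g y) = y) : (isoMk f hf hb).inv.hom.toLin y = g y := by
  change (LinearEquiv.ofBijective f hb).symm y = g y
  rw [LinearEquiv.symm_apply_eq]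
  exact hg.symm

omit [WeakHopfAlgebra k H] in
theorem lin_hom_ext {U V : P.FullSubcategory} {f g : U ⟶ V}
    (h : f.hom.toLin = g.hom.toLin) : f = g :=
  ObjectProperty.hom_ext _ (CoactedModule.Hom.ext h)

/-- The constraints satisfy the axioms of a monoidal category as soon as they are well defined. -/
theorem IsClosed.isMonoidal (hreg : IsRegular k H) (h : τ.IsClosed P) : τ.IsMonoidal P where
  isClosed := h
  lawful := ⟨{ h.struct with
    tensorHom_def := fun {X₁ Y₁ X₂ Y₂} f g => lin_hom_ext (LinearMap.ext (τ.hom_ext_pt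
        fun u v => by
      change τ.mapLin f.hom.toLin g.hom.toLin (τ.pt u v) =
        τ.mapLin LinearMap.id g.hom.toLin (τ.mapLin f.hom.toLin LinearMap.id (τ.pt u v))
      rw [mapLin_pt τ (map_smul_hom f) (map_smul_hom g),
        mapLin_pt τ (map_smul_hom f) (map_smul_id _), mapLin_pt τ (map_smul_id _) (map_smul_hom g)]
      rfl))
    id_tensorHom_id := fun X₁ X₂ => lin_hom_ext (LinearMap.ext (τ.hom_ext_pt fun u v => by
      change τ.mapLin LinearMap.id LinearMap.id (τ.pt u v) = τ.pt u v
      rw [mapLin_pt τ (map_smul_id _) (map_smul_id _)]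
      rfl))
    tensorHom_comp_tensorHom := fun {X₁ Y₁ Z₁ X₂ Y₂ Z₂} f₁ f₂ g₁ g₂ =>
        lin_hom_ext (LinearMap.ext (τ.hom_ext_pt fun u v => by
      change τ.mapLin g₁.hom.toLin g₂.hom.toLin (τ.mapLin f₁.hom.toLin f₂.hom.toLin (τ.pt u v)) =
        τ.mapLin (f₁ ≫ g₁).hom.toLin (f₂ ≫ g₂).hom.toLin (τ.pt u v)
      rw [mapLin_pt τ (map_smul_hom f₁) (map_smul_hom f₂),
        mapLin_pt τ (map_smul_hom g₁) (map_smul_hom g₂),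
        mapLin_pt τ (map_smul_hom _) (map_smul_hom _)]
      rfl))
    whiskerLeft_id := fun X Y => lin_hom_ext (LinearMap.ext (τ.hom_ext_pt fun u v => by
      change τ.mapLin LinearMap.id LinearMap.id (τ.pt u v) = τ.pt u v
      rw [mapLin_pt τ (map_smul_id _) (map_smul_id _)]
      rfl))
    id_whiskerRight := fun X Y => lin_hom_ext (LinearMap.ext (τ.hom_ext_pt fun u v => by
      change τ.mapLin LinearMap.id LinearMap.id (τ.pt u v) = τ.pt u v
      rw [mapLin_pt τ (map_smul_id _) (map_smul_id _)]
      rfl))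
    associator_naturality := fun {X₁ X₂ X₃ Y₁ Y₂ Y₃} f₁ f₂ f₃ =>
        lin_hom_ext (LinearMap.ext (τ.hom_ext_pt_left fun u v w => by
      change τ.assocLin _ _ _ (τ.mapLin (τ.mapLin f₁.hom.toLin f₂.hom.toLin) f₃.hom.toLin
          (τ.pt (τ.pt u v) w)) =
        τ.mapLin f₁.hom.toLin (τ.mapLin f₂.hom.toLin f₃.hom.toLin)
          (τ.assocLin _ _ _ (τ.pt (τ.pt u v) w))
      rw [mapLin_pt τ (mapLin_smul τ (map_smul_hom f₁) (map_smul_hom f₂)) (map_smul_hom f₃),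
        mapLin_pt τ (map_smul_hom f₁) (map_smul_hom f₂), assocLin_pt, assocLin_pt,
        mapLin_pt τ (map_smul_hom f₁) (mapLin_smul τ (map_smul_hom f₂) (map_smul_hom f₃)),
        mapLin_pt τ (map_smul_hom f₂) (map_smul_hom f₃)]))
    leftUnitor_naturality := fun {X Y} f => lin_hom_ext (LinearMap.ext (τ.hom_ext_pt fun z u => by
      change τ.leftLin _ (τ.mapLin LinearMap.id f.hom.toLin (τ.pt z u)) =
        f.hom.toLin (τ.leftLin _ (τ.pt z u))
      rw [mapLin_pt τ (map_smul_id _) (map_smul_hom f), leftLin_pt, leftLin_pt, map_smul_hom]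
      rfl))
    rightUnitor_naturality := fun {X Y} f => lin_hom_ext (LinearMap.ext (τ.hom_ext_pt fun u z => by
      change τ.rightLin _ (τ.mapLin f.hom.toLin LinearMap.id (τ.pt u z)) =
        f.hom.toLin (τ.rightLin _ (τ.pt u z))
      rw [mapLin_pt τ (map_smul_hom f) (map_smul_id _), rightLin_pt τ hreg, rightLin_pt τ hreg,
        map_smul_hom]
      rfl))
    pentagon := fun W X Y Z => lin_hom_ext (LinearMap.ext (τ.hom_ext_pt fun x z => by
      induction x using τ.tens_induction with
      | zero => rw [pt_zero_left, map_zero, map_zero]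
      | add x y hx hy => rw [pt_add_left, map_add, map_add, hx, hy]
      | pt x y =>
        induction x using τ.tens_induction with
        | zero => rw [pt_zero_left, pt_zero_left, map_zero, map_zero]
        | add x y hx hy => rw [pt_add_left, pt_add_left, map_add, map_add, hx, hy]
        | pt w x =>
          change τ.mapLin LinearMap.id (τ.assocLin _ _ _) (τ.assocLin _ _ _
              (τ.mapLin (τ.assocLin _ _ _) LinearMap.id (τ.pt (τ.pt (τ.pt w x) y) z))) =
            τ.assocLin _ _ _ (τ.assocLin _ _ _ (τ.pt (τ.pt (τ.pt w x) y) z))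
          rw [mapLin_pt τ (assocLin_smul τ) (map_smul_id _), assocLin_pt, assocLin_pt, assocLin_pt,
            LinearMap.id_apply, assocLin_pt, mapLin_pt τ (map_smul_id _) (assocLin_smul τ),
            assocLin_pt]
          rfl))
    triangle := fun X Y => lin_hom_ext (LinearMap.ext (τ.hom_ext_pt_left fun u z v => by
      change τ.mapLin LinearMap.id (τ.leftLin _) (τ.assocLin _ _ _ (τ.pt (τ.pt u z) v)) =
        τ.mapLin (τ.rightLin _) LinearMap.id (τ.pt (τ.pt u z) v)
      rw [assocLin_pt, mapLin_pt τ (map_smul_id _) (leftLin_smul τ), leftLin_pt,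
        mapLin_pt τ (rightLin_smul τ hreg) (map_smul_id _), rightLin_pt τ hreg]
      exact (τ.pt_antipode_smul hreg (τ.oneIncl_mem z) u v).symm)) }, rfl⟩

end CoactionRule

end Coherence

/-! ### The compatibility condition of Yetter-Drinfeld modules -/

section YetterDrinfeldModules

variable {k : Type w} {H : Type u} [Field k] [Ring H] [Algebra k H] [WeakHopfAlgebra k H]

local notation "Δ" => Coalgebra.comul (R := k) (A := H)
local notation "𝒮" => antipode (k := k) (H := H)
local notation "εt" => targetMap k H
local notation "εs" => sourceMap k H

variable {N U V : CoactedModule k H}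

theorem ydAct_tmul (h x : H) (n : N) : ydAct N h (x ⊗ₜ n) =
    lift₃ (trilin fun a b c => (a * (x * 𝒮 c)) ⊗ₜ[k] (b • n)) ((Δ).lTensor H (Δ h)) := by
  have : ∀ t : H ⊗[k] (H ⊗[k] H), (TensorProduct.homTensorHomMap (RingHom.id k) H N H N
      (TensorProduct.map (sandwich k H) (lact k H N) ((TensorProduct.assoc k H H H).symm
        ((TensorProduct.comm k H H).toLinearMap.lTensor H t)))) (x ⊗ₜ n) =
      lift₃ (trilin fun a b c => (a * (x * 𝒮 c)) ⊗ₜ[k] (b • n)) t := by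
    intro t
    induction t with
    | zero => simp
    | add x y hx hy => simp only [map_add, LinearMap.add_apply, hx, hy]
    | tmul a t =>
      induction t with
      | zero => simp
      | add x y hx hy =>
        simp only [map_add, TensorProduct.tmul_add, LinearMap.add_apply, hx, hy]
      | tmul b c => simp [sandwich_tmul]
  exact this _

/-- The twists by `a ⊗ S(b)` compose according to the product in `H ⊗ H`. -/
theorem twistBy_antipode_mul (s t : H ⊗[k] H) (y : H ⊗[k] N) :
    twistBy (lact k H N) ((𝒮).lTensor H s) (twistBy (lact k H N) ((𝒮).lTensor H t) y) =
      twistBy (lact k H N) ((𝒮).lTensor H (s * t)) y := by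
  have add : ∀ X Y : H ⊗[k] H, twistBy (lact k H N) (X + Y) =
      twistBy (lact k H N) X + twistBy (lact k H N) Y := fun X Y => by simp [twistBy]
  have zero : twistBy (lact k H N) (0 : H ⊗[k] H) = 0 := by simp [twistBy]
  induction y with
  | zero => simp
  | add x y hx hy => simp only [map_add, hx, hy]
  | tmul x n =>
    induction s with
    | zero => simp [zero]
    | add x y hx hy => simp only [map_add, add, add_mul, LinearMap.add_apply, hx, hy]
    | tmul a b =>
      induction t with
      | zero => simp [zero]
      | add x y hx hy => simp only [map_add, add, mul_add, LinearMap.add_apply, hx, hy]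
      | tmul c d => simp [twistBy_tmul, antipode_mul_rev, mul_smul, mul_assoc]

/-- A form of the compatibility condition of Yetter-Drinfeld modules that does not involve the
antipode: `h₁n₋₁ ⊗ h₂n₀ = (h₁n)₋₁h₂ ⊗ (h₁n)₀`, together with `ρ(n) ∈ H ⊗_t N`. -/
structure IsCrossed (N : CoactedModule k H) : Prop where
  coact_mem : ∀ n : N, act2 k H H N (Δ 1) (N.coact n) = N.coact n
  cross : ∀ (h : H) (n : N), act2 k H H N (Δ h) (N.coact n) =
    lift₂ (bilin fun a b => rmul N b (N.coact (a • n))) (Δ h)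

/-- `1₁xS(1₃) ⊗ 1₂·n = 1₁xS(1₂') ⊗ 1₁'1₂·n`, since `Δ²(1) = 1₁ ⊗ 1₁'1₂ ⊗ 1₂'`. -/
theorem ydAct_one (y : H ⊗[k] N) :
    ydAct N 1 y = twistBy (lact k H N) ((𝒮).lTensor H (Δ 1)) (act2 k H H N (Δ 1) y) := by
  have add : ∀ X Y : H ⊗[k] H, twistBy (lact k H N) (X + Y) =
      twistBy (lact k H N) X + twistBy (lact k H N) Y := fun X Y => by simp [twistBy]
  have zero : twistBy (lact k H N) (0 : H ⊗[k] H) = 0 := by simp [twistBy]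
  induction y with
  | zero => simp
  | add x y hx hy => simp only [map_add, hx, hy]
  | tmul x n =>
    rw [ydAct_tmul, comul_one_right]
    have : ∀ s t : H ⊗[k] H, lift₃ (trilin fun a b c => (a * (x * 𝒮 c)) ⊗ₜ[k] (b • n))
        (((1 : H) ⊗ₜ[k] s) * TensorProduct.assoc k H H H (t ⊗ₜ (1 : H))) =
        twistBy (lact k H N) ((𝒮).lTensor H s) (act2 k H H N t (x ⊗ₜ n)) := by
      intro s t
      induction s with
      | zero => simp [zero]
      | add x y hx hy =>
        simp only [map_add, add, TensorProduct.tmul_add, add_mul, LinearMap.add_apply, hx, hy]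
      | tmul a b =>
        induction t with
        | zero => simp
        | add x y hx hy =>
          simp only [map_add, TensorProduct.add_tmul, mul_add, LinearMap.add_apply, hx, hy]
        | tmul c d => simp [twistBy_tmul, mul_smul, mul_assoc]
    exact this _ _

/-- `n₋₁S(1₂) ⊗ 1₁n₀ = n₋₁ ⊗ n₀` -/
theorem IsYetterDrinfeld.twistBy_coact (hN : IsYetterDrinfeld N) (n : N) :
    twistBy (lact k H N) ((𝒮).lTensor H (Δ 1)) (N.coact n) = N.coact n := by
  have h : N.coact n = ydAct N 1 (N.coact n) := by rw [← hN.coact_smul, one_smul]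
  rw [ydAct_one] at h
  conv_lhs => rw [h, twistBy_antipode_mul, comul_one_mul]
  exact h.symm

/-- `h₁xS(h₃)h₄ ⊗ h₂·n = h₁xS(1₂) ⊗ h₂1₁·n`: here `S(h₃)h₄` is `ε_s(h₃)`, and
`h₂ ⊗ ε_s(h₃) = h₂1₁ ⊗ S(1₂)`. -/
theorem sum_rmul_ydAct (h : H) (y : H ⊗[k] N) :
    lift₂ (bilin fun a b => rmul N b (ydAct N a y)) (Δ h) =
      act2 k H H N (Δ h) (twistBy (lact k H N) ((𝒮).lTensor H (Δ 1)) y) := by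
  have add : ∀ X Y : H ⊗[k] H, twistBy (lact k H N) (X + Y) =
      twistBy (lact k H N) X + twistBy (lact k H N) Y := fun X Y => by simp [twistBy]
  have zero : twistBy (lact k H N) (0 : H ⊗[k] H) = 0 := by simp [twistBy]
  induction y with
  | zero =>
    simp only [map_zero]
    induction Δ h with
    | zero => simp
    | add x y hx hy => simp only [map_add, hx, hy, add_zero]
    | tmul a b => simp
  | add x y hx hy =>
    rw [map_add, map_add, ← hx, ← hy]
    induction Δ h with
    | zero => simp
    | add x y hx hy => simp only [map_add] at hx hy ⊢; rw [hx, hy]; abel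
    | tmul a b => simp
  | tmul x n =>
    let T : H →ₗ[k] H ⊗[k] N := lift₂ (bilin fun p q => (x * 𝒮 q) ⊗ₜ[k] (p • n)) ∘ₗ Δ
    have inner : ∀ g : H, lift₂ (bilin fun a b => rmul N b (T a)) (Δ g) =
        (lact k H N g).lTensor H (twistBy (lact k H N) ((𝒮).lTensor H (Δ 1)) (x ⊗ₜ n)) := by
      intro g
      have e₁ : ∀ t : H ⊗[k] H, (lact k H N g).lTensor H
          (twistBy (lact k H N) t (x ⊗ₜ n)) =
          lift₂ (bilin fun a b => (x * b) ⊗ₜ[k] (a • n)) ((g ⊗ₜ 1) * t) := by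
        intro t
        induction t with
        | zero => simp [zero]
        | add x y hx hy => simp only [map_add, add, LinearMap.add_apply, mul_add, hx, hy]
        | tmul a b => simp [twistBy_tmul, mul_smul]
      rw [e₁, ← lTensor_sourceMap_comul_one, ← lTensor_sourceMap_comul]
      have e₂ : ∀ t : H ⊗[k] H, lift₂ (bilin fun a b => (x * b) ⊗ₜ[k] (a • n))
          ((εs).lTensor H t) = lift₂ (bilin fun a b => (x * εs b) ⊗ₜ[k] (a • n)) t := by
        intro t
        induction t with
        | zero => simp
        | add x y hx hy => simp only [map_add, hx, hy]
        | tmul a b => simp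
      rw [e₂]
      refine sum_comul_comul _ _ (trilin fun a b c => (x * 𝒮 b * c) ⊗ₜ[k] (a • n)) ?_ ?_ g
      · intro a c
        simp only [bilin_apply, T, LinearMap.comp_apply]
        induction Δ a with
        | zero => simp
        | add x y hx hy => simp only [map_add, LinearMap.add_apply, hx, hy]
        | tmul a b => simp
      · intro a c
        rw [bilin_apply, ← antipode_mul]
        induction Δ c with
        | zero => simp
        | add x y hx hy => simp only [map_add, mul_add, TensorProduct.add_tmul, hx, hy]
        | tmul a b => simp [mul_assoc]
    have outer : ∀ (t : H ⊗[k] H) (y : H ⊗[k] N), act2 k H H N t y =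
        lift₂ (bilin fun p q => lmul N p ((lact k H N q).lTensor H y)) t := by
      intro t y
      induction y with
      | zero =>
        rw [map_zero]
        induction t with
        | zero => simp
        | add x y hx hy => rw [map_add, ← hx, ← hy, add_zero]
        | tmul a b => simp
      | add x y hx hy =>
        rw [map_add, hx, hy]
        clear hx hy
        induction t with
        | zero => simp
        | add x y hx hy => simp only [map_add] at hx hy ⊢; rw [← hx, ← hy]; abel
        | tmul a b => simp
      | tmul x n =>
        induction t with
        | zero => simp
        | add x y hx hy => simp only [map_add, LinearMap.add_apply, hx, hy]
        | tmul a b => simp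
    rw [outer]
    refine sum_comul_comul _ _ (trilin fun a b c => rmul N c (lmul N a (T b))) ?_ ?_ h
    · intro a c
      rw [bilin_apply, ydAct_tmul]
      induction Δ a with
      | zero => simp
      | add x y hx hy => simp only [map_add, LinearMap.add_apply, hx, hy]
      | tmul a b =>
        simp only [LinearMap.lTensor_tmul, lift₂_tmul, trilin_apply, T, LinearMap.comp_apply]
        congr 1
        induction Δ b with
        | zero => simp
        | add x y hx hy => simp only [map_add, TensorProduct.tmul_add, hx, hy]
        | tmul p q => simp
    · intro a c
      rw [bilin_apply, ← inner]
      induction Δ c with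
      | zero => simp
      | add x y hx hy => simp only [map_add, hx, hy]
      | tmul p q =>
        simp only [lift₂_tmul, bilin_apply, trilin_apply]
        induction T p with
        | zero => simp
        | add x y hx hy => simp only [map_add, hx, hy]
        | tmul x n => simp [mul_assoc]

/-- Multiplication of the condition for `(h₁n)₋₁ ⊗ (h₁n)₀` by `h₂` cancels the antipode. -/
theorem IsYetterDrinfeld.isCrossed (hN : IsYetterDrinfeld N) : IsCrossed N where
  coact_mem n := hN.coact_mem n
  cross h n := by
    rw [lift₂_congr (F' := bilin fun a b => rmul N b (ydAct N a (N.coact n))) _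
      (fun a b => by simp [hN.coact_smul]), sum_rmul_ydAct, hN.twistBy_coact]

/-- The converse of `IsYetterDrinfeld.isCrossed`: `h₁n₋₁S(h₃) ⊗ h₂n₀ = (h₁n)₋₁ε_t(h₂) ⊗ (h₁n)₀`, and
`h₁ ⊗ ε_t(h₂) = 1₁h ⊗ 1₂`. -/
theorem IsCrossed.coact_smul (hN : IsCrossed N) (h : H) (n : N) :
    N.coact (h • n) = ydAct N h (N.coact n) := by
  have e₁ : ∀ y : H ⊗[k] N, ydAct N h y =
      lift₂ (bilin fun p c => rmul N (𝒮 c) (act2 k H H N (Δ p) y)) (Δ h) := by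
    intro y
    induction y with
    | zero =>
      rw [map_zero]
      induction Δ h with
      | zero => simp
      | add x y hx hy => rw [map_add, ← hx, ← hy, add_zero]
      | tmul a b => simp
    | add x y hx hy =>
      rw [map_add, hx, hy]
      induction Δ h with
      | zero => simp
      | add x y hx hy => simp only [map_add] at hx hy ⊢; rw [← hx, ← hy]; abel
      | tmul a b => simp
    | tmul x m =>
      rw [ydAct_tmul, ← coassoc']
      induction Δ h with
      | zero => simp
      | add x y hx hy => simp only [map_add, hx, hy]
      | tmul p c =>
        rw [LinearMap.rTensor_tmul, lift₂_tmul, bilin_apply]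
        induction Δ p with
        | zero => simp
        | add x y hx hy =>
          simp only [TensorProduct.add_tmul, map_add, LinearMap.add_apply, hx, hy]
        | tmul a b => simp [mul_assoc]
  have e₂ : lift₂ (bilin fun p c => rmul N (𝒮 c) (act2 k H H N (Δ p) (N.coact n))) (Δ h) =
      lift₂ (bilin fun a b => rmul N (εt b) (N.coact (a • n))) (Δ h) := by
    refine sum_comul_comul _ _
      (trilin fun a b c => rmul N (b * 𝒮 c) (N.coact (a • n))) ?_ ?_ h
    · intro p c
      rw [bilin_apply, hN.cross]
      induction Δ p with
      | zero => simp
      | add x y hx hy => simp only [map_add, LinearMap.add_apply, hx, hy]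
      | tmul a b =>
        simp only [lift₂_tmul, bilin_apply, trilin_apply]
        induction N.coact (a • n) with
        | zero => simp
        | add x y hx hy => simp only [map_add, hx, hy]
        | tmul x n => simp [mul_assoc]
    · intro a c
      rw [bilin_apply, ← mul_antipode]
      induction Δ c with
      | zero => simp
      | add x y hx hy => simp only [map_add, LinearMap.add_apply, hx, hy]
      | tmul p q => simp
  have e₃ : ∀ t : H ⊗[k] H, lift₂ (bilin fun a b => rmul N (εt b) (N.coact (a • n))) t =
      lift₂ (bilin fun a b => rmul N b (N.coact (a • n))) ((εt).lTensor H t) := by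
    intro t
    induction t with
    | zero => simp
    | add x y hx hy => simp only [map_add, hx, hy]
    | tmul a b => simp
  have e₄ : ∀ t : H ⊗[k] H, lift₂ (bilin fun a b => rmul N b (N.coact (a • n))) (t * (h ⊗ₜ 1)) =
      lift₂ (bilin fun a b => rmul N b (N.coact (a • h • n))) t := by
    intro t
    induction t with
    | zero => simp
    | add x y hx hy => simp only [map_add, add_mul, hx, hy]
    | tmul a b => simp [mul_smul]
  rw [e₁, e₂, e₃, lTensor_targetMap_comul, e₄, ← hN.cross, hN.coact_mem]

end YetterDrinfeldModules

/-! ### The codiagonal coaction -/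

section YetterDrinfeldTensor

variable {k : Type w} {H : Type u} [Field k] [Ring H] [Algebra k H] [WeakHopfAlgebra k H]

local notation "Δ" => Coalgebra.comul (R := k) (A := H)
local notation "𝒮" => antipode (k := k) (H := H)
local notation "Hₜ" => targetSpace k H
local notation "Hₛ" => sourceSpace k H

/-- For `t = ∑ a ⊗ b`, the map `x ↦ ∑ (α(a)x)₋₁ b ⊗ (α(a)x)₀`. -/
noncomputable def crossBy {X : Type*} [AddCommGroup X] [Module k X] (ρ : X →ₗ[k] H ⊗[k] X)
    (α : H →ₗ[k] Module.End k X) : H ⊗[k] H →ₗ[k] X →ₗ[k] H ⊗[k] X :=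
  lift₂ (bilin (fun a b => rmul X b ∘ₗ ρ ∘ₗ α a)
    (by intros; ext; simp) (by intros; ext; simp) (by intros; ext; simp) (by intros; ext; simp))

omit [WeakHopfAlgebra k H] in
@[simp] theorem crossBy_tmul {X : Type*} [AddCommGroup X] [Module k X] (ρ : X →ₗ[k] H ⊗[k] X)
    (α : H →ₗ[k] Module.End k X) (a b : H) (x : X) :
    crossBy ρ α (a ⊗ₜ b) x = rmul X b (ρ (α a x)) := rfl

variable {N U V W U' V' : CoactedModule k H}

omit [WeakHopfAlgebra k H] in
theorem crossBy_mul_tmul (t : H ⊗[k] H) (a b : H) (n : N) :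
    crossBy N.coact (lact k H N) (t * (a ⊗ₜ b)) n =
      rmul N b (crossBy N.coact (lact k H N) t (a • n)) := by
  induction t with
  | zero => simp
  | add x y hx hy => simp only [map_add, add_mul, LinearMap.add_apply, hx, hy]
  | tmul c d =>
    simp only [Algebra.TensorProduct.tmul_mul_tmul, crossBy_tmul, lact_apply, mul_smul]
    generalize N.coact (c • a • n) = y
    induction y with
    | zero => simp
    | add x y hx hy => simp only [map_add, hx, hy]
    | tmul x n => simp [mul_assoc]

namespace IsCrossed

variable (hN : IsCrossed N)
include hN

theorem crossBy_comul (h : H) (n : N) :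
    crossBy N.coact (lact k H N) (Δ h) n = act2 k H H N (Δ h) (N.coact n) := by
  rw [hN.cross]
  induction Δ h with
  | zero => simp
  | add x y hx hy => simp only [map_add, LinearMap.add_apply, hx, hy]
  | tmul a b => simp

theorem crossBy_comul_one (n : N) :
    crossBy N.coact (lact k H N) (Δ 1) n = N.coact n := by
  rw [hN.crossBy_comul, hN.coact_mem]

/-- `ρ(z·n) = z n₋₁ ⊗ n₀` for `z ∈ H_t` -/
theorem coact_target_smul {z : H} (hz : z ∈ Hₜ) (n : N) :
    N.coact (z • n) = lmul N z (N.coact n) := by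
  have h := hN.crossBy_comul z n
  rw [comul_of_mem_target' hz, crossBy_mul_tmul, hN.crossBy_comul_one,
    ← comul_of_mem_target' hz, comul_of_mem_target hz, act2_mul, Module.End.mul_apply,
    hN.coact_mem] at h
  calc N.coact (z • n) = rmul N 1 (N.coact (z • n)) := by
        generalize N.coact (z • n) = y
        induction y with
        | zero => simp
        | add x y hx hy => rw [map_add, ← hx, ← hy]
        | tmul x n => simp
    _ = _ := by
      rw [h]
      generalize N.coact n = y
      induction y with
      | zero => simp
      | add x y hx hy => simp only [map_add, hx, hy]
      | tmul x n => simp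

/-- `n₋₁ ⊗ y·n₀ = n₋₁ y ⊗ n₀` for `y ∈ H_s` -/
theorem source_smul_coact {y : H} (hy : y ∈ Hₛ) (n : N) :
    act2 k H H N (1 ⊗ₜ y) (N.coact n) = rmul N y (N.coact n) := by
  have h := hN.crossBy_comul y n
  rw [comul_of_mem_source' hy, crossBy_mul_tmul, one_smul, hN.crossBy_comul_one,
    ← comul_of_mem_source' hy, comul_of_mem_source hy, act2_mul, Module.End.mul_apply,
    hN.coact_mem] at h
  exact h.symm

/-- `ρ(y·n) = n₋₁ S(y) ⊗ n₀` for `y ∈ H_s` -/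
theorem coact_source_smul (hreg : IsRegular k H) {y : H} (hy : y ∈ Hₛ) (n : N) :
    N.coact (y • n) = rmul N (𝒮 y) (N.coact n) := by
  have h := crossBy_mul_tmul (Δ 1) y 1 n
  rw [hreg.comul_one_mul_source hy, crossBy_mul_tmul, one_smul, hN.crossBy_comul_one,
    hN.crossBy_comul_one] at h
  rw [h]
  generalize N.coact (y • n) = x
  induction x with
  | zero => simp
  | add x y hx hy => rw [map_add, ← hx, ← hy]
  | tmul x n => simp

/-- `n₋₁ ⊗ z·n₀ = S(z) n₋₁ ⊗ n₀` for `z ∈ H_t` -/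
theorem target_smul_coact (hreg : IsRegular k H) {z : H} (hz : z ∈ Hₜ) (n : N) :
    act2 k H H N (1 ⊗ₜ z) (N.coact n) = lmul N (𝒮 z) (N.coact n) := by
  have h := congrArg (fun t => act2 k H H N t (N.coact n))
    (hreg.source_mul_comul_one (antipode_target_mem hz))
  simp only [act2_mul, Module.End.mul_apply, hN.coact_mem, hreg.target hz] at h
  rw [← h]
  generalize N.coact n = x
  induction x with
  | zero => simp
  | add x y hx hy => simp only [map_add, hx, hy]
  | tmul x n => simp

end IsCrossed

/-- `(a ⊗ u) ⊗ (b ⊗ v) ↦ ab ⊗ (u ⊗ v)` -/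
noncomputable def mulTens (U V : Type*) [AddCommGroup U] [Module k U] [AddCommGroup V]
    [Module k V] : (H ⊗[k] U) ⊗[k] (H ⊗[k] V) →ₗ[k] H ⊗[k] (U ⊗[k] V) :=
  (LinearMap.mul' k H).rTensor (U ⊗[k] V) ∘ₗ
    (TensorProduct.tensorTensorTensorComm k H U H V).toLinearMap

omit [WeakHopfAlgebra k H] in
@[simp] theorem mulTens_tmul {U V : Type*} [AddCommGroup U] [Module k U] [AddCommGroup V]
    [Module k V] (a b : H) (u : U) (v : V) :
    mulTens (k := k) U V ((a ⊗ₜ u) ⊗ₜ (b ⊗ₜ v)) = (a * b) ⊗ₜ (u ⊗ₜ v) := rfl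

/-- The codiagonal coaction `u ⊗ v ↦ u₋₁v₋₁ ⊗ (u₀ ⊗ v₀)` on `U ⊗ V`. -/
noncomputable def coactTens (U V : CoactedModule k H) : U ⊗[k] V →ₗ[k] H ⊗[k] (U ⊗[k] V) :=
  mulTens U V ∘ₗ TensorProduct.map U.coact V.coact

omit [WeakHopfAlgebra k H] in
theorem coactTens_tmul (u : U) (v : V) :
    coactTens U V (u ⊗ₜ v) = mulTens U V (U.coact u ⊗ₜ V.coact v) := rfl

/-- The diagonal action `h·x = Δ(h)x` on `U ⊗ V`. -/
noncomputable def actTens (U V : CoactedModule k H) : H →ₗ[k] Module.End k (U ⊗[k] V) :=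
  act2 k H U V ∘ₗ Δ

theorem actTens_apply (h : H) (x : U ⊗[k] V) : actTens U V h x = act2 k H U V (Δ h) x := rfl

omit [WeakHopfAlgebra k H] in
theorem actBy_mul_tmul {X : Type*} [AddCommGroup X] [Module k X] (α : H →ₗ[k] Module.End k X)
    (a b : H) (z : H ⊗[k] X) :
    actBy (LinearMap.mul k H) α (a ⊗ₜ b) z = lmul X a ((α b).lTensor H z) := by
  induction z with
  | zero => simp
  | add x y hx hy => simp only [map_add, hx, hy]
  | tmul x n => simp

omit [WeakHopfAlgebra k H] in
/-- To check an identity on `Y ⊗ Z` for `Y = H ⊗ U` and `Z = H ⊗ V` it suffices to check it on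
pure tensors. -/
theorem tmul_tmul_ext {D : Type*} [AddCommGroup D] [Module k D]
    {f g : (H ⊗[k] U) ⊗[k] (H ⊗[k] V) →ₗ[k] D}
    (h : ∀ a u b v, f ((a ⊗ₜ u) ⊗ₜ (b ⊗ₜ v)) = g ((a ⊗ₜ u) ⊗ₜ (b ⊗ₜ v)))
    (x : H ⊗[k] U) (y : H ⊗[k] V) : f (x ⊗ₜ y) = g (x ⊗ₜ y) := by
  induction x with
  | zero => simp
  | add x x' hx hy => simp only [map_add, TensorProduct.add_tmul, hx, hy]
  | tmul a u =>
    induction y with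
    | zero => simp
    | add x x' hx hy => simp only [map_add, TensorProduct.tmul_add, hx, hy]
    | tmul b v => exact h a u b v

omit [WeakHopfAlgebra k H] in
theorem mulTens_act2 (a b c : H) (x : H ⊗[k] U) (y : H ⊗[k] V) :
    mulTens U V (act2 k H H U (a ⊗ₜ b) x ⊗ₜ act2 k H H V (1 ⊗ₜ c) y) =
      lmul _ a ((act2 k H U V (b ⊗ₜ c)).lTensor H (mulTens U V (x ⊗ₜ y))) :=
  tmul_tmul_ext (f := mulTens U V ∘ₗ TensorProduct.map (act2 k H H U (a ⊗ₜ b))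
      (act2 k H H V (1 ⊗ₜ c)))
    (g := lmul _ a ∘ₗ (act2 k H U V (b ⊗ₜ c)).lTensor H ∘ₗ mulTens U V)
    (fun a u b v => by simp [mul_assoc]) x y

omit [WeakHopfAlgebra k H] in
theorem mulTens_rmul_left (b c : H) (x : H ⊗[k] U) (y : H ⊗[k] V) :
    mulTens U V (rmul _ b x ⊗ₜ act2 k H H V (1 ⊗ₜ c) y) =
      mulTens U V (x ⊗ₜ act2 k H H V (b ⊗ₜ c) y) :=
  tmul_tmul_ext (f := mulTens U V ∘ₗ TensorProduct.map (rmul _ b) (act2 k H H V (1 ⊗ₜ c)))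
    (g := mulTens U V ∘ₗ (act2 k H H V (b ⊗ₜ c)).lTensor _)
    (fun a u b v => by simp [mul_assoc]) x y

omit [WeakHopfAlgebra k H] in
theorem mulTens_rmul (b : H) (x : H ⊗[k] U) (y : H ⊗[k] V) :
    mulTens U V (x ⊗ₜ rmul _ b y) = rmul _ b (mulTens U V (x ⊗ₜ y)) :=
  tmul_tmul_ext (f := mulTens U V ∘ₗ (rmul _ b).lTensor _) (g := rmul _ b ∘ₗ mulTens U V)
    (fun a u b v => by simp [mul_assoc]) x y

omit [WeakHopfAlgebra k H] in
theorem mulTens_rmul_lmul (b : H) (x : H ⊗[k] U) (y : H ⊗[k] V) :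
    mulTens U V (rmul _ b x ⊗ₜ y) = mulTens U V (x ⊗ₜ lmul _ b y) :=
  tmul_tmul_ext (f := mulTens U V ∘ₗ (rmul _ b).rTensor _) (g := mulTens U V ∘ₗ (lmul _ b).lTensor _)
    (fun a u b v => by simp [mul_assoc]) x y

omit [WeakHopfAlgebra k H] in
theorem rmul_mul {X : Type*} [AddCommGroup X] [Module k X] (a b : H) (x : H ⊗[k] X) :
    rmul X (a * b) x = rmul X b (rmul X a x) := by
  induction x with
  | zero => simp
  | add x y hx hy => simp only [map_add, hx, hy]
  | tmul x n => simp [mul_assoc]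

omit [WeakHopfAlgebra k H] in
theorem rmul_one {X : Type*} [AddCommGroup X] [Module k X] (x : H ⊗[k] X) :
    rmul X (1 : H) x = x := by
  induction x with
  | zero => simp
  | add x y hx hy => rw [map_add, hx, hy]
  | tmul x n => simp

/-- A version of `sum_comul_comul` for linear maps on `H ⊗ H`. -/
theorem sum_comul_linear {D : Type*} [AddCommGroup D] [Module k D] (L₁ L₂ : H ⊗[k] H →ₗ[k] D)
    (G : H →ₗ[k] H →ₗ[k] H →ₗ[k] D) (h₁ : ∀ a b, L₁ (a ⊗ₜ b) = lift₂ G (Δ a) b)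
    (h₂ : ∀ a b, L₂ (a ⊗ₜ b) = lift₂ (G a) (Δ b)) (h : H) : L₁ (Δ h) = L₂ (Δ h) := by
  have e : ∀ (L : H ⊗[k] H →ₗ[k] D) (t), lift₂ (TensorProduct.curry L) t = L t := fun L t => by
    induction t with
    | zero => simp
    | add x y hx hy => simp only [map_add, hx, hy]
    | tmul x n => simp
  rw [← e L₁, ← e L₂]
  exact sum_comul_comul (TensorProduct.curry L₁) (TensorProduct.curry L₂) G h₁ h₂ h

section Tensor

variable (hU : IsCrossed U) (hV : IsCrossed V)
include hU hV

/-- The codiagonal coaction satisfies the compatibility condition of `IsCrossed`. -/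
theorem IsCrossed.cross_coactTens (h : H) (x : U ⊗[k] V) :
    actBy (LinearMap.mul k H) (actTens U V) (Δ h) (coactTens U V x) =
      crossBy (coactTens U V) (actTens U V) (Δ h) x := by
  induction x with
  | zero => simp
  | add x y hx hy => simp only [map_add, hx, hy]
  | tmul u v =>
    -- The condition for `U` and then that for `V` is applied in `h₁u₋₁v₋₁ ⊗ h₂u₀ ⊗ h₃v₀`, by way of
    -- `E(p ⊗ c) = p₁u₋₁v₋₁ ⊗ p₂u₀ ⊗ cv₀` and `F(a ⊗ q) = (au)₋₁q₁v₋₁ ⊗ (au)₀ ⊗ q₂v₀`.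
    let F : H ⊗[k] H →ₗ[k] H ⊗[k] (U ⊗[k] V) := lift₂ (bilin fun a q =>
      mulTens U V (U.coact (a • u) ⊗ₜ[k] act2 k H H V (Δ q) (V.coact v)))
    let E : H ⊗[k] H →ₗ[k] H ⊗[k] (U ⊗[k] V) := lift₂ (bilin fun p c =>
      mulTens U V (act2 k H H U (Δ p) (U.coact u) ⊗ₜ[k] act2 k H H V (1 ⊗ₜ[k] c) (V.coact v)))
    have e₁ : E (Δ h) = (actBy (LinearMap.mul k H) (actTens U V)).flip
        (coactTens U V (u ⊗ₜ v)) (Δ h) := by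
      refine sum_comul_linear _ _ (trilin fun a b c => mulTens U V
        (act2 k H H U (a ⊗ₜ[k] b) (U.coact u) ⊗ₜ[k] act2 k H H V (1 ⊗ₜ[k] c) (V.coact v))) ?_ ?_ h
      · intro p c
        simp only [E, lift₂_tmul, bilin_apply]
        induction Δ p with
        | zero => simp
        | add x y hx hy => simp only [map_add, LinearMap.add_apply, TensorProduct.add_tmul, hx, hy]
        | tmul a b => simp
      · intro a q
        rw [LinearMap.flip_apply, actBy_mul_tmul, coactTens_tmul, actTens]
        rw [LinearMap.comp_apply]
        induction Δ q with
        | zero => simp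
        | add x y hx hy => simp only [map_add, LinearMap.lTensor_add, LinearMap.add_apply, hx, hy]
        | tmul b c => rw [lift₂_tmul, trilin_apply, mulTens_act2]
    have e₂ : E (Δ h) = F (Δ h) := by
      refine sum_comul_linear _ _ (trilin fun a b c => mulTens U V
        (rmul _ b (U.coact (a • u)) ⊗ₜ[k] act2 k H H V (1 ⊗ₜ[k] c) (V.coact v))) ?_ ?_ h
      · intro p c
        simp only [E, lift₂_tmul, bilin_apply]
        rw [← hU.crossBy_comul]
        induction Δ p with
        | zero => simp
        | add x y hx hy => simp only [map_add, LinearMap.add_apply, TensorProduct.add_tmul, hx, hy]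
        | tmul a b => simp
      · intro a q
        simp only [F, lift₂_tmul, bilin_apply]
        induction Δ q with
        | zero => simp
        | add x y hx hy => simp only [map_add, LinearMap.add_apply, TensorProduct.tmul_add, hx, hy]
        | tmul b c => rw [lift₂_tmul, trilin_apply, mulTens_rmul_left]
    have e₃ : (crossBy (coactTens U V) (actTens U V)).flip (u ⊗ₜ v) (Δ h) = F (Δ h) := by
      refine sum_comul_linear _ _ (trilin fun a b c =>
        rmul _ c (coactTens U V ((a • u) ⊗ₜ[k] (b • v)))) ?_ ?_ h
      · intro p c
        rw [LinearMap.flip_apply, crossBy_tmul, actTens_apply]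
        induction Δ p with
        | zero => simp
        | add x y hx hy => simp only [map_add, LinearMap.add_apply, hx, hy]
        | tmul a b => simp
      · intro a q
        simp only [F, lift₂_tmul, bilin_apply]
        rw [← hV.crossBy_comul]
        induction Δ q with
        | zero => simp
        | add x y hx hy => simp only [map_add, LinearMap.add_apply, TensorProduct.tmul_add, hx, hy]
        | tmul b c =>
          rw [lift₂_tmul, trilin_apply, crossBy_tmul, mulTens_rmul, coactTens_tmul, lact_apply]
    exact (e₁.symm.trans e₂).trans e₃.symm

/-- `(1₁u)₋₁(1₂v)₋₁ = u₋₁S(1₁)1₂v₋₁`, as `1₁ ∈ H_s` and `1₂ ∈ H_t`; and `S(1₁)1₂ = 1`. So the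
codiagonal coaction factors through `U ⊗_t V`. -/
theorem IsCrossed.coactTens_comul_one (hreg : IsRegular k H) (x : U ⊗[k] V) :
    coactTens U V (act2 k H U V (Δ 1) x) = coactTens U V x := by
  induction x with
  | zero => simp
  | add x y hx hy => simp only [map_add, hx, hy]
  | tmul u v =>
    have key := comul_one_induction (k := k) (H := H)
      (f := coactTens U V ∘ₗ (act2 k H U V).flip (u ⊗ₜ v))
      (g := lift₂ (bilin fun a b =>
        mulTens U V (rmul _ (𝒮 a * b) (U.coact u) ⊗ₜ[k] V.coact v))) (fun y hy z hz => by
        simp only [LinearMap.comp_apply, LinearMap.flip_apply, act2_tmul, coactTens_tmul,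
          hU.coact_source_smul hreg hy, hV.coact_target_smul hz, ← mulTens_rmul_lmul, ← rmul_mul,
          lift₂_tmul, bilin_apply])
    refine key.trans ?_
    have e : ∀ t : H ⊗[k] H, lift₂ (bilin fun a b =>
        mulTens U V (rmul _ (𝒮 a * b) (U.coact u) ⊗ₜ[k] V.coact v)) t =
        mulTens U V (rmul _ (LinearMap.mul' k H ((𝒮).rTensor H t)) (U.coact u) ⊗ₜ V.coact v) := by
      intro t
      induction t with
      | zero => simp
      | add x y hx hy => simp only [map_add, LinearMap.add_apply, TensorProduct.add_tmul, hx, hy]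
      | tmul a b => simp
    rw [e, antipode_mul, sourceMap_one, rmul_one, coactTens_tmul]

/-- `u₋₁v₋₁ ⊗ 1₁u₀ ⊗ 1₂v₀ = u₋₁1₁S(1₂)v₋₁ ⊗ u₀ ⊗ v₀`, and `1₁S(1₂) = 1`. So the codiagonal coaction
has values in `H ⊗ (U ⊗_t V)`. -/
theorem IsCrossed.lTensor_act2_coactTens (hreg : IsRegular k H) (x : U ⊗[k] V) :
    (act2 k H U V (Δ 1)).lTensor H (coactTens U V x) = coactTens U V x := by
  induction x with
  | zero => simp
  | add x y hx hy => simp only [map_add, hx, hy]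
  | tmul u v =>
    have key := comul_one_induction (k := k) (H := H)
      (f := (LinearMap.lTensorHom H ∘ₗ act2 k H U V).flip (coactTens U V (u ⊗ₜ v)))
      (g := lift₂ (bilin fun a b =>
        mulTens U V (rmul _ (a * 𝒮 b) (U.coact u) ⊗ₜ[k] V.coact v))) (fun y hy z hz => by
        have e := mulTens_act2 1 y z (U.coact u) (V.coact v)
        rw [hU.source_smul_coact hy, hV.target_smul_coact hreg hz, ← mulTens_rmul_lmul,
          ← rmul_mul] at e
        simp only [LinearMap.comp_apply, LinearMap.flip_apply, lift₂_tmul, bilin_apply,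
          LinearMap.coe_lTensorHom, coactTens_tmul]
        rw [e]
        generalize (act2 k H U V (y ⊗ₜ z)).lTensor H _ = w
        induction w with
        | zero => simp
        | add x y hx hy => rw [map_add, ← hx, ← hy]
        | tmul a b => simp)
    refine key.trans ?_
    have e : ∀ t : H ⊗[k] H, lift₂ (bilin fun a b =>
        mulTens U V (rmul _ (a * 𝒮 b) (U.coact u) ⊗ₜ[k] V.coact v)) t =
        mulTens U V (rmul _ (LinearMap.mul' k H ((𝒮).lTensor H t)) (U.coact u) ⊗ₜ V.coact v) := by
      intro t
      induction t with
      | zero => simp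
      | add x y hx hy => simp only [map_add, LinearMap.add_apply, TensorProduct.add_tmul, hx, hy]
      | tmul a b => simp
    rw [e, mul_antipode, targetMap_one, rmul_one, coactTens_tmul]

/-- The codiagonal coaction has values on which `Δ(1)` acts trivially, as this holds for `ρ(u)`. -/
theorem IsCrossed.comul_one_coactTens (hreg : IsRegular k H) (x : U ⊗[k] V) :
    actBy (LinearMap.mul k H) (actTens U V) (Δ 1) (coactTens U V x) = coactTens U V x := by
  have h10 := hU.lTensor_act2_coactTens hV hreg
  induction x with
  | zero => simp
  | add x y hx hy => simp only [map_add, hx, hy]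
  | tmul u v =>
    have key := comul_one_induction (k := k) (H := H)
      (f := (actBy (LinearMap.mul k H) (actTens U V)).flip (coactTens U V (u ⊗ₜ v)))
      (g := mulTens U V ∘ₗ (TensorProduct.mk k (H ⊗[k] U) (H ⊗[k] V)).flip (V.coact v) ∘ₗ
        (act2 k H H U).flip (U.coact u)) (fun y hy z hz => by
        have e := mulTens_act2 y z 1 (U.coact u) (V.coact v)
        simp only [LinearMap.comp_apply, LinearMap.flip_apply, TensorProduct.mk_apply]
        have one : act2 k H H V (1 ⊗ₜ[k] 1) (V.coact v) = V.coact v := by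
          generalize V.coact v = w
          induction w with
          | zero => simp
          | add x y hx hy => rw [map_add, hx, hy]
          | tmul a b => simp
        rw [one] at e
        rw [e, actBy_mul_tmul, ← coactTens_tmul, actTens, LinearMap.comp_apply,
          comul_of_mem_target hz, act2_mul, Module.End.mul_eq_comp, LinearMap.lTensor_comp,
          LinearMap.comp_apply, h10])
    refine key.trans ?_
    simp only [LinearMap.comp_apply, LinearMap.flip_apply, TensorProduct.mk_apply, hU.coact_mem,
      coactTens_tmul]

end Tensor

end YetterDrinfeldTensor

/-! ### Transport of the Yetter-Drinfeld axioms along embeddings -/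

section YetterDrinfeldClosed

variable {k : Type w} {H : Type u} [Field k] [Ring H] [Algebra k H] [WeakHopfAlgebra k H]

local notation "Δ" => Coalgebra.comul (R := k) (A := H)
local notation "ϵ" => Coalgebra.counit (R := k) (A := H)

variable {N U V W U' V' : CoactedModule k H}

theorem IsCrossed.of_crossBy (h₁ : ∀ n : N, act2 k H H N (Δ 1) (N.coact n) = N.coact n)
    (h₂ : ∀ (h : H) (n : N),
      act2 k H H N (Δ h) (N.coact n) = crossBy N.coact (lact k H N) (Δ h) n) :
    IsCrossed N where
  coact_mem := h₁
  cross h n := by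
    rw [h₂]
    induction Δ h with
    | zero => simp
    | add x y hx hy => simp only [map_add, LinearMap.add_apply, hx, hy]
    | tmul a b => simp

theorem IsYetterDrinfeld.of_isCrossed (h : IsCrossed N)
    (h₁ : ∀ n : N, N.coact.lTensor H (N.coact n) =
      TensorProduct.assoc k H H N ((Δ).rTensor N (N.coact n)))
    (h₂ : ∀ n : N, TensorProduct.lid k N ((ϵ).rTensor N (N.coact n)) = n) :
    IsYetterDrinfeld N :=
  ⟨h₁, h₂, h.coact_mem, h.coact_smul⟩

/-- Transport of `IsCrossed` along an embedding of the underlying space. -/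
theorem IsCrossed.of_embedding {X : Type*} [AddCommGroup X] [Module k X] (i : N →ₗ[k] X)
    (p : X →ₗ[k] N) (hpi : ∀ n, p (i n) = n) (ρ : X →ₗ[k] H ⊗[k] X)
    (α : H →ₗ[k] Module.End k X) (hα : ∀ h n, i (h • n) = α h (i n))
    (hρ : ∀ n, i.lTensor H (N.coact n) = ρ (i n))
    (h₁ : ∀ n, actBy (LinearMap.mul k H) α (Δ 1) (ρ (i n)) = ρ (i n))
    (h₂ : ∀ h n, actBy (LinearMap.mul k H) α (Δ h) (ρ (i n)) = crossBy ρ α (Δ h) (i n)) :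
    IsCrossed N := by
  have inj : Function.Injective (i.lTensor H) := fun x y hxy => by
    have e : p ∘ₗ i = LinearMap.id := LinearMap.ext hpi
    have := congrArg (p.lTensor H) hxy
    rwa [← LinearMap.lTensor_comp_apply, ← LinearMap.lTensor_comp_apply, e, LinearMap.lTensor_id]
      at this
  have act : ∀ (t : H ⊗[k] H) (y : H ⊗[k] N), i.lTensor H (act2 k H H N t y) =
      actBy (LinearMap.mul k H) α t (i.lTensor H y) := by
    intro t y
    induction y with
    | zero => simp
    | add x y hx hy => simp only [map_add, hx, hy]
    | tmul a n =>
      induction t with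
      | zero => simp
      | add x y hx hy => simp only [map_add, LinearMap.add_apply, hx, hy]
      | tmul b c => simp [hα]
  refine .of_crossBy (fun n => inj ?_) (fun h n => inj ?_)
  · rw [act, hρ, h₁]
  · rw [act, hρ, h₂]
    induction Δ h with
    | zero => simp
    | add x y hx hy => simp only [map_add, LinearMap.add_apply, hx, hy]
    | tmul a b =>
      rw [crossBy_tmul, crossBy_tmul, lact_apply, ← hα, ← hρ]
      generalize N.coact (a • n) = y
      induction y with
      | zero => simp
      | add x y hx hy => simp only [map_add, hx, hy]
      | tmul x n => simp

/-- Transport of the comodule axioms along an embedding of the underlying space. -/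
theorem IsCrossed.isYetterDrinfeld_of_embedding (hN : IsCrossed N) {X : Type*} [AddCommGroup X]
    [Module k X] (i : N →ₗ[k] X) (p : X →ₗ[k] N) (hpi : ∀ n, p (i n) = n) (ρ : X →ₗ[k] H ⊗[k] X)
    (hρ : ∀ n, i.lTensor H (N.coact n) = ρ (i n))
    (h₁ : ∀ n, ρ.lTensor H (ρ (i n)) = TensorProduct.assoc k H H X ((Δ).rTensor X (ρ (i n))))
    (h₂ : ∀ n, TensorProduct.lid k X ((ϵ).rTensor X (ρ (i n))) = i n) : IsYetterDrinfeld N := by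
  have e : p ∘ₗ i = LinearMap.id := LinearMap.ext hpi
  have inj : Function.Injective ((i.lTensor H).lTensor H) := fun x y hxy => by
    have := congrArg ((p.lTensor H).lTensor H) hxy
    rwa [← LinearMap.lTensor_comp_apply, ← LinearMap.lTensor_comp_apply, ← LinearMap.lTensor_comp,
      e, LinearMap.lTensor_id, LinearMap.lTensor_id] at this
  refine .of_isCrossed hN (fun n => inj ?_) (fun n => ?_)
  · have e₁ : ∀ y : H ⊗[k] N, (i.lTensor H).lTensor H (N.coact.lTensor H y) =
        ρ.lTensor H (i.lTensor H y) := fun y => by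
      rw [← LinearMap.lTensor_comp_apply, ← LinearMap.lTensor_comp_apply]
      congr 2
      exact LinearMap.ext hρ
    have e₂ : ∀ y : H ⊗[k] N, (i.lTensor H).lTensor H
        (TensorProduct.assoc k H H N ((Δ).rTensor N y)) =
        TensorProduct.assoc k H H X ((Δ).rTensor X (i.lTensor H y)) := fun y => by
      induction y with
      | zero => simp
      | add x y hx hy => simp only [map_add, hx, hy]
      | tmul a n =>
        simp only [LinearMap.rTensor_tmul, LinearMap.lTensor_tmul]
        induction Δ a with
        | zero => simp
        | add x y hx hy => simp only [map_add, TensorProduct.add_tmul, hx, hy]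
        | tmul b c => simp
    rw [e₁, e₂, hρ, h₁]
  · have e₃ : ∀ y : H ⊗[k] N, i (TensorProduct.lid k N ((ϵ).rTensor N y)) =
        TensorProduct.lid k X ((ϵ).rTensor X (i.lTensor H y)) := fun y => by
      induction y with
      | zero => simp
      | add x y hx hy => simp only [map_add, hx, hy]
      | tmul a n => simp
    rw [← hpi (TensorProduct.lid k N ((ϵ).rTensor N (N.coact n))), e₃, hρ, h₂, hpi]

theorem coactTens_coassoc
    (hU : ∀ n : U, U.coact.lTensor H (U.coact n) =
      TensorProduct.assoc k H H U ((Δ).rTensor U (U.coact n)))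
    (hV : ∀ n : V, V.coact.lTensor H (V.coact n) =
      TensorProduct.assoc k H H V ((Δ).rTensor V (V.coact n))) (x : U ⊗[k] V) :
    (coactTens U V).lTensor H (coactTens U V x) = TensorProduct.assoc k H H (U ⊗[k] V)
      ((Δ).rTensor (U ⊗[k] V) (coactTens U V x)) := by
  induction x with
  | zero => simp
  | add x y hx hy => simp only [map_add, hx, hy]
  | tmul u v =>
    let M : (H ⊗[k] (H ⊗[k] U)) ⊗[k] (H ⊗[k] (H ⊗[k] V)) →ₗ[k] H ⊗[k] (H ⊗[k] (U ⊗[k] V)) :=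
      (mulTens U V).lTensor H ∘ₗ mulTens (H ⊗[k] U) (H ⊗[k] V)
    have e₁ := tmul_tmul_ext (f := (coactTens U V).lTensor H ∘ₗ mulTens U V)
      (g := M ∘ₗ TensorProduct.map (U.coact.lTensor H) (V.coact.lTensor H))
      (fun a u b v => by simp [M, coactTens_tmul]) (U.coact u) (V.coact v)
    have e₂ := tmul_tmul_ext
      (f := (TensorProduct.assoc k H H (U ⊗[k] V)).toLinearMap ∘ₗ (Δ).rTensor (U ⊗[k] V) ∘ₗ
        mulTens U V)
      (g := M ∘ₗ TensorProduct.map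
        ((TensorProduct.assoc k H H U).toLinearMap ∘ₗ (Δ).rTensor U)
        ((TensorProduct.assoc k H H V).toLinearMap ∘ₗ (Δ).rTensor V))
      (fun a u b v => by
        simp only [LinearMap.comp_apply, mulTens_tmul, LinearMap.rTensor_tmul, comul_mul,
          TensorProduct.map_tmul]
        induction Δ a with
        | zero => simp
        | add x y hx hy => simp only [map_add, TensorProduct.add_tmul, add_mul, hx, hy]
        | tmul a₁ a₂ =>
          induction Δ b with
          | zero => simp
          | add x y hx hy =>
            simp only [map_add, TensorProduct.add_tmul, TensorProduct.tmul_add, mul_add, hx, hy]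
          | tmul b₁ b₂ => simp [M]) (U.coact u) (V.coact v)
    simp only [LinearMap.comp_apply, TensorProduct.map_tmul, LinearEquiv.coe_coe] at e₁ e₂
    rw [coactTens_tmul, e₁, e₂, hU, hV]

/-- `ε(u₋₁v₋₁)u₀ ⊗ v₀ = ε(u₋₁1₁)u₀ ⊗ ε(1₂v₋₁)v₀ = 1₁u ⊗ 1₂v` -/
theorem coactTens_counit (hU : IsCrossed U) (hV : IsCrossed V)
    (hU' : ∀ n : U, TensorProduct.lid k U ((ϵ).rTensor U (U.coact n)) = n)
    (hV' : ∀ n : V, TensorProduct.lid k V ((ϵ).rTensor V (V.coact n)) = n) (x : U ⊗[k] V) :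
    TensorProduct.lid k (U ⊗[k] V) ((ϵ).rTensor (U ⊗[k] V) (coactTens U V x)) =
      act2 k H U V (Δ 1) x := by
  induction x with
  | zero => simp
  | add x y hx hy => simp only [map_add, hx, hy]
  | tmul u v =>
    let e (N : CoactedModule k H) : H ⊗[k] N →ₗ[k] N :=
      (TensorProduct.lid k N).toLinearMap ∘ₗ (ϵ).rTensor N
    let Q : H ⊗[k] H →ₗ[k] (H ⊗[k] U) ⊗[k] (H ⊗[k] V) →ₗ[k] U ⊗[k] V :=
      TensorProduct.homTensorHomMap (RingHom.id k) (H ⊗[k] U) (H ⊗[k] V) U V ∘ₗ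
        TensorProduct.map (LinearMap.compRight k (e U) ∘ₗ rmul U)
          (LinearMap.compRight k (e V) ∘ₗ lmul V)
    have hQ : ∀ a b x y, Q (a ⊗ₜ b) (x ⊗ₜ y) = e U (rmul _ a x) ⊗ₜ[k] e V (lmul _ b y) :=
      fun _ _ _ _ => rfl
    have e₁ := comul_one_induction (k := k) (H := H) (f := (act2 k H U V).flip (u ⊗ₜ v))
      (g := Q.flip (U.coact u ⊗ₜ V.coact v))
      (fun y hy z hz => by
        simp only [LinearMap.flip_apply, act2_tmul, hQ]
        rw [← hV.coact_target_smul hz, ← hU.source_smul_coact hy]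
        have e₂ : ∀ x : H ⊗[k] U, e U (act2 k H H U (1 ⊗ₜ y) x) = y • e U x := by
          intro x
          induction x with
          | zero => simp
          | add x y hx hy => simp only [map_add, smul_add, hx, hy]
          | tmul a b => simp [e, smul_algebra_smul_comm]
        rw [e₂]
        simp only [e, LinearMap.comp_apply, LinearEquiv.coe_coe, hU', hV'])
    refine Eq.trans ?_ e₁.symm
    exact tmul_tmul_ext
      (f := (TensorProduct.lid k (U ⊗[k] V)).toLinearMap ∘ₗ (ϵ).rTensor (U ⊗[k] V) ∘ₗ mulTens U V)
      (g := Q (Δ 1))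
      (fun a u b v => by
        have key := counit_mul_left (k := k) a 1 b
        rw [mul_one] at key
        simp only [LinearMap.comp_apply, mulTens_tmul, LinearMap.rTensor_tmul, LinearEquiv.coe_coe,
          TensorProduct.lid_tmul, key]
        induction Δ 1 with
        | zero => simp
        | add x y hx hy => simp only [map_add, add_smul, LinearMap.add_apply, hx, hy]
        | tmul p q =>
          simp [hQ, e]
          rw [mul_comm, mul_smul, TensorProduct.smul_tmul']) _ _

end YetterDrinfeldClosed

/-! ### Tensor products of Yetter-Drinfeld modules -/

section YetterDrinfeldMonoidal

variable {k : Type w} {H : Type u} [Field k] [Ring H] [Algebra k H] [WeakHopfAlgebra k H]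

local notation "Δ" => Coalgebra.comul (R := k) (A := H)
local notation "𝒮" => antipode (k := k) (H := H)
local notation "εt" => targetMap k H
local notation "τ" => ydRule k H

open CoactionRule

variable {N U V W U' V' : CoactedModule k H}

theorem ydRule_coact (x : (τ).tens U V) :
    ((τ).tens U V).coact x = ((τ).proj U V).lTensor H (coactTens U V ((τ).incl U V x)) := by
  change TensorProduct.map (LinearMap.mul' k H) (projT k H U V)
    (TensorProduct.tensorTensorTensorComm k H U H V
      (TensorProduct.map U.coact V.coact ((τ).incl U V x))) = _
  rw [coactTens, LinearMap.comp_apply, mulTens, LinearMap.comp_apply,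
    ← LinearMap.comp_apply (LinearMap.lTensor _ _), LinearMap.lTensor_comp_rTensor]
  rfl

theorem ydRule_coact_pt (hreg : IsRegular k H) (hU : IsCrossed U) (hV : IsCrossed V) (u : U)
    (v : V) : ((τ).tens U V).coact ((τ).pt u v) =
      ((τ).proj U V).lTensor H (mulTens U V (U.coact u ⊗ₜ V.coact v)) := by
  rw [ydRule_coact, pt, incl_proj, hU.coactTens_comul_one hV hreg, coactTens_tmul]

theorem lTensor_incl_ydRule_coact (hreg : IsRegular k H) (hU : IsCrossed U) (hV : IsCrossed V)
    (x : (τ).tens U V) : ((τ).incl U V).lTensor H (((τ).tens U V).coact x) =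
      coactTens U V ((τ).incl U V x) := by
  rw [ydRule_coact, ← LinearMap.lTensor_comp_apply]
  exact hU.lTensor_act2_coactTens hV hreg _

/-- `U ⊗_t V` inherits the axioms from `U ⊗ V`, where they hold for the codiagonal coaction except that
`Δ(1)` takes the role of the identity. -/
theorem IsYetterDrinfeld.tens (hreg : IsRegular k H) (hU : IsYetterDrinfeld U)
    (hV : IsYetterDrinfeld V) : IsYetterDrinfeld ((τ).tens U V) := by
  have hU' := hU.isCrossed
  have hV' := hV.isCrossed
  have hc : IsCrossed ((τ).tens U V) :=
    .of_embedding ((τ).incl U V) ((τ).proj U V) (τ).proj_incl (coactTens U V) (actTens U V)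
      (fun h n => rfl) (lTensor_incl_ydRule_coact hreg hU' hV')
      (fun n => hU'.comul_one_coactTens hV' hreg _) (fun h n => hU'.cross_coactTens hV' h _)
  exact hc.isYetterDrinfeld_of_embedding ((τ).incl U V) ((τ).proj U V) (τ).proj_incl
    (coactTens U V) (lTensor_incl_ydRule_coact hreg hU' hV')
    (fun n => coactTens_coassoc hU.coassoc hV.coassoc _)
    (fun n => by rw [coactTens_counit hU' hV' hU.counit hV.counit, comul_one_incl])

theorem lTensor_oneIncl_coact (z : (τ).one) :
    ((τ).oneIncl).lTensor H ((τ).one.coact z) = Δ ((τ).oneIncl z) := by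
  change ((τ).oneIncl).lTensor H (((τ).oneProj).lTensor H (Δ ((τ).oneIncl z))) = _
  rw [← LinearMap.lTensor_comp_apply]
  change (εt).lTensor H (Δ ((τ).oneIncl z)) = _
  rw [lTensor_targetMap_comul, ← comul_of_mem_target' ((τ).oneIncl_mem z)]

/-- `H_t` with the coaction `Δ`, embedded in `H` with the action `h·x = ε_t(hx)`. -/
theorem IsYetterDrinfeld.one : IsYetterDrinfeld ((τ).one) := by
  let α : H →ₗ[k] Module.End k H := LinearMap.compRight k (εt) ∘ₗ LinearMap.mul k H
  have hα : ∀ h x, α h x = εt (h * x) := fun _ _ => rfl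
  have act : ∀ s t : H ⊗[k] H, actBy (LinearMap.mul k H) α s t = (εt).lTensor H (s * t) := by
    intro s t
    induction s with
    | zero => simp
    | add x y hx hy => simp only [map_add, LinearMap.add_apply, add_mul, hx, hy]
    | tmul a b =>
      induction t with
      | zero => simp
      | add x y hx hy => simp only [map_add, mul_add, hx, hy]
      | tmul c d => simp [hα]
  have act' : ∀ (h : H) (z : (τ).one), actBy (LinearMap.mul k H) α (Δ h) (Δ ((τ).oneIncl z)) =
      Δ 1 * ((h * (τ).oneIncl z) ⊗ₜ 1) := fun h z => by
    rw [act, ← comul_mul, lTensor_targetMap_comul]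
  have hc : IsCrossed ((τ).one) := by
    refine .of_embedding (τ).oneIncl (τ).oneProj (τ).oneProj_oneIncl Δ α (fun h z => rfl)
      lTensor_oneIncl_coact (fun z => ?_) (fun h z => ?_)
    · rw [act', one_mul, comul_of_mem_target' ((τ).oneIncl_mem z)]
    · rw [act']
      have e : ∀ t : H ⊗[k] H, crossBy Δ α t ((τ).oneIncl z) =
          Δ 1 * ((LinearMap.mul' k H (TensorProduct.map εt LinearMap.id
            (t * ((τ).oneIncl z ⊗ₜ 1)))) ⊗ₜ 1) := by
        intro t
        induction t with
        | zero => simp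
        | add x y hx hy =>
          simp only [map_add, LinearMap.add_apply, add_mul, TensorProduct.add_tmul, mul_add, hx, hy]
        | tmul a b =>
          have e' : ∀ s : H ⊗[k] H, rmul H b s = s * (b ⊗ₜ 1) := by
            intro s
            induction s with
            | zero => simp
            | add x y hx hy => simp only [map_add, add_mul, hx, hy]
            | tmul c d => simp
          rw [crossBy_tmul, hα, comul_of_mem_target' (targetMap_mem _), e', mul_assoc]
          simp
      rw [e, ← comul_mul_target h ((τ).oneIncl_mem z), ← conv_apply, conv_targetMap_id,
        LinearMap.id_apply]
  exact hc.isYetterDrinfeld_of_embedding (τ).oneIncl (τ).oneProj (τ).oneProj_oneIncl Δ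
    lTensor_oneIncl_coact (fun z => (Coalgebra.coassoc_apply _).symm)
    (fun z => by rw [Coalgebra.rTensor_counit_comul, TensorProduct.lid_tmul, one_smul])

omit [WeakHopfAlgebra k H] in
theorem coactTens_map {f : U →ₗ[k] U'} {g : V →ₗ[k] V'}
    (hf : ∀ u, U'.coact (f u) = f.lTensor H (U.coact u))
    (hg : ∀ v, V'.coact (g v) = g.lTensor H (V.coact v)) (u : U) (v : V) :
    mulTens U' V' (U'.coact (f u) ⊗ₜ V'.coact (g v)) =
      (TensorProduct.map f g).lTensor H (mulTens U V (U.coact u ⊗ₜ V.coact v)) := by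
  rw [hf, hg]
  exact tmul_tmul_ext
    (f := mulTens U' V' ∘ₗ TensorProduct.map (f.lTensor H) (g.lTensor H))
    (g := (TensorProduct.map f g).lTensor H ∘ₗ mulTens U V) (fun a u b v => by simp) _ _

theorem ydRule_mapLin (hreg : IsRegular k H) (hU : IsCrossed U) (hV : IsCrossed V)
    (hU' : IsCrossed U') (hV' : IsCrossed V') {f : U →ₗ[k] U'} {g : V →ₗ[k] V'}
    (hf : CoactedModule.IsMorphism f) (hg : CoactedModule.IsMorphism g) :
    CoactedModule.IsMorphism ((τ).mapLin f g) where
  map_smul := mapLin_smul τ hf.map_smul hg.map_smul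
  map_coact := (τ).hom_ext_pt (f := ((τ).tens U' V').coact ∘ₗ (τ).mapLin f g)
    (g := ((τ).mapLin f g).lTensor H ∘ₗ ((τ).tens U V).coact) fun u v => by
      rw [LinearMap.comp_apply, LinearMap.comp_apply, mapLin_pt τ hf.map_smul hg.map_smul,
        ydRule_coact_pt hreg hU hV, ydRule_coact_pt hreg hU' hV',
        coactTens_map hf.map_coact hg.map_coact, ← LinearMap.lTensor_comp_apply,
        ← LinearMap.lTensor_comp_apply]
      congr 2
      exact LinearMap.ext fun x => (mapLin_proj τ hf.map_smul hg.map_smul x).symm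

theorem ydRule_assocLin (hreg : IsRegular k H) (hU : IsYetterDrinfeld U) (hV : IsYetterDrinfeld V)
    (hW : IsYetterDrinfeld W) : CoactedModule.IsMorphism ((τ).assocLin U V W) where
  map_smul := assocLin_smul τ
  map_coact := (τ).hom_ext_pt_left (f := ((τ).tens U ((τ).tens V W)).coact ∘ₗ (τ).assocLin U V W)
    (g := ((τ).assocLin U V W).lTensor H ∘ₗ ((τ).tens ((τ).tens U V) W).coact) fun u v w => by
      rw [LinearMap.comp_apply, LinearMap.comp_apply, assocLin_pt,
        ydRule_coact_pt hreg hU.isCrossed (hV.tens hreg hW).isCrossed,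
        ydRule_coact_pt hreg hV.isCrossed hW.isCrossed,
        ydRule_coact_pt hreg (hU.tens hreg hV).isCrossed hW.isCrossed,
        ydRule_coact_pt hreg hU.isCrossed hV.isCrossed]
      generalize U.coact u = x
      generalize V.coact v = y
      generalize W.coact w = z
      induction x with
      | zero => simp
      | add x x' hx hy => simp only [map_add, TensorProduct.add_tmul, hx, hy]
      | tmul a u =>
        induction y with
        | zero => simp
        | add x x' hx hy =>
          simp only [map_add, TensorProduct.add_tmul, TensorProduct.tmul_add, hx, hy]
        | tmul b v =>
          induction z with
          | zero => simp
          | add x x' hx hy => simp only [map_add, TensorProduct.tmul_add, hx, hy]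
          | tmul c w => simp [proj_tmul, assocLin_pt, mul_assoc]

theorem ydRule_leftLin (hreg : IsRegular k H) (hU : IsYetterDrinfeld U) :
    CoactedModule.IsMorphism ((τ).leftLin U) where
  map_smul := leftLin_smul τ
  map_coact := (τ).hom_ext_pt (f := U.coact ∘ₗ (τ).leftLin U)
    (g := ((τ).leftLin U).lTensor H ∘ₗ ((τ).tens (τ).one U).coact) fun z u => by
      have hU' := hU.isCrossed
      rw [LinearMap.comp_apply, LinearMap.comp_apply, leftLin_pt,
        ydRule_coact_pt hreg IsYetterDrinfeld.one.isCrossed hU']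
      have e := tmul_tmul_ext (U := (τ).one) (V := U)
        (f := ((τ).leftLin U).lTensor H ∘ₗ ((τ).proj _ U).lTensor H ∘ₗ mulTens _ U)
        (g := TensorProduct.lift (act2 k H H U ∘ₗ (τ).oneIncl.lTensor H))
        (fun a u b v => by simp [proj_tmul, leftLin_pt]) ((τ).one.coact z) (U.coact u)
      simp only [LinearMap.comp_apply, TensorProduct.lift.tmul] at e
      have hz := (τ).oneIncl_mem z
      rw [e, lTensor_oneIncl_coact, comul_of_mem_target hz, act2_mul, Module.End.mul_apply,
        hU'.coact_mem, hU'.coact_target_smul hz]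
      generalize U.coact u = y
      induction y with
      | zero => simp
      | add x y hx hy => simp only [map_add, hx, hy]
      | tmul x n => simp

theorem ydRule_rightLin (hreg : IsRegular k H) (hU : IsYetterDrinfeld U) :
    CoactedModule.IsMorphism ((τ).rightLin U) where
  map_smul := rightLin_smul τ hreg
  map_coact := (τ).hom_ext_pt (f := U.coact ∘ₗ (τ).rightLin U)
    (g := ((τ).rightLin U).lTensor H ∘ₗ ((τ).tens U (τ).one).coact) fun u z => by
      have hU' := hU.isCrossed
      have hz := (τ).oneIncl_mem z
      rw [LinearMap.comp_apply, LinearMap.comp_apply, rightLin_pt τ hreg,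
        ydRule_coact_pt hreg hU' IsYetterDrinfeld.one.isCrossed,
        hU'.coact_source_smul hreg (antipode_target_mem hz), hreg.target hz]
      let Q : H ⊗[k] H →ₗ[k] H ⊗[k] U →ₗ[k] H ⊗[k] U :=
        actBy (LinearMap.mul k H).flip (lact k H U ∘ₗ 𝒮)
      have hQ : ∀ a b x u, Q (a ⊗ₜ b) (x ⊗ₜ u) = (x * a) ⊗ₜ[k] (𝒮 b • u) := fun _ _ _ _ => rfl
      have e := tmul_tmul_ext (U := U) (V := (τ).one)
        (f := ((τ).rightLin U).lTensor H ∘ₗ ((τ).proj U _).lTensor H ∘ₗ mulTens U _)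
        (g := TensorProduct.lift (Q ∘ₗ (τ).oneIncl.lTensor H).flip)
        (fun a u b v => by simp [proj_tmul, rightLin_pt τ hreg, hQ]) (U.coact u)
        ((τ).one.coact z)
      simp only [LinearMap.comp_apply, TensorProduct.lift.tmul, LinearMap.flip_apply] at e
      rw [e, lTensor_oneIncl_coact, comul_of_mem_target hz]
      have e₁ := comul_one_induction (k := k) (H := H)
        (f := Q.flip (U.coact u) ∘ₗ LinearMap.mulLeft k ((τ).oneIncl z ⊗ₜ[k] (1 : H)))
        (g := (rmul U).flip (U.coact u) ∘ₗ LinearMap.mulLeft k ((τ).oneIncl z) ∘ₗ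
          lift₂ (bilin fun a b => 𝒮 b * a)) (fun y hy x hx => by
          have e₂ : ∀ w : H ⊗[k] U, Q (((τ).oneIncl z * y) ⊗ₜ x) w =
              rmul U ((τ).oneIncl z * y) (act2 k H H U (1 ⊗ₜ 𝒮 x) w) := by
            intro w
            induction w with
            | zero => simp
            | add x y hx hy => simp only [map_add, hx, hy]
            | tmul x n => simp [hQ]
          simp only [LinearMap.comp_apply, LinearMap.flip_apply, LinearMap.mulLeft_apply,
            Algebra.TensorProduct.tmul_mul_tmul, one_mul, lift₂_tmul, bilin_apply]
          rw [e₂, hU'.source_smul_coact (antipode_target_mem hx), ← rmul_mul, ← mul_assoc,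
            ← mul_assoc, target_mul_source hz (antipode_target_mem hx)])
      simp only [LinearMap.comp_apply, LinearMap.flip_apply, LinearMap.mulLeft_apply,
        hreg.antipode_mul_comul_one, mul_one] at e₁
      exact e₁.symm

theorem ydRule_isClosed (hreg : IsRegular k H) :
    (τ).IsClosed (IsYetterDrinfeld (k := k) (H := H)) where
  tens _ _ hU hV := hU.tens hreg hV
  one := .one
  map U U' V V' f g := ydRule_mapLin hreg U.property.isCrossed V.property.isCrossed
    U'.property.isCrossed V'.property.isCrossed f.isMorphism g.isMorphism
  assoc U V W := ydRule_assocLin hreg U.property V.property W.property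
  assoc_bijective _ _ _ := (τ).assocLin_bijective
  left U := ydRule_leftLin hreg U.property
  left_bijective _ := (τ).leftLin_bijective hreg
  right U := ydRule_rightLin hreg U.property
  right_bijective _ := (τ).rightLin_bijective hreg

end YetterDrinfeldMonoidal

/-! ### The maps `u ⊗ v ↦ u₋₁·v ⊗ u₀` and `v ⊗ u ↦ u₀ ⊗ S⁻¹(u₋₁)·v` -/

section YetterDrinfeldBraiding

variable {k : Type w} {H : Type u} [Field k] [Ring H] [Algebra k H] [WeakHopfAlgebra k H]

local notation "Δ" => Coalgebra.comul (R := k) (A := H)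
local notation "ϵ" => Coalgebra.counit (R := k) (A := H)
local notation "𝒮" => antipode (k := k) (H := H)
local notation "εt" => targetMap k H
local notation "εs" => sourceMap k H
local notation "τ" => ydRule k H

open CoactionRule

variable {N U V W U' V' : CoactedModule k H}

omit [WeakHopfAlgebra k H] in
theorem ydBraiding_tmul (u : U) (v : V) :
    ydBraiding U V (u ⊗ₜ v) = actSwap U V (U.coact u ⊗ₜ v) := rfl

omit [WeakHopfAlgebra k H] in
theorem actSwap_act2 (t : H ⊗[k] H) (y : H ⊗[k] U) (v : V) :
    actSwap U V (act2 k H H U t y ⊗ₜ v) = act2 k H V U t (actSwap U V (y ⊗ₜ v)) := by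
  induction y with
  | zero => simp
  | add x y hx hy => simp only [map_add, TensorProduct.add_tmul, hx, hy]
  | tmul a u =>
    induction t with
    | zero => simp
    | add x y hx hy =>
      simp only [map_add, LinearMap.add_apply, TensorProduct.add_tmul, hx, hy]
    | tmul b c => simp [actSwap_tmul, mul_smul]

omit [WeakHopfAlgebra k H] in
theorem actSwap_rmul (b : H) (y : H ⊗[k] U) (v : V) :
    actSwap U V (rmul U b y ⊗ₜ v) = actSwap U V (y ⊗ₜ (b • v)) := by
  induction y with
  | zero => simp
  | add x y hx hy => simp only [map_add, TensorProduct.add_tmul, hx, hy]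
  | tmul a u => simp [actSwap_tmul, mul_smul]

omit [WeakHopfAlgebra k H] in
theorem actSwap_crossBy (t : H ⊗[k] H) (u : U) (v : V) :
    actSwap U V (crossBy U.coact (lact k H U) t u ⊗ₜ v) =
      ydBraiding U V (act2 k H U V t (u ⊗ₜ v)) := by
  induction t with
  | zero => simp
  | add x y hx hy => simp only [map_add, LinearMap.add_apply, TensorProduct.add_tmul, hx, hy]
  | tmul a b => rw [crossBy_tmul, actSwap_rmul, act2_tmul, ydBraiding_tmul, lact_apply]

/-- The braiding commutes with the diagonal action of `H`. -/
theorem IsCrossed.ydBraiding_act2 (hU : IsCrossed U) (h : H) (x : U ⊗[k] V) :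
    ydBraiding U V (act2 k H U V (Δ h) x) = act2 k H V U (Δ h) (ydBraiding U V x) := by
  induction x with
  | zero => simp
  | add x y hx hy => simp only [map_add, hx, hy]
  | tmul u v => rw [← actSwap_crossBy, hU.crossBy_comul, actSwap_act2, ydBraiding_tmul]

/-- The braiding is colinear: both sides are `(u₋₂v₋₁ ⊗ u₋₁v₀) ⊗ u₀`, on the left by the compatibility
condition for `v`. -/
theorem coactTens_ydBraiding (hU : IsYetterDrinfeld U) (hV : IsCrossed V) (x : U ⊗[k] V) :
    coactTens V U (ydBraiding U V x) = (ydBraiding U V).lTensor H (coactTens U V x) := by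
  induction x with
  | zero => simp
  | add x y hx hy => simp only [map_add, hx, hy]
  | tmul u v =>
    let T : (H ⊗[k] V) ⊗[k] U →ₗ[k] H ⊗[k] (V ⊗[k] U) := TensorProduct.assoc k H V U
    -- `E(a, n) = a₁v₋₁ ⊗ a₂v₀ ⊗ n`; the two sides are `F₁` and `F₂` at the coaction of `u`.
    let E : H →ₗ[k] U →ₗ[k] H ⊗[k] (V ⊗[k] U) :=
      bilin fun a n => T (act2 k H H V (Δ a) (V.coact v) ⊗ₜ[k] n)
    let F₁ : H →ₗ[k] U →ₗ[k] H ⊗[k] (V ⊗[k] U) := TensorProduct.curry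
      (coactTens V U ∘ₗ actSwap U V ∘ₗ (TensorProduct.mk k (H ⊗[k] U) V).flip v)
    let F₂ : H →ₗ[k] U →ₗ[k] H ⊗[k] (V ⊗[k] U) := TensorProduct.curry
      ((ydBraiding U V).lTensor H ∘ₗ mulTens U V ∘ₗ
        (TensorProduct.mk k (H ⊗[k] U) (H ⊗[k] V)).flip (V.coact v))
    have e₁ : lift₂ E (U.coact u) = lift₂ F₁ (U.coact u) := by
      refine sum_coassoc hU.coassoc _ _ (trilin fun a b n =>
        T (rmul _ b (V.coact (a • v)) ⊗ₜ[k] n)) ?_ ?_ u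
      · intro a n
        simp only [E, bilin_apply]
        rw [← hV.crossBy_comul]
        induction Δ a with
        | zero => simp
        | add x y hx hy => simp only [map_add, LinearMap.add_apply, TensorProduct.add_tmul, hx, hy]
        | tmul a b => simp
      · intro a n
        simp only [F₁, TensorProduct.curry_apply, LinearMap.comp_apply, LinearMap.flip_apply,
          TensorProduct.mk_apply, actSwap_tmul, coactTens_tmul]
        induction U.coact n with
        | zero => simp
        | add x x' hx hy => simp only [map_add, TensorProduct.tmul_add, hx, hy]
        | tmul b n =>
          rw [lift₂_tmul, trilin_apply]
          induction V.coact (a • v) with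
          | zero => simp
          | add x x' hx hy => simp only [map_add, TensorProduct.add_tmul, hx, hy]
          | tmul c v => simp [T]
    have e₂ : lift₂ E (U.coact u) = lift₂ F₂ (U.coact u) := by
      refine sum_coassoc hU.coassoc _ _ (trilin fun a b n =>
        T (act2 k H H V (a ⊗ₜ[k] b) (V.coact v) ⊗ₜ[k] n)) ?_ ?_ u
      · intro a n
        simp only [E, bilin_apply]
        induction Δ a with
        | zero => simp
        | add x y hx hy => simp only [map_add, LinearMap.add_apply, TensorProduct.add_tmul, hx, hy]
        | tmul a b => simp
      · intro a n
        simp only [F₂, TensorProduct.curry_apply, LinearMap.comp_apply, LinearMap.flip_apply,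
          TensorProduct.mk_apply]
        have e₁ : ∀ y : H ⊗[k] V, (ydBraiding U V).lTensor H (mulTens U V ((a ⊗ₜ n) ⊗ₜ y)) =
            lmul _ a ((actSwap U V).lTensor H
              (TensorProduct.leftComm k (H ⊗[k] U) H V (U.coact n ⊗ₜ y))) := by
          intro y
          induction y with
          | zero => simp
          | add x x' hx hy => simp only [map_add, TensorProduct.tmul_add, hx, hy]
          | tmul c v => simp [ydBraiding_tmul]
        rw [e₁]
        induction U.coact n with
        | zero => simp
        | add x x' hx hy => simp only [map_add, TensorProduct.add_tmul, hx, hy]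
        | tmul b n =>
          rw [lift₂_tmul, trilin_apply]
          induction V.coact v with
          | zero => simp
          | add x x' hx hy => simp only [map_add, TensorProduct.tmul_add, TensorProduct.add_tmul, hx, hy]
          | tmul c v => simp [T, actSwap_tmul]
    have e : ∀ (L : H ⊗[k] U →ₗ[k] H ⊗[k] (V ⊗[k] U)) (t), lift₂ (TensorProduct.curry L) t = L t :=
      fun L t => by
        induction t with
        | zero => simp
        | add x y hx hy => simp only [map_add, hx, hy]
        | tmul x n => simp
    rw [e₁] at e₂
    simp only [F₁, F₂, e] at e₂
    exact e₂

/-- The formula `v ⊗ u ↦ u₀ ⊗ S⁻¹(u₋₁)·v` for the inverse of the braiding -/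
noncomputable def ydBraidingInv (hS : Function.Bijective (antipode (k := k) : H →ₗ[k] H))
    (U V : CoactedModule k H) : V ⊗[k] U →ₗ[k] U ⊗[k] V :=
  (TensorProduct.comm k V U).toLinearMap ∘ₗ actSwap U V ∘ₗ
    ((antipodeInv k H hS).rTensor U ∘ₗ U.coact).rTensor V ∘ₗ
    (TensorProduct.comm k V U).toLinearMap

variable (hS : Function.Bijective (antipode (k := k) : H →ₗ[k] H))

theorem ydBraidingInv_tmul (v : V) (u : U) : ydBraidingInv hS U V (v ⊗ₜ u) =
    TensorProduct.comm k V U (actSwap U V ((antipodeInv k H hS).rTensor U (U.coact u) ⊗ₜ v)) :=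
  rfl

theorem antipode_antipodeInv (h : H) : 𝒮 (antipodeInv k H hS h) = h :=
  (LinearEquiv.ofBijective (𝒮) hS).apply_symm_apply h

theorem antipodeInv_antipode (h : H) : antipodeInv k H hS (𝒮 h) = h :=
  (LinearEquiv.ofBijective (𝒮) hS).symm_apply_apply h

/-- `h₂S⁻¹(h₁) = S⁻¹(ε_t(h))` -/
theorem mul_antipodeInv (h : H) :
    lift₂ (bilin fun a b => b * antipodeInv k H hS a) (Δ h) = antipodeInv k H hS (εt h) := by
  apply hS.1
  rw [antipode_antipodeInv, ← mul_antipode]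
  induction Δ h with
  | zero => simp
  | add x y hx hy => simp only [map_add, hx, hy]
  | tmul a b => simp [antipode_mul_rev, antipode_antipodeInv]

/-- `S⁻¹(h₂)h₁ = S⁻¹(ε_s(h))` -/
theorem antipodeInv_mul (h : H) :
    lift₂ (bilin fun a b => antipodeInv k H hS b * a) (Δ h) = antipodeInv k H hS (εs h) := by
  apply hS.1
  rw [antipode_antipodeInv, ← antipode_mul]
  induction Δ h with
  | zero => simp
  | add x y hx hy => simp only [map_add, hx, hy]
  | tmul a b => simp [antipode_mul_rev, antipode_antipodeInv]

/-- `ε_t(h) = S(1₁)ε(1₂h)` -/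
theorem targetMap_eq_antipode (h : H) :
    εt h = lift₂ (bilin fun a b => ϵ (b * h) • 𝒮 a) (Δ 1) := by
  rw [targetMap_eq_sum]
  conv_lhs => rw [← map_antipode_comm_comul_one]
  refine comul_one_induction (f := lift₂ (bilin fun a b => ϵ (a * h) • b) ∘ₗ
    TensorProduct.map 𝒮 𝒮 ∘ₗ (TensorProduct.comm k H H).toLinearMap) fun y _ z hz => ?_
  simp [antipode_of_target hz, counit_sourceMap_mul]

/-- `ε_s(h) = S(1₂)ε(h1₁)` -/
theorem sourceMap_eq_antipode (h : H) :
    εs h = lift₂ (bilin fun a b => ϵ (h * a) • 𝒮 b) (Δ 1) := by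
  rw [sourceMap_eq_sum]
  conv_lhs => rw [← map_antipode_comm_comul_one]
  refine comul_one_induction (f := lift₂ (bilin fun a b => ϵ (h * b) • a) ∘ₗ
    TensorProduct.map 𝒮 𝒮 ∘ₗ (TensorProduct.comm k H H).toLinearMap) fun y hy z _ => ?_
  simp [antipode_of_source hy, counit_mul_targetMap]

theorem lift₂_curry {A B D : Type*} [AddCommGroup A] [Module k A] [AddCommGroup B] [Module k B]
    [AddCommGroup D] [Module k D] (L : A ⊗[k] B →ₗ[k] D) (t : A ⊗[k] B) :
    lift₂ (TensorProduct.curry L) t = L t := by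
  induction t with
  | zero => simp
  | add x y hx hy => simp only [map_add, hx, hy]
  | tmul x n => simp

/-- A version of `sum_coassoc` for linear maps on `H ⊗ N`. -/
theorem sum_coassoc_linear {N D : Type*} [AddCommGroup N] [Module k N] [AddCommGroup D]
    [Module k D] {ρ : N →ₗ[k] H ⊗[k] N} (hρ : ∀ n, ρ.lTensor H (ρ n) =
      TensorProduct.assoc k H H N ((Δ).rTensor N (ρ n))) (L₁ L₂ : H ⊗[k] N →ₗ[k] D)
    (G : H →ₗ[k] H →ₗ[k] N →ₗ[k] D) (h₁ : ∀ a n, L₁ (a ⊗ₜ n) = lift₂ G (Δ a) n)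
    (h₂ : ∀ a n, L₂ (a ⊗ₜ n) = lift₂ (G a) (ρ n)) (n : N) : L₁ (ρ n) = L₂ (ρ n) := by
  rw [← lift₂_curry L₁, ← lift₂_curry L₂]
  exact sum_coassoc hρ (TensorProduct.curry L₁) (TensorProduct.curry L₂) G h₁ h₂ n

/-- `ε_t(u₋₁) ⊗ u₀ = S(1₁) ⊗ 1₂·u` -/
theorem IsYetterDrinfeld.rTensor_targetMap_coact (hU : IsYetterDrinfeld U) (u : U) :
    (εt).rTensor U (U.coact u) = lift₂ (bilin fun a b => 𝒮 a ⊗ₜ[k] (b • u)) (Δ 1) := by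
  let e : H ⊗[k] U →ₗ[k] U := (TensorProduct.lid k U).toLinearMap ∘ₗ (ϵ).rTensor U
  let Q : H ⊗[k] H →ₗ[k] H ⊗[k] U →ₗ[k] H ⊗[k] U :=
    lift₂ (bilin (fun a b => TensorProduct.mk k H U (𝒮 a) ∘ₗ e ∘ₗ lmul U b)
      (by intros; ext; simp) (by intros; ext; simp)
      (by intros; ext; simp [TensorProduct.tmul_add]) (by intros; ext; simp))
  have hQ : ∀ w, (εt).rTensor U w = Q (Δ 1) w := by
    intro w
    induction w with
    | zero => simp
    | add x y hx hy => simp only [map_add, hx, hy]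
    | tmul x n =>
      rw [LinearMap.rTensor_tmul, targetMap_eq_antipode]
      induction Δ 1 with
      | zero => simp
      | add x y hx hy => simp only [map_add, LinearMap.add_apply, TensorProduct.add_tmul, hx, hy]
      | tmul a b => simp [Q, e, TensorProduct.smul_tmul']
  rw [hQ]
  refine comul_one_induction (f := Q.flip (U.coact u)) fun y _ z hz => ?_
  simp only [Q, e, LinearMap.flip_apply, lift₂_tmul, bilin_apply, LinearMap.comp_apply,
    ← hU.isCrossed.coact_target_smul hz, LinearEquiv.coe_coe, hU.counit, TensorProduct.mk_apply]

/-- `ε_s(u₋₁) ⊗ u₀ = S(1₂) ⊗ 1₁·u` -/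
theorem IsYetterDrinfeld.rTensor_sourceMap_coact (hU : IsYetterDrinfeld U) (u : U) :
    (εs).rTensor U (U.coact u) = lift₂ (bilin fun a b => 𝒮 b ⊗ₜ[k] (a • u)) (Δ 1) := by
  let e : H ⊗[k] U →ₗ[k] U := (TensorProduct.lid k U).toLinearMap ∘ₗ (ϵ).rTensor U
  let Q : H ⊗[k] H →ₗ[k] H ⊗[k] U →ₗ[k] H ⊗[k] U :=
    lift₂ (bilin (fun a b => TensorProduct.mk k H U (𝒮 b) ∘ₗ e ∘ₗ rmul U a)
      (by intros; ext; simp [TensorProduct.tmul_add]) (by intros; ext; simp)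
      (by intros; ext; simp) (by intros; ext; simp))
  have hQ : ∀ w, (εs).rTensor U w = Q (Δ 1) w := by
    intro w
    induction w with
    | zero => simp
    | add x y hx hy => simp only [map_add, hx, hy]
    | tmul x n =>
      rw [LinearMap.rTensor_tmul, sourceMap_eq_antipode]
      induction Δ 1 with
      | zero => simp
      | add x y hx hy => simp only [map_add, LinearMap.add_apply, TensorProduct.add_tmul, hx, hy]
      | tmul a b => simp [Q, e, TensorProduct.smul_tmul']
  rw [hQ]
  refine comul_one_induction (f := Q.flip (U.coact u)) fun y hy z _ => ?_
  have e₂ : ∀ x : H ⊗[k] U, e (act2 k H H U (1 ⊗ₜ y) x) = y • e x := by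
    intro x
    induction x with
    | zero => simp
    | add x y hx hy => simp only [map_add, smul_add, hx, hy]
    | tmul a b => simp [e, smul_algebra_smul_comm]
  simp only [Q, LinearMap.flip_apply, lift₂_tmul, bilin_apply, LinearMap.comp_apply,
    ← hU.isCrossed.source_smul_coact hy, e₂, TensorProduct.mk_apply]
  simp only [e, LinearMap.comp_apply, LinearEquiv.coe_coe, hU.counit]

/-- By `u₋₁S⁻¹(u₋₂) ⊗ u₀ = S⁻¹(ε_t(u₋₁)) ⊗ u₀ = 1₁ ⊗ 1₂u`, the two formulas are inverse on `V ⊗_t U`. -/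
theorem ydBraiding_ydBraidingInv (hU : IsYetterDrinfeld U) (x : V ⊗[k] U) :
    ydBraiding U V (ydBraidingInv hS U V x) = act2 k H V U (Δ 1) x := by
  induction x with
  | zero => simp
  | add x y hx hy => simp only [map_add, hx, hy]
  | tmul v u =>
    let K : H ⊗[k] U →ₗ[k] V ⊗[k] U :=
      lift₂ (bilin fun a n => (antipodeInv k H hS a • v) ⊗ₜ[k] n)
    have key := sum_coassoc_linear hU.coassoc (K ∘ₗ (εt).rTensor U)
      (ydBraiding U V ∘ₗ (TensorProduct.comm k V U).toLinearMap ∘ₗ actSwap U V ∘ₗ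
        (TensorProduct.mk k (H ⊗[k] U) V).flip v ∘ₗ (antipodeInv k H hS).rTensor U)
      (trilin fun a b n => (b • antipodeInv k H hS a • v) ⊗ₜ[k] n) (fun a n => by
        simp only [LinearMap.comp_apply, LinearMap.rTensor_tmul, K, lift₂_tmul, bilin_apply]
        rw [← mul_antipodeInv]
        induction Δ a with
        | zero => simp
        | add x y hx hy =>
          simp only [map_add, LinearMap.add_apply, TensorProduct.add_tmul, add_smul, hx, hy]
        | tmul a b => simp [mul_smul]) (fun a n => by
        simp only [LinearMap.comp_apply, LinearMap.rTensor_tmul, LinearMap.flip_apply,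
          TensorProduct.mk_apply, actSwap_tmul, LinearEquiv.coe_coe, TensorProduct.comm_tmul,
          ydBraiding_tmul]
        induction U.coact n with
        | zero => simp
        | add x y hx hy => simp only [map_add, TensorProduct.add_tmul, hx, hy]
        | tmul b n => simp [actSwap_tmul]) u
    refine key.symm.trans ?_
    rw [LinearMap.comp_apply, hU.rTensor_targetMap_coact]
    induction Δ 1 with
    | zero => simp
    | add x y hx hy => simp only [map_add, LinearMap.add_apply, hx, hy]
    | tmul a b => simp [K, antipodeInv_antipode]

/-- By `S⁻¹(u₋₁)u₋₂ ⊗ u₀ = S⁻¹(ε_s(u₋₁)) ⊗ u₀ = 1₂ ⊗ 1₁u`, the two formulas are inverse on `U ⊗_t V`. -/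
theorem ydBraidingInv_ydBraiding (hU : IsYetterDrinfeld U) (x : U ⊗[k] V) :
    ydBraidingInv hS U V (ydBraiding U V x) = act2 k H U V (Δ 1) x := by
  induction x with
  | zero => simp
  | add x y hx hy => simp only [map_add, hx, hy]
  | tmul u v =>
    let K : H ⊗[k] U →ₗ[k] U ⊗[k] V :=
      lift₂ (bilin fun a n => n ⊗ₜ[k] (antipodeInv k H hS a • v))
    have key := sum_coassoc_linear hU.coassoc (K ∘ₗ (εs).rTensor U)
      (ydBraidingInv hS U V ∘ₗ actSwap U V ∘ₗ (TensorProduct.mk k (H ⊗[k] U) V).flip v)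
      (trilin fun a b n => n ⊗ₜ[k] (antipodeInv k H hS b • a • v)) (fun a n => by
        simp only [LinearMap.comp_apply, LinearMap.rTensor_tmul, K, lift₂_tmul, bilin_apply]
        rw [← antipodeInv_mul]
        induction Δ a with
        | zero => simp
        | add x y hx hy =>
          simp only [map_add, LinearMap.add_apply, TensorProduct.tmul_add, add_smul, hx, hy]
        | tmul a b => simp [mul_smul]) (fun a n => by
        simp only [LinearMap.comp_apply, LinearMap.flip_apply,
          TensorProduct.mk_apply, actSwap_tmul, ydBraidingInv_tmul]
        induction U.coact n with
        | zero => simp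
        | add x y hx hy => simp only [map_add, TensorProduct.add_tmul, hx, hy]
        | tmul b n => simp [actSwap_tmul]) u
    refine key.symm.trans ?_
    rw [LinearMap.comp_apply, hU.rTensor_sourceMap_coact]
    induction Δ 1 with
    | zero => simp
    | add x y hx hy => simp only [map_add, LinearMap.add_apply, hx, hy]
    | tmul a b => simp [K, antipodeInv_antipode]

/-! ### The braiding on `U ⊗_t V` -/

/-- The braiding `u ⊗_t v ↦ u₋₁·v ⊗_t u₀` -/
noncomputable def braidLin (U V : CoactedModule k H) : (τ).tens U V →ₗ[k] (τ).tens V U :=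
  (τ).proj V U ∘ₗ ydBraiding U V ∘ₗ (τ).incl U V

section

variable (hU : IsYetterDrinfeld U)
include hU

theorem incl_braidLin (x : (τ).tens U V) :
    (τ).incl V U (braidLin U V x) = ydBraiding U V ((τ).incl U V x) := by
  change (τ).incl V U ((τ).proj V U (ydBraiding U V ((τ).incl U V x))) = _
  rw [incl_proj, ← hU.isCrossed.ydBraiding_act2, comul_one_incl]

theorem braidLin_proj (x : U ⊗[k] V) :
    braidLin U V ((τ).proj U V x) = (τ).proj V U (ydBraiding U V x) := by
  change (τ).proj V U (ydBraiding U V ((τ).incl U V ((τ).proj U V x))) = _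
  rw [incl_proj, hU.isCrossed.ydBraiding_act2, proj_comul_one]

theorem braidLin_pt (u : U) (v : V) : braidLin U V ((τ).pt u v) =
    (τ).proj V U (actSwap U V (U.coact u ⊗ₜ v)) :=
  braidLin_proj hU _

theorem braidLin_smul (h : H) (x : (τ).tens U V) :
    braidLin U V (h • x) = h • braidLin U V x := by
  apply (τ).incl_injective
  rw [incl_braidLin hU, incl_smul, incl_smul, incl_braidLin hU, hU.isCrossed.ydBraiding_act2]

theorem braidLin_isMorphism (hV : IsYetterDrinfeld V) :
    CoactedModule.IsMorphism (braidLin U V) where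
  map_smul := braidLin_smul hU
  map_coact x := by
    rw [ydRule_coact, incl_braidLin hU, coactTens_ydBraiding hU hV.isCrossed, ydRule_coact,
      ← LinearMap.lTensor_comp_apply, ← LinearMap.lTensor_comp_apply]
    congr 2
    exact LinearMap.ext fun x => (braidLin_proj hU x).symm

theorem ydBraidingInv_incl_braidLin (x : (τ).tens U V) :
    ydBraidingInv hS U V ((τ).incl V U (braidLin U V x)) = (τ).incl U V x := by
  rw [incl_braidLin hU, ydBraidingInv_ydBraiding hS hU, comul_one_incl]

include hS in
theorem braidLin_bijective : Function.Bijective (braidLin U V) := by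
  refine ⟨fun x y hxy => (τ).incl_injective ?_, fun y =>
    ⟨(τ).proj U V (ydBraidingInv hS U V ((τ).incl V U y)), ?_⟩⟩
  · rw [← ydBraidingInv_incl_braidLin hS hU x, hxy, ydBraidingInv_incl_braidLin hS hU y]
  · rw [braidLin_proj hU, ydBraiding_ydBraidingInv hS hU, comul_one_incl, proj_incl]

end

end YetterDrinfeldBraiding

/-! ### The braided category of Yetter-Drinfeld modules -/

section YetterDrinfeldBraided

variable {k : Type w} {H : Type u} [Field k] [Ring H] [Algebra k H] [WeakHopfAlgebra k H]

local notation "Δ" => Coalgebra.comul (R := k) (A := H)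
local notation "τ" => ydRule k H

open CoactionRule

variable {U V W U' V' : CoactedModule k H}

theorem braidLin_naturality_right (hU : IsYetterDrinfeld U) {g : V →ₗ[k] V'}
    (hg : CoactedModule.IsMorphism g) (x : (τ).tens U V) :
    braidLin U V' ((τ).mapLin LinearMap.id g x) =
      (τ).mapLin g LinearMap.id (braidLin U V x) := by
  refine (τ).hom_ext_pt (f := braidLin U V' ∘ₗ (τ).mapLin LinearMap.id g)
    (g := (τ).mapLin g LinearMap.id ∘ₗ braidLin U V) (fun u v => ?_) x
  rw [LinearMap.comp_apply, LinearMap.comp_apply, mapLin_pt τ (map_smul_id _) hg.map_smul,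
    braidLin_pt hU, braidLin_pt hU, mapLin_proj τ hg.map_smul (map_smul_id _), LinearMap.id_apply]
  congr 1
  induction U.coact u with
  | zero => simp
  | add x y hx hy => simp only [map_add, TensorProduct.add_tmul, hx, hy]
  | tmul a u => simp [actSwap_tmul, hg.map_smul]

theorem braidLin_naturality_left (hU : IsYetterDrinfeld U) (hU' : IsYetterDrinfeld U')
    {f : U →ₗ[k] U'} (hf : CoactedModule.IsMorphism f) (x : (τ).tens U V) :
    braidLin U' V ((τ).mapLin f LinearMap.id x) =
      (τ).mapLin LinearMap.id f (braidLin U V x) := by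
  refine (τ).hom_ext_pt (f := braidLin U' V ∘ₗ (τ).mapLin f LinearMap.id)
    (g := (τ).mapLin LinearMap.id f ∘ₗ braidLin U V) (fun u v => ?_) x
  rw [LinearMap.comp_apply, LinearMap.comp_apply, mapLin_pt τ hf.map_smul (map_smul_id _),
    braidLin_pt hU, braidLin_pt hU', mapLin_proj τ (map_smul_id _) hf.map_smul,
    LinearMap.id_apply, hf.map_coact]
  congr 1
  induction U.coact u with
  | zero => simp
  | add x y hx hy => simp only [map_add, TensorProduct.add_tmul, hx, hy]
  | tmul a u => simp [actSwap_tmul]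

/-- Both sides are `u₋₂·v ⊗ (u₋₁·w ⊗ u₀)`. -/
theorem braidLin_hexagon_forward (hU : IsYetterDrinfeld U) (x : (τ).tens ((τ).tens U V) W) :
    (τ).assocLin V W U (braidLin U ((τ).tens V W) ((τ).assocLin U V W x)) =
      (τ).mapLin LinearMap.id (braidLin U W) ((τ).assocLin V U W
        ((τ).mapLin (braidLin U V) LinearMap.id x)) := by
  refine (τ).hom_ext_pt_left
    (f := (τ).assocLin V W U ∘ₗ braidLin U ((τ).tens V W) ∘ₗ (τ).assocLin U V W)
    (g := (τ).mapLin LinearMap.id (braidLin U W) ∘ₗ (τ).assocLin V U W ∘ₗ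
        (τ).mapLin (braidLin U V) LinearMap.id) (fun u v w => ?_) x
  simp only [LinearMap.comp_apply]
  rw [assocLin_pt, braidLin_pt hU, mapLin_pt τ (braidLin_smul hU) (map_smul_id _),
    braidLin_pt hU, LinearMap.id_apply]
  refine sum_coassoc_linear hU.coassoc
    ((τ).assocLin V W U ∘ₗ (τ).proj ((τ).tens V W) U ∘ₗ actSwap U ((τ).tens V W) ∘ₗ
      (TensorProduct.mk k (H ⊗[k] U) ((τ).tens V W)).flip ((τ).pt v w))
    ((τ).mapLin LinearMap.id (braidLin U W) ∘ₗ (τ).assocLin V U W ∘ₗ (τ).proj ((τ).tens V U) W ∘ₗ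
      (TensorProduct.mk k ((τ).tens V U) W).flip w ∘ₗ (τ).proj V U ∘ₗ actSwap U V ∘ₗ
      (TensorProduct.mk k (H ⊗[k] U) V).flip v)
    (trilin fun a b n => (τ).proj V ((τ).tens W U) ((a • v) ⊗ₜ[k] (τ).proj W U ((b • w) ⊗ₜ[k] n)))
    (fun a n => ?_) (fun a n => ?_) u
  · simp only [LinearMap.comp_apply, LinearMap.flip_apply, TensorProduct.mk_apply, actSwap_tmul,
      pt, smul_proj]
    induction Δ a with
    | zero => simp
    | add x y hx hy =>
      simp only [map_add, LinearMap.add_apply, TensorProduct.add_tmul, hx, hy]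
    | tmul a b => simp [proj_tmul, assocLin_pt]
  · simp only [LinearMap.comp_apply, LinearMap.flip_apply, TensorProduct.mk_apply, actSwap_tmul,
      proj_tmul, assocLin_pt]
    rw [mapLin_pt τ (map_smul_id _) (braidLin_smul hU), braidLin_pt hU]
    induction U.coact n with
    | zero => simp [pt_zero_right]
    | add x y hx hy => simp only [map_add, TensorProduct.add_tmul, pt_add_right, hx, hy]
    | tmul b n => simp [actSwap_tmul, proj_tmul]

/-- Both sides are `(u₋₁v₋₁·w ⊗ u₀) ⊗ v₀`. -/
theorem braidLin_hexagon_reverse (hreg : IsRegular k H) (hU : IsYetterDrinfeld U)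
    (hV : IsYetterDrinfeld V) (x : (τ).tens U ((τ).tens V W)) :
    (τ).assocInvLin W U V (braidLin ((τ).tens U V) W ((τ).assocInvLin U V W x)) =
      (τ).mapLin (braidLin U W) LinearMap.id ((τ).assocInvLin U W V
        ((τ).mapLin LinearMap.id (braidLin V W) x)) := by
  refine (τ).hom_ext_pt_right
    (f := (τ).assocInvLin W U V ∘ₗ braidLin ((τ).tens U V) W ∘ₗ (τ).assocInvLin U V W)
    (g := (τ).mapLin (braidLin U W) LinearMap.id ∘ₗ (τ).assocInvLin U W V ∘ₗ
        (τ).mapLin LinearMap.id (braidLin V W)) (fun u v w => ?_) x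
  simp only [LinearMap.comp_apply]
  rw [assocInvLin_pt, braidLin_pt (hU.tens hreg hV), mapLin_pt τ (map_smul_id _)
    (braidLin_smul hV), ydRule_coact_pt hreg hU.isCrossed hV.isCrossed, braidLin_pt hV,
    LinearMap.id_apply]
  induction V.coact v with
  | zero => simp [pt_zero_right]
  | add x y hx hy =>
    simp only [map_add, TensorProduct.add_tmul, TensorProduct.tmul_add, pt_add_right, hx, hy]
  | tmul b v =>
    rw [actSwap_tmul, proj_tmul, assocInvLin_pt, mapLin_pt τ (braidLin_smul hU) (map_smul_id _),
      braidLin_pt hU]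
    induction U.coact u with
    | zero => simp [pt_zero_left]
    | add x y hx hy => simp only [map_add, TensorProduct.add_tmul, pt_add_left, hx, hy]
    | tmul a u => simp [actSwap_tmul, proj_tmul, assocInvLin_pt, mul_smul]

/-- The braided monoidal category of Yetter-Drinfeld modules. -/
@[reducible] noncomputable def ydBraided (hreg : IsRegular k H)
    (hS : Function.Bijective (antipode (k := k) : H →ₗ[k] H)) (hY : (τ).IsMonoidal IsYetterDrinfeld) :
    letI : MonoidalCategory (YetterDrinfeld k H) := hY.category
    BraidedCategory (YetterDrinfeld k H) :=
  letI : MonoidalCategory (YetterDrinfeld k H) := hY.category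
  have assoc_inv : ∀ (U V W : YetterDrinfeld k H) (x : (τ).tens U.obj ((τ).tens V.obj W.obj)),
      (α_ U V W).inv.hom.toLin x = (τ).assocInvLin U.obj V.obj W.obj x :=
    fun U V W x => isoMk_inv_apply ((τ).assocLin_assocInvLin x)
  { braiding := fun U V => isoMk (P := IsYetterDrinfeld) (U := U ⊗ V) (V := V ⊗ U)
      (braidLin U.obj V.obj) (braidLin_isMorphism U.property V.property)
      (braidLin_bijective hS U.property)
    braiding_naturality_right := fun X {Y Z} f => lin_hom_ext (LinearMap.ext fun x =>
      braidLin_naturality_right X.property f.hom.isMorphism x)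
    braiding_naturality_left := fun {X Y} f Z => lin_hom_ext (LinearMap.ext fun x =>
      braidLin_naturality_left X.property Y.property f.hom.isMorphism x)
    hexagon_forward := fun X Y Z => lin_hom_ext (LinearMap.ext fun x =>
      braidLin_hexagon_forward X.property x)
    hexagon_reverse := fun X Y Z => lin_hom_ext (LinearMap.ext fun x => by
      change (α_ Z X Y).inv.hom.toLin (braidLin ((τ).tens X.obj Y.obj) Z.obj
        ((α_ X Y Z).inv.hom.toLin x)) = (τ).mapLin (braidLin X.obj Z.obj) LinearMap.id
          ((α_ X Z Y).inv.hom.toLin ((τ).mapLin LinearMap.id (braidLin Y.obj Z.obj) x))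
      rw [assoc_inv, assoc_inv, assoc_inv]
      exact braidLin_hexagon_reverse hreg X.property Y.property x) }

end YetterDrinfeldBraided

/-! ### Twisted coactions -/

section Transmutation

variable {k : Type w} {H : Type u} [Field k] [Ring H] [Algebra k H] [WeakHopfAlgebra k H]

local notation "Δ" => Coalgebra.comul (R := k) (A := H)
local notation "ϵ" => Coalgebra.counit (R := k) (A := H)
local notation "𝒮" => antipode (k := k) (H := H)
local notation "εt" => targetMap k H
local notation "εs" => sourceMap k H
local notation "Hₜ" => targetSpace k H
local notation "Hₛ" => sourceSpace k H

variable {M N : CoactedModule k H}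

omit [WeakHopfAlgebra k H] in
theorem twistBy_add {M : Type*} [AddCommGroup M] [Module k M] (α : H →ₗ[k] Module.End k M)
    (X Y : H ⊗[k] H) : twistBy α (X + Y) = twistBy α X + twistBy α Y := by
  simp [twistBy]

omit [WeakHopfAlgebra k H] in
theorem twistBy_zero {M : Type*} [AddCommGroup M] [Module k M] (α : H →ₗ[k] Module.End k M) :
    twistBy α (0 : H ⊗[k] H) = 0 := by
  simp [twistBy]

omit [WeakHopfAlgebra k H] in
theorem twistBy_lmul {M : Type*} [AddCommGroup M] [Module k M] (α : H →ₗ[k] Module.End k M)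
    (X : H ⊗[k] H) (a : H) (w : H ⊗[k] M) :
    twistBy α X (lmul M a w) = lmul M a (twistBy α X w) := by
  induction X with
  | zero => simp [twistBy_zero]
  | add x y hx hy => simp only [map_add, twistBy_add, LinearMap.add_apply, hx, hy]
  | tmul b c =>
    induction w with
    | zero => simp
    | add x y hx hy => simp only [map_add, hx, hy]
    | tmul x m => simp [twistBy_tmul, mul_assoc]

theorem twistBy_act2_right (X : H ⊗[k] H) (a : H) (w : H ⊗[k] M) :
    twistBy (lact k H M) ((𝒮).lTensor H X) (act2 k H H M (1 ⊗ₜ a) w) =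
      twistBy (lact k H M) ((𝒮).lTensor H (X * (a ⊗ₜ 1))) w := by
  induction X with
  | zero => simp [twistBy_zero]
  | add x y hx hy => simp only [map_add, twistBy_add, add_mul, LinearMap.add_apply, hx, hy]
  | tmul b c =>
    induction w with
    | zero => simp
    | add x y hx hy => simp only [map_add, hx, hy]
    | tmul x m => simp [twistBy_tmul, mul_smul]

theorem twistBy_mul_right (X : H ⊗[k] H) (a : H) (w : H ⊗[k] M) :
    twistBy (lact k H M) ((𝒮).lTensor H ((1 ⊗ₜ a) * X)) w =
      rmul M (𝒮 a) (twistBy (lact k H M) ((𝒮).lTensor H X) w) := by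
  induction X with
  | zero => simp [twistBy_zero]
  | add x y hx hy => simp only [map_add, twistBy_add, mul_add, LinearMap.add_apply, hx, hy]
  | tmul b c =>
    induction w with
    | zero => simp
    | add x y hx hy => simp only [map_add, hx, hy]
    | tmul x m => simp [twistBy_tmul, antipode_mul_rev, mul_assoc]

omit [WeakHopfAlgebra k H] in
theorem lact_mul (a b : H) : lact k H M (a * b) = lact k H M a * lact k H M b := by
  ext m
  simp [mul_smul]

/-- The twist by `Y¹ ⊗ S(Y²)` followed by the twist by `X` is the twist by `X¹Y¹ ⊗ S(Y²)X²`. -/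
theorem twistBy_twistBy_antipode {M : Type*} [AddCommGroup M] [Module k M]
    {α : H →ₗ[k] Module.End k M} (hα : ∀ a b, α (a * b) = α a * α b) (X Y : H ⊗[k] H)
    (w : H ⊗[k] M) : twistBy α X (twistBy α ((𝒮).lTensor H Y) w) =
      twistBy α (lift₃ (trilin fun a b c => a ⊗ₜ[k] (𝒮 b * c)) (leg13 X * leg12 Y)) w := by
  simp only [leg13, leg12]
  induction X with
  | zero => simp [twistBy_zero]
  | add x y hx hy =>
    simp only [map_add, twistBy_add, add_mul, TensorProduct.tmul_add, LinearMap.add_apply, hx, hy]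
  | tmul b c =>
    induction Y with
    | zero => simp [twistBy_zero]
    | add x y hx hy =>
      simp only [map_add, twistBy_add, mul_add, TensorProduct.add_tmul, LinearMap.add_apply, hx, hy]
    | tmul p q =>
      induction w with
      | zero => simp
      | add x y hx hy => simp only [map_add, hx, hy]
      | tmul x m => simp [twistBy_tmul, hα, mul_assoc]

/-- The twist by `Y` followed by the twist by `X¹ ⊗ S(X²)` is the twist by `X¹Y¹ ⊗ Y²S(X²)`. -/
theorem twistBy_antipode_twistBy (X Y : H ⊗[k] H) (w : H ⊗[k] M) :
    twistBy (lact k H M) ((𝒮).lTensor H X) (twistBy (lact k H M) Y w) =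
      twistBy (lact k H M) (lift₃ (trilin fun a b c => a ⊗ₜ[k] (b * 𝒮 c)) (leg13 X * leg12 Y)) w := by
  simp only [leg13, leg12]
  induction X with
  | zero => simp [twistBy_zero]
  | add x y hx hy =>
    simp only [map_add, twistBy_add, add_mul, TensorProduct.tmul_add, LinearMap.add_apply, hx, hy]
  | tmul b c =>
    induction Y with
    | zero => simp [twistBy_zero]
    | add x y hx hy =>
      simp only [map_add, twistBy_add, mul_add, TensorProduct.add_tmul, LinearMap.add_apply, hx, hy]
    | tmul p q =>
      induction w with
      | zero => simp
      | add x y hx hy => simp only [map_add, hx, hy]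
      | tmul x m => simp [twistBy_tmul, mul_smul, mul_assoc]

/-! ### The centralizer `_R H` -/

theorem mem_transmuted {x : H} : x ∈ transmuted k H ↔ ∀ y ∈ Hₛ, y * x = x * y := by
  rw [transmuted, Subalgebra.mem_centralizer_iff]
  exact ⟨fun h y ⟨z, hz⟩ => h y ⟨z, hz⟩, fun h y ⟨z, hz⟩ => h y ⟨z, hz⟩⟩

/-- An element of `H ⊗ M` lies in `_R H ⊗ M` if and only if its first factor commutes with
`H_s`. -/
theorem mem_range_transmuted {X : Type*} [AddCommGroup X] [Module k X] (w : H ⊗[k] X) :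
    w ∈ LinearMap.range ((transmuted k H).val.toLinearMap.rTensor X) ↔
      ∀ y ∈ Hₛ, lmul X y w = rmul X y w := by
  constructor
  · rintro ⟨w, rfl⟩ y hy
    induction w with
    | zero => simp
    | add x y hx hy => simp only [map_add, hx, hy]
    | tmul x m =>
      have e := mem_transmuted.1 x.2 y hy
      simp [e]
  · intro h
    let b := Module.Free.chooseBasis k X
    let E := TensorProduct.equivFinsuppOfBasisRight (M := H) b
    have hl : ∀ (y : H) (w : H ⊗[k] X) i, E (lmul X y w) i = y * E w i := by
      intro y w i
      induction w with
      | zero => simp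
      | add x y hx hy => simp only [map_add, Finsupp.add_apply, mul_add, hx, hy]
      | tmul x m => simp [E]
    have hr : ∀ (y : H) (w : H ⊗[k] X) i, E (rmul X y w) i = E w i * y := by
      intro y w i
      induction w with
      | zero => simp
      | add x y hx hy => simp only [map_add, Finsupp.add_apply, add_mul, hx, hy]
      | tmul x m => simp [E]
    have hw : ∀ i, E w i ∈ transmuted k H := fun i => mem_transmuted.2 fun y hy => by
      rw [← hl, ← hr, h y hy]
    rw [← E.symm_apply_apply w, TensorProduct.equivFinsuppOfBasisRight_symm_apply]
    exact Submodule.sum_mem _ fun i _ => ⟨(⟨E w i, hw i⟩ : transmuted k H) ⊗ₜ b i, rfl⟩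

variable {R : H ⊗[k] H}

/-! ### From Yetter-Drinfeld modules to `_R H`-comodules -/

/-- `y n₋₁ ⊗ n₀ = n₋₁ ⊗ S(y)·n₀` for `y ∈ H_s`, hence `n₋₁S(R²) ⊗ R¹·n₀ ∈ _R H ⊗ N`. -/
theorem IsYetterDrinfeld.objG_coact_mem (hreg : IsRegular k H) (hR : IsQuasitriangular R)
    (hN : IsYetterDrinfeld N) (n : N) : (objG R N).coact n ∈
      LinearMap.range ((transmuted k H).val.toLinearMap.rTensor N) := by
  refine (mem_range_transmuted _).2 fun y hy => ?_
  change lmul N y (twistBy (lact k H N) ((𝒮).lTensor H R) (N.coact n)) =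
    rmul N y (twistBy (lact k H N) ((𝒮).lTensor H R) (N.coact n))
  have hz := antipode_source_mem hy
  have e := hN.isCrossed.target_smul_coact hreg hz n
  rw [hreg.source hy] at e
  rw [← twistBy_lmul, ← e, twistBy_act2_right, ← hR.target_mul hz, twistBy_mul_right,
    hreg.source hy]

/-- The twist by `S(R²) ⊗ R¹` turns the action `h₁xS(h₃) ⊗ h₂·m` into `h₁xS(h₂) ⊗ h₃·m`. -/
theorem twistBy_ydAct (hR : IsQuasitriangular R) (h : H) (w : H ⊗[k] N) :
    twistBy (lact k H N) ((𝒮).lTensor H R) (ydAct N h w) =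
      actBy (adj k H) (lact k H N) (Δ h) (twistBy (lact k H N) ((𝒮).lTensor H R) w) := by
  induction w with
  | zero => simp
  | add x y hx hy => simp only [map_add, hx, hy]
  | tmul x m =>
    let P : H →ₗ[k] H ⊗[k] H →ₗ[k] H ⊗[k] N :=
      bilin fun a t => lmul N a (lift₂ (bilin fun b c => (x * 𝒮 c) ⊗ₜ[k] (b • m)) t)
    have hP : ∀ a b c, P a (b ⊗ₜ c) = (a * (x * 𝒮 c)) ⊗ₜ[k] (b • m) := fun _ _ _ => rfl
    have e₁ : ∀ t X : H ⊗[k] H, ∀ a, P a (X * t) = twistBy (lact k H N) ((𝒮).lTensor H X)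
        (P a t) := by
      intro t X a
      induction X with
      | zero => simp [twistBy_zero]
      | add x y hx hy => simp only [map_add, twistBy_add, add_mul, LinearMap.add_apply, hx, hy]
      | tmul p q =>
        induction t with
        | zero => simp
        | add x y hx hy => simp only [map_add, mul_add, hx, hy]
        | tmul b c => simp [hP, twistBy_tmul, antipode_mul_rev, mul_assoc, mul_smul]
    have e₂ : twistBy (lact k H N) ((𝒮).lTensor H R) (ydAct N h (x ⊗ₜ m)) =
        lift₂ (bilin fun a b => P a (R * Δ b)) (Δ h) := by
      rw [ydAct_tmul]
      induction Δ h with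
      | zero => simp
      | add x y hx hy => simp only [map_add, hx, hy]
      | tmul a b =>
        rw [lift₂_tmul, bilin_apply, e₁, LinearMap.lTensor_tmul]
        congr 1
        induction Δ b with
        | zero => simp
        | add x y hx hy => simp only [map_add, TensorProduct.tmul_add, hx, hy]
        | tmul b c => simp [hP]
    rw [e₂]
    refine Eq.symm (sum_comul_linear ((actBy (adj k H) (lact k H N)).flip
      (twistBy (lact k H N) ((𝒮).lTensor H R) (x ⊗ₜ m)))
      (lift₂ (bilin fun a b => P a (R * Δ b)))
      (trilin fun a b c => P a ((c ⊗ₜ[k] b) * R)) ?_ ?_ h)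
    · intro p c
      let K : H ⊗[k] H →ₗ[k] H ⊗[k] H →ₗ[k] H ⊗[k] N :=
        lift₂ (bilin (fun a b => P a ∘ₗ LinearMap.mulLeft k (c ⊗ₜ[k] b))
          (by intros; ext; simp) (by intros; ext; simp)
          (by intros; ext; simp [TensorProduct.tmul_add, add_mul]) (by intros; ext; simp))
      have hK : ∀ X : H ⊗[k] H, actBy (adj k H) (lact k H N) (p ⊗ₜ c)
          (twistBy (lact k H N) ((𝒮).lTensor H X) (x ⊗ₜ m)) = K (Δ p) X := by
        intro X
        induction X with
        | zero => simp [twistBy_zero]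
        | add x y hx hy => simp only [map_add, twistBy_add, LinearMap.add_apply, hx, hy]
        | tmul s t =>
          rw [LinearMap.lTensor_tmul, twistBy_tmul, actBy_tmul, adj, LinearMap.comp_apply]
          induction Δ p with
          | zero => simp
          | add x y hx hy => simp only [map_add, LinearMap.add_apply, TensorProduct.add_tmul, hx, hy]
          | tmul a b => simp [K, hP, sandwich_tmul, antipode_mul_rev, mul_assoc, mul_smul]
      rw [LinearMap.flip_apply, hK]
      induction Δ p with
      | zero => simp
      | add x y hx hy => simp only [map_add, LinearMap.add_apply, hx, hy]
      | tmul a b => simp [K]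
    · intro a q
      rw [lift₂_tmul, bilin_apply, ← hR.cop_mul, comulCop]
      induction Δ q with
      | zero => simp
      | add x y hx hy => simp only [map_add, add_mul, hx, hy]
      | tmul b c => simp

theorem IsYetterDrinfeld.objG_coact_smul (hR : IsQuasitriangular R) (hN : IsYetterDrinfeld N)
    (h : H) (n : N) : (objG R N).coact (h • n) =
      actBy (adj k H) (lact k H N) (Δ h) ((objG R N).coact n) := by
  change twistBy (lact k H N) ((𝒮).lTensor H R) (N.coact (h • n)) = actBy (adj k H) (lact k H N)
    (Δ h) (twistBy (lact k H N) ((𝒮).lTensor H R) (N.coact n))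
  rw [hN.coact_smul, twistBy_ydAct hR]

/-- In `ε_t(n₋₁S(R²))R¹n₀` only `R¹ ⊗ ε_s(R²) = 1₁ ⊗ S(1₂)` matters, so `R` may be replaced by `Δ(1)`,
which leaves `ε_t(n₋₁)n₀ = S(1₁)1₂n = n`. -/
theorem IsYetterDrinfeld.objG_counit (hreg : IsRegular k H) (hR : IsQuasitriangular R)
    (hN : IsYetterDrinfeld N) (n : N) :
    actMap k H N ((εt).rTensor N ((objG R N).coact n)) = n := by
  change actMap k H N ((εt).rTensor N (twistBy (lact k H N) ((𝒮).lTensor H R) (N.coact n))) = n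
  have e₁ : ∀ (X : H ⊗[k] H) (w : H ⊗[k] N), actMap k H N ((εt).rTensor N
      (twistBy (lact k H N) ((𝒮).lTensor H X) w)) = actMap k H N ((εt).rTensor N
      (twistBy (lact k H N) ((𝒮).lTensor H ((εs).lTensor H X)) w)) := by
    intro X w
    induction w with
    | zero => simp
    | add x y hx hy => simp only [map_add, hx, hy]
    | tmul x m =>
      induction X with
      | zero => simp [twistBy_zero]
      | add x y hx hy => simp only [map_add, twistBy_add, LinearMap.add_apply, hx, hy]
      | tmul a b =>
        simp only [LinearMap.lTensor_tmul, twistBy_tmul, LinearMap.rTensor_tmul, actMap_tmul]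
        rw [← targetMap_mul_targetMap k H x (𝒮 b), targetMap_antipode]
  rw [e₁, hR.lTensor_sourceMap hreg, ← lTensor_sourceMap_comul_one, ← e₁, hN.twistBy_coact,
    hN.rTensor_targetMap_coact]
  have e₂ : ∀ t : H ⊗[k] H, actMap k H N (lift₂ (bilin fun a b => 𝒮 a ⊗ₜ[k] (b • n)) t) =
      LinearMap.mul' k H ((𝒮).rTensor H t) • n := by
    intro t
    induction t with
    | zero => simp
    | add x y hx hy => simp only [map_add, add_smul, hx, hy]
    | tmul a b => simp [actMap_tmul, mul_smul]
  rw [e₂, antipode_mul, sourceMap_one, one_smul]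

/-! ### Coassociativity of the coaction given by `G` -/

/-- `r ⊗ (p ⊗ q) ⊗ s` acts by `x ⊗ y ⊗ m ↦ x S(r) ⊗ p y S(q) ⊗ s·m`. -/
noncomputable def sandwichAct (N : CoactedModule k H) :
    H ⊗[k] ((H ⊗[k] H) ⊗[k] H) →ₗ[k] Module.End k (H ⊗[k] (H ⊗[k] N)) :=
  TensorProduct.homTensorHomMap (RingHom.id k) H (H ⊗[k] N) H (H ⊗[k] N) ∘ₗ
    TensorProduct.map ((LinearMap.mul k H).flip ∘ₗ 𝒮)
      (TensorProduct.homTensorHomMap (RingHom.id k) H N H N ∘ₗ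
        TensorProduct.map (sandwich k H) (lact k H N))

theorem sandwichAct_tmul (r p q s x y : H) (m : N) :
    sandwichAct N (r ⊗ₜ ((p ⊗ₜ q) ⊗ₜ s)) (x ⊗ₜ (y ⊗ₜ m)) =
      (x * 𝒮 r) ⊗ₜ[k] ((p * (y * 𝒮 q)) ⊗ₜ[k] (s • m)) := rfl

/-- `p ⊗ q ⊗ r ↦ r ⊗ Δ(p) ⊗ q` -/
noncomputable def splitFst : H ⊗[k] (H ⊗[k] H) →ₗ[k] H ⊗[k] ((H ⊗[k] H) ⊗[k] H) :=
  lift₃ (trilin fun p q r => r ⊗ₜ[k] (Δ p ⊗ₜ[k] q))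

/-- `a ⊗ b` acts by `x ⊗ v ↦ x S(b) ⊗ a₁·v₋₁ ⊗ a₂·v₀` for `v ∈ H ⊗ N`, with the adjoint action
on the first factor of `v`. -/
noncomputable def adjointAct (N : CoactedModule k H) :
    H ⊗[k] H →ₗ[k] Module.End k (H ⊗[k] (H ⊗[k] N)) :=
  TensorProduct.homTensorHomMap (RingHom.id k) H (H ⊗[k] N) H (H ⊗[k] N) ∘ₗ
    TensorProduct.map ((LinearMap.mul k H).flip ∘ₗ 𝒮) (actBy (adj k H) (lact k H N) ∘ₗ Δ) ∘ₗ
    (TensorProduct.comm k H H).toLinearMap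

theorem adjointAct_tmul (a b x : H) (v : H ⊗[k] N) : adjointAct N (a ⊗ₜ b) (x ⊗ₜ v) =
    (x * 𝒮 b) ⊗ₜ[k] (actBy (adj k H) (lact k H N) (Δ a) v) := rfl

set_option maxSynthPendingDepth 4 in
/-- The left side of the coassociativity axiom in terms of `n₋₂ ⊗ n₋₁ ⊗ n₀`. -/
theorem adjointAct_eq_sandwichAct (A Q : H ⊗[k] H) (w : H ⊗[k] (H ⊗[k] N)) :
    adjointAct N A ((twistBy (lact k H N) ((𝒮).lTensor H Q)).lTensor H w) =
      sandwichAct N (splitFst (TensorProduct.assoc k H H H ((Δ).rTensor H A)) *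
        lift₂ (bilin fun c d => (1 : H) ⊗ₜ[k] (((1 : H) ⊗ₜ[k] d) ⊗ₜ[k] c)) Q) w := by
  induction A with
  | zero => simp
  | add x y hx hy => simp only [map_add, add_mul, LinearMap.add_apply, hx, hy]
  | tmul a b =>
    induction Q with
    | zero => simp [twistBy_zero]
    | add x y hx hy =>
      simp only [map_add, twistBy_add, LinearMap.lTensor_add, mul_add, LinearMap.add_apply, hx, hy]
    | tmul c d =>
      induction w with
      | zero => simp
      | add x y hx hy => simp only [map_add, hx, hy]
      | tmul x w =>
        induction w with
        | zero => simp
        | add x y hx hy => simp only [map_add, TensorProduct.tmul_add, hx, hy]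
        | tmul y m =>
          simp only [LinearMap.lTensor_tmul, twistBy_tmul, adjointAct_tmul, LinearMap.rTensor_tmul,
            lift₂_tmul, bilin_apply]
          induction Δ a with
          | zero => simp
          | add x y hx hy =>
            simp only [map_add, TensorProduct.tmul_add, TensorProduct.add_tmul, add_mul,
              LinearMap.add_apply, hx, hy]
          | tmul p s =>
            simp only [actBy_tmul, adj, LinearMap.comp_apply, TensorProduct.assoc_tmul, splitFst,
              lift₃_tmul, trilin_apply]
            induction Δ p with
            | zero => simp
            | add x y hx hy =>
              simp only [map_add, TensorProduct.tmul_add, TensorProduct.add_tmul, add_mul,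
                LinearMap.add_apply, hx, hy]
            | tmul p₁ p₂ =>
              simp [sandwich_tmul, sandwichAct_tmul, antipode_mul_rev, mul_smul, mul_assoc]

set_option maxSynthPendingDepth 4 in
/-- The right side of the coassociativity axiom in terms of `n₋₂ ⊗ n₋₁ ⊗ n₀`. -/
theorem transmutedComul_eq_sandwichAct (A Q : H ⊗[k] H) (w : H ⊗[k] N) :
    TensorProduct.assoc k H H N ((transmutedComul A).rTensor N
        (twistBy (lact k H N) ((𝒮).lTensor H Q) w)) =
      sandwichAct N (lift₂ (bilin fun a b => b ⊗ₜ[k] (Δ a ⊗ₜ[k] (1 : H))) A *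
        lift₃ (trilin fun s t v => v ⊗ₜ[k] (((1 : H) ⊗ₜ[k] t) ⊗ₜ[k] s)) ((Δ).lTensor H Q))
        (TensorProduct.assoc k H H N ((Δ).rTensor N w)) := by
  simp only [transmutedComul]
  induction A with
  | zero => simp [twistBy_zero]
  | add x y hx hy =>
    simp only [map_add, twistBy_add, LinearMap.add_comp, LinearMap.rTensor_add, add_mul,
      LinearMap.add_apply, hx, hy]
  | tmul a b =>
    induction Q with
    | zero => simp [twistBy_zero]
    | add x y hx hy =>
      simp only [map_add, twistBy_add, mul_add, LinearMap.add_apply, hx, hy]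
    | tmul c d =>
      induction w with
      | zero => simp
      | add x y hx hy => simp only [map_add, hx, hy]
      | tmul x n =>
        simp only [LinearMap.lTensor_tmul, twistBy_tmul, LinearMap.rTensor_tmul, lift₂_tmul,
          bilin_apply, LinearMap.comp_apply, comul_mul, comul_antipode]
        induction Δ x with
        | zero => simp
        | add x y hx hy => simp only [map_add, TensorProduct.add_tmul, add_mul, hx, hy]
        | tmul x₁ x₂ =>
          induction Δ d with
          | zero => simp
          | add x y hx hy =>
            simp only [map_add, TensorProduct.tmul_add, TensorProduct.add_tmul, mul_add,
              LinearMap.add_apply, hx, hy]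
          | tmul t v =>
            simp only [TensorProduct.map_tmul, TensorProduct.comm_tmul, lift₃_tmul, trilin_apply,
              Algebra.TensorProduct.tmul_mul_tmul, twistBy_tmul, TensorProduct.assoc_tmul, adj,
              LinearMap.comp_apply]
            induction Δ a with
            | zero => simp
            | add x y hx hy =>
              simp only [map_add, TensorProduct.tmul_add, TensorProduct.add_tmul, add_mul,
                LinearMap.add_apply, hx, hy]
            | tmul p q =>
              simp [sandwich_tmul, sandwichAct_tmul, antipode_mul_rev, mul_assoc]

set_option maxSynthPendingDepth 4 in
theorem splitFst_leg13_mul_leg23 (A B : H ⊗[k] H) :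
    splitFst (leg13 A * leg23 B) = lift₂ (bilin fun a b => b ⊗ₜ[k] (Δ a ⊗ₜ[k] (1 : H))) A *
      lift₂ (bilin fun a b => b ⊗ₜ[k] ((1 : H ⊗[k] H) ⊗ₜ[k] a)) B := by
  simp only [leg13, leg23]
  induction A with
  | zero => simp
  | add x y hx hy => simp only [map_add, TensorProduct.tmul_add, add_mul, hx, hy]
  | tmul a b =>
    induction B with
    | zero => simp
    | add x y hx hy => simp only [map_add, TensorProduct.tmul_add, mul_add, hx, hy]
    | tmul c d => simp [splitFst]

set_option maxSynthPendingDepth 4 in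
omit [WeakHopfAlgebra k H] in
theorem lift_leg13_mul_leg12 (A B : H ⊗[k] H) :
    lift₃ (trilin fun s t v => v ⊗ₜ[k] (((1 : H) ⊗ₜ[k] t) ⊗ₜ[k] s)) (leg13 A * leg12 B) =
      lift₂ (bilin fun a b => b ⊗ₜ[k] ((1 : H ⊗[k] H) ⊗ₜ[k] a)) A *
        lift₂ (bilin fun c d => (1 : H) ⊗ₜ[k] (((1 : H) ⊗ₜ[k] d) ⊗ₜ[k] c)) B := by
  simp only [leg13, leg12]
  induction A with
  | zero => simp
  | add x y hx hy => simp only [map_add, TensorProduct.tmul_add, add_mul, hx, hy]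
  | tmul a b =>
    induction B with
    | zero => simp
    | add x y hx hy => simp only [map_add, TensorProduct.add_tmul, mul_add, hx, hy]
    | tmul c d => simp

theorem IsYetterDrinfeld.lTensor_objG_coact (hR : IsQuasitriangular R) (hN : IsYetterDrinfeld N)
    (A : H ⊗[k] H) (w : H ⊗[k] N) : (objG R N).coact.lTensor H
      (twistBy (lact k H N) ((𝒮).lTensor H A) w) = adjointAct N A
        ((twistBy (lact k H N) ((𝒮).lTensor H R)).lTensor H (N.coact.lTensor H w)) := by
  induction w with
  | zero => simp
  | add x y hx hy => simp only [map_add, hx, hy]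
  | tmul x m =>
    induction A with
    | zero => simp [twistBy_zero]
    | add x y hx hy => simp only [map_add, twistBy_add, LinearMap.add_apply, hx, hy]
    | tmul a b =>
      simp only [LinearMap.lTensor_tmul, twistBy_tmul, adjointAct_tmul, lact_apply]
      congr 1
      exact hN.objG_coact_smul hR a m

set_option maxSynthPendingDepth 4 in
/-- Both sides are images of `n₋₂ ⊗ n₋₁ ⊗ n₀` under `sandwichAct`. By the formulas for `(Δ ⊗ id)R` and
`(id ⊗ Δ)R`, the elements that act are the two ways to bracket a product of three factors. -/
theorem IsYetterDrinfeld.objG_coassoc (hR : IsQuasitriangular R) (hN : IsYetterDrinfeld N)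
    (n : N) : (objG R N).coact.lTensor H ((objG R N).coact n) =
      TensorProduct.assoc k H H N ((transmutedComul R).rTensor N ((objG R N).coact n)) := by
  refine (hN.lTensor_objG_coact hR R (N.coact n)).trans ((adjointAct_eq_sandwichAct R R _).trans
    (Eq.trans ?_ (transmutedComul_eq_sandwichAct R R (N.coact n)).symm))
  rw [hN.coassoc, hR.comul_id, hR.id_comul, splitFst_leg13_mul_leg23, lift_leg13_mul_leg12]
  congr 1
  exact congrArg (sandwichAct N) (mul_assoc (G := H ⊗[k] ((H ⊗[k] H) ⊗[k] H)) _ _ _)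

/-- The functor `G` is well defined on objects. -/
theorem IsYetterDrinfeld.isTransmutedComodule (hreg : IsRegular k H) (hR : IsQuasitriangular R)
    (hN : IsYetterDrinfeld N) : IsTransmutedComodule R (objG R N) where
  coact_mem n := hN.objG_coact_mem hreg hR n
  coact_mem_tensorT n := by
    have h := hN.objG_coact_smul hR 1 n
    rw [one_smul] at h
    exact h.symm
  coact_smul h n := hN.objG_coact_smul hR h n
  coassoc n := hN.objG_coassoc hR n
  counit n := hN.objG_counit hreg hR n

/-! ### From `_R H`-comodules to Yetter-Drinfeld modules -/

theorem adj_mul (a b : H) : adj k H (a * b) = adj k H a * adj k H b := by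
  rw [adj, LinearMap.comp_apply, LinearMap.comp_apply, LinearMap.comp_apply, comul_mul]
  induction Δ a with
  | zero => simp
  | add x y hx hy => simp only [map_add, add_mul, hx, hy]
  | tmul p q =>
    induction Δ b with
    | zero => simp
    | add x y hx hy => simp only [map_add, mul_add, hx, hy]
    | tmul r s =>
      ext x
      simp [sandwich_tmul, antipode_mul_rev, mul_assoc]

/-- `y·x = xS(y)` for `y ∈ H_s` and `x ∈ C_H(H_s)`. -/
theorem adj_source_apply {y : H} (hy : y ∈ Hₛ) {x : H} (hx : x ∈ transmuted k H) :
    adj k H y x = x * 𝒮 y := by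
  have e : sandwich k H ((1 ⊗ₜ y) * Δ 1) x = x * LinearMap.mul' k H ((𝒮).lTensor H (Δ 1)) * 𝒮 y :=
    comul_one_induction (f := (sandwich k H).flip x ∘ₗ LinearMap.mulLeft k (1 ⊗ₜ[k] y))
      (g := LinearMap.mulRight k (𝒮 y) ∘ₗ LinearMap.mulLeft k x ∘ₗ LinearMap.mul' k H ∘ₗ
        (𝒮).lTensor H) fun a ha b hb => by
      simp [sandwich_tmul, antipode_mul_rev, ← mul_assoc, mem_transmuted.1 hx a ha]
  rw [adj, LinearMap.comp_apply, comul_of_mem_source hy, e, mul_antipode, targetMap_one, mul_one]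

/-- `(h₁·x)h₂ = hx` for `x ∈ C_H(H_s)`, where `H` acts by the adjoint action. -/
theorem sum_adj_mul (h : H) {x : H} (hx : x ∈ transmuted k H) :
    lift₂ (bilin fun a b => adj k H a x * b) (Δ h) = h * x := by
  have e := sum_comul_linear (k := k) (D := H) (lift₂ (bilin fun a b => adj k H a x * b))
    (lift₂ (bilin fun a b => a * x * εs b)) (trilin fun a b c => a * x * 𝒮 b * c)
    (fun a b => by
      rw [lift₂_tmul, bilin_apply, adj, LinearMap.comp_apply]
      induction Δ a with
      | zero => simp
      | add x y hx hy => simp only [map_add, LinearMap.add_apply, add_mul, hx, hy]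
      | tmul p q => simp [sandwich_tmul, mul_assoc])
    (fun a b => by
      rw [lift₂_tmul, bilin_apply, ← antipode_mul]
      induction Δ b with
      | zero => simp
      | add x y hx hy => simp only [map_add, mul_add, hx, hy]
      | tmul p q => simp [mul_assoc]) h
  rw [e]
  have e₂ : ∀ t : H ⊗[k] H, lift₂ (bilin fun a b => a * x * εs b) t =
      LinearMap.mul' k H (TensorProduct.map LinearMap.id εs t) * x := by
    intro t
    induction t with
    | zero => simp
    | add p q hp hq => simp only [map_add, add_mul, hp, hq]
    | tmul a b => simp [mul_assoc, mem_transmuted.1 hx _ (sourceMap_mem b)]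
  rw [e₂, ← conv_apply, conv_id_sourceMap, LinearMap.id_apply]

/-- `x₁S(1₂) ⊗ 1₁·x₂ = x₁ ⊗ x₂` for `x ∈ C_H(H_s)`. -/
theorem twistBy_adj_comul (hreg : IsRegular k H) {x : H} (hx : x ∈ transmuted k H) :
    twistBy (adj k H) ((𝒮).lTensor H (Δ 1)) (Δ x) = Δ x := by
  have e₁ : ∀ {y : H}, y ∈ Hₛ → ∀ v : H, adj k H y v = adj k H 1 v * 𝒮 y := by
    intro y hy v
    rw [adj, LinearMap.comp_apply, LinearMap.comp_apply, comul_of_mem_source hy]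
    induction Δ (1 : H) with
    | zero => simp
    | add p q hp hq => simp only [map_add, mul_add, LinearMap.add_apply, add_mul, hp, hq]
    | tmul a b => simp [sandwich_tmul, antipode_mul_rev, mul_assoc]
  have e₂ : ∀ {z : H}, z ∈ Hₜ → ∀ v : H, adj k H 1 v * z = adj k H 1 (v * z) := by
    intro z hz v
    rw [adj, LinearMap.comp_apply]
    exact comul_one_induction (f := LinearMap.mulRight k z ∘ₗ (sandwich k H).flip v)
      (g := (sandwich k H).flip (v * z)) fun a ha b hb => by
      simp [sandwich_tmul, mul_assoc, target_mul_source hz (antipode_target_mem hb)]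
  have e₃ : twistBy (adj k H) ((𝒮).lTensor H (Δ 1)) (Δ x) =
      (adj k H 1).lTensor H (Δ x * Δ 1) := by
    rw [twistBy, hreg.comm_lTensor_antipode]
    refine comul_one_induction
      (f := (actBy (LinearMap.mul k H).flip (adj k H)).flip (Δ x) ∘ₗ (𝒮).lTensor H)
      (g := (adj k H 1).lTensor H ∘ₗ LinearMap.mulLeft k (Δ x)) fun y hy z hz => ?_
    simp only [LinearMap.comp_apply, LinearMap.flip_apply, LinearMap.lTensor_tmul,
      LinearMap.mulLeft_apply]
    induction Δ x with
    | zero => simp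
    | add p q hp hq => simp only [map_add, add_mul, hp, hq]
    | tmul a b =>
      simp [e₁ (antipode_target_mem hz), hreg.target hz, e₂ hz]
  have e₄ : (adj k H 1).lTensor H (Δ x) =
      (LinearMap.mulRight k (LinearMap.mul' k H ((𝒮).lTensor H (Δ 1)))).lTensor H (Δ x) := by
    rw [adj, LinearMap.comp_apply]
    refine comul_one_induction (f := (LinearMap.lTensorHom H ∘ₗ sandwich k H).flip (Δ x))
      (g := (LinearMap.lTensorHom H ∘ₗ (LinearMap.mul k H).flip ∘ₗ LinearMap.mul' k H ∘ₗ
        (𝒮).lTensor H).flip (Δ x)) fun y hy z hz => ?_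
    have e₅ : (1 ⊗ₜ y) * Δ x = Δ x * (1 ⊗ₜ y) := by
      rw [← comul_source_mul x hy, ← comul_mul_source x hy, mem_transmuted.1 hx y hy]
    have e₆ : ∀ t : H ⊗[k] H, (sandwich k H (y ⊗ₜ z)).lTensor H t =
        (LinearMap.mulRight k (𝒮 z)).lTensor H ((1 ⊗ₜ y) * t) := by
      intro t
      induction t with
      | zero => simp
      | add p q hp hq => simp only [map_add, mul_add, hp, hq]
      | tmul a b => simp [sandwich_tmul, mul_assoc]
    have e₇ : ∀ t : H ⊗[k] H, (LinearMap.mulRight k (𝒮 z)).lTensor H (t * (1 ⊗ₜ y)) =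
        (LinearMap.mulRight k (y * 𝒮 z)).lTensor H t := by
      intro t
      induction t with
      | zero => simp
      | add p q hp hq => simp only [map_add, add_mul, hp, hq]
      | tmul a b => simp [mul_assoc]
    exact (e₆ _).trans ((congrArg _ e₅).trans (e₇ _))
  rw [e₃, comul_mul_one, e₄, mul_antipode, targetMap_one, LinearMap.mulRight_one,
    LinearMap.lTensor_id, LinearMap.id_apply]

/-- `a ⊗ b` acts on `H ⊗ M` by `x ⊗ m ↦ (a·x)b ⊗ m`, with the adjoint action on `x`. -/
noncomputable def mulAdj (M : Type*) [AddCommGroup M] [Module k M] :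
    H ⊗[k] H →ₗ[k] Module.End k (H ⊗[k] M) :=
  TensorProduct.lift ((LinearMap.mul k (Module.End k (H ⊗[k] M))).flip.compl₁₂
    (LinearMap.rTensorHom M ∘ₗ adj k H) (rmul M))

theorem mulAdj_tmul (a b : H) (w : H ⊗[k] M) :
    mulAdj M (a ⊗ₜ b) w = rmul M b ((adj k H a).rTensor M w) := rfl

/-- The identity `(a₁·x)a₂ = ax` of `sum_adj_mul`, on `_R H ⊗ M`. -/
theorem mulAdj_comul (a : H) {w : H ⊗[k] M}
    (hw : w ∈ LinearMap.range ((transmuted k H).val.toLinearMap.rTensor M)) :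
    mulAdj M (Δ a) w = lmul M a w := by
  obtain ⟨w, rfl⟩ := hw
  induction w with
  | zero => simp
  | add x y hx hy => simp only [map_add, hx, hy]
  | tmul x m =>
    have e := sum_adj_mul (k := k) a x.2
    simp only [LinearMap.rTensor_tmul, lmul_tmul, AlgHom.toLinearMap_apply, Subalgebra.coe_val]
    rw [← e]
    induction Δ a with
    | zero => simp
    | add p q hp hq => simp only [map_add, TensorProduct.add_tmul, LinearMap.add_apply, hp, hq]
    | tmul p q => simp [mulAdj_tmul]

/-- `h₁xR² ⊗ h₂R¹·m = (h₁·x)R²h₃ ⊗ R¹h₂·m` for `x ∈ _R H`, where `h₁·x` is the adjoint action. Both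
sides are `(h₁·x)h₂R² ⊗ h₃R¹·m`, by `(h₁·x)h₂ = hx` and `Δ^cop(h)R = RΔ(h)`. -/
theorem act2_twistBy (hR : IsQuasitriangular R) (h : H) {w : H ⊗[k] M}
    (hw : w ∈ LinearMap.range ((transmuted k H).val.toLinearMap.rTensor M)) :
    act2 k H H M (Δ h) (twistBy (lact k H M) R w) =
      lift₂ (bilin fun a b => rmul M b (twistBy (lact k H M) R
        (actBy (adj k H) (lact k H M) (Δ a) w))) (Δ h) := by
  have tw : ∀ (X : H ⊗[k] H) (a b : H) (w : H ⊗[k] M),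
      twistBy (lact k H M) (X * (a ⊗ₜ b)) w =
        rmul M b (twistBy (lact k H M) X (act2 k H H M (1 ⊗ₜ a) w)) := by
    intro X a b w
    induction X with
    | zero => simp [twistBy_zero]
    | add x y hx hy => simp only [map_add, twistBy_add, add_mul, LinearMap.add_apply, hx, hy]
    | tmul p q =>
      induction w with
      | zero => simp
      | add x y hx hy => simp only [map_add, hx, hy]
      | tmul x m => simp [twistBy_tmul, mul_smul, mul_assoc, act2]
  have tw' : ∀ (X : H ⊗[k] H) (a b : H) (w : H ⊗[k] M),
      twistBy (lact k H M) ((b ⊗ₜ a) * X) w =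
        act2 k H H M (1 ⊗ₜ b) (twistBy (lact k H M) X (rmul M a w)) := by
    intro X a b w
    induction X with
    | zero => simp [twistBy_zero]
    | add x y hx hy => simp only [map_add, twistBy_add, mul_add, LinearMap.add_apply, hx, hy]
    | tmul p q =>
      induction w with
      | zero => simp
      | add x y hx hy => simp only [map_add, hx, hy]
      | tmul x m => simp [twistBy_tmul, mul_smul, mul_assoc, act2]
  let T : H ⊗[k] H →ₗ[k] Module.End k (H ⊗[k] M) :=
    actBy (LinearMap.mul k H).flip (lact k H M) ∘ₗ (TensorProduct.comm k H H).toLinearMap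
  have hT : ∀ X, T X = twistBy (lact k H M) X := fun _ => rfl
  have e₁ := sum_comul_linear (k := k) (D := H ⊗[k] M)
    (lift₂ (bilin fun a b => rmul M b (twistBy (lact k H M) R
      (actBy (adj k H) (lact k H M) (Δ a) w))))
    (lift₂ (bilin fun a b => T (R * Δ b) ((adj k H a).rTensor M w)))
    (trilin fun a b c => T (R * (b ⊗ₜ c)) ((adj k H a).rTensor M w))
    (fun a b => by
      rw [lift₂_tmul, bilin_apply]
      induction Δ a with
      | zero => simp
      | add x y hx hy => simp only [map_add, LinearMap.add_apply, hx, hy]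
      | tmul p q =>
        rw [lift₂_tmul, trilin_apply, hT, tw]
        congr 2
        generalize w = w
        induction w with
        | zero => simp
        | add x y hx hy => simp only [map_add, hx, hy]
        | tmul x m => simp [act2])
    (fun a b => by
      rw [lift₂_tmul, bilin_apply]
      induction Δ b with
      | zero => simp
      | add x y hx hy => simp only [map_add, mul_add, LinearMap.add_apply, hx, hy]
      | tmul p q => simp) h
  have e₂ := sum_comul_linear (k := k) (D := H ⊗[k] M)
    ((act2 k H H M).flip (twistBy (lact k H M) R w))
    (lift₂ (bilin fun a b => T (R * Δ b) ((adj k H a).rTensor M w)))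
    (trilin fun a b c => T ((c ⊗ₜ b) * R) ((adj k H a).rTensor M w))
    (fun a b => by
      have e₅ : act2 k H H M (a ⊗ₜ b) (twistBy (lact k H M) R w) =
          act2 k H H M (1 ⊗ₜ b) (twistBy (lact k H M) R (lmul M a w)) := by
        rw [twistBy_lmul]
        generalize twistBy (lact k H M) R w = u
        induction u with
        | zero => simp
        | add x y hx hy => simp only [map_add, hx, hy]
        | tmul x m => simp [act2]
      rw [LinearMap.flip_apply, e₅, ← mulAdj_comul a hw]
      induction Δ a with
      | zero => simp
      | add p q hp hq => simp only [map_add, LinearMap.add_apply, hp, hq]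
      | tmul p q => rw [lift₂_tmul, mulAdj_tmul, trilin_apply, hT, tw'])
    (fun a b => by
      rw [lift₂_tmul, bilin_apply, ← hR.cop_mul, comulCop]
      induction Δ b with
      | zero => simp
      | add x y hx hy => simp only [map_add, add_mul, LinearMap.add_apply, hx, hy]
      | tmul p q => simp) h
  exact e₂.trans e₁.symm

/-- The twist by `R` maps `_R H ⊗ M` to `H ⊗_t M`, as `R = Δ^cop(1)R` and `xy = yx` for `x ∈ _R H`,
`y ∈ H_s`. -/
theorem act2_comul_one_twistBy (hR : IsQuasitriangular R) {w : H ⊗[k] M}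
    (hw : w ∈ LinearMap.range ((transmuted k H).val.toLinearMap.rTensor M)) :
    act2 k H H M (Δ 1) (twistBy (lact k H M) R w) = twistBy (lact k H M) R w := by
  have hw' := (mem_range_transmuted w).1 hw
  conv_rhs => rw [← hR.cop_one_mul, comulCop]
  refine comul_one_induction (f := (act2 k H H M).flip (twistBy (lact k H M) R w))
    (g := (actBy (LinearMap.mul k H).flip (lact k H M)).flip w ∘ₗ
      (TensorProduct.comm k H H).toLinearMap ∘ₗ LinearMap.mulRight k R ∘ₗ
      (TensorProduct.comm k H H).toLinearMap) fun y hy z hz => ?_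
  have e₁ : ∀ u : H ⊗[k] M, act2 k H H M (y ⊗ₜ z) u = act2 k H H M (1 ⊗ₜ z) (lmul M y u) := by
    intro u
    induction u with
    | zero => simp
    | add x y hx hy => simp only [map_add, hx, hy]
    | tmul x m => simp [act2]
  change act2 k H H M (y ⊗ₜ z) (twistBy (lact k H M) R w) =
    twistBy (lact k H M) ((z ⊗ₜ y) * R) w
  rw [e₁, ← twistBy_lmul, hw' y hy]
  clear hw hw' hR
  induction R with
  | zero => simp [twistBy_zero]
  | add p q hp hq => simp only [twistBy_add, mul_add, map_add, LinearMap.add_apply, hp, hq]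
  | tmul a b =>
    induction w with
    | zero => simp
    | add p q hp hq => simp only [map_add, hp, hq]
    | tmul x m => simp [twistBy_tmul, act2, mul_smul, mul_assoc]

/-- `ε(xR²)R¹·m = ε_t(x)·m` for `x ∈ _R H`. Here `R¹ ⊗ R²` may be replaced by
`R¹ ⊗ ε_t(R²) = S(1₁) ⊗ 1₂`, and then by `1₂ ⊗ 1₁`. -/
theorem counit_twistBy (hreg : IsRegular k H) (hR : IsQuasitriangular R) {w : H ⊗[k] M}
    (hw : w ∈ LinearMap.range ((transmuted k H).val.toLinearMap.rTensor M)) :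
    TensorProduct.lid k M ((ϵ).rTensor M (twistBy (lact k H M) R w)) =
      actMap k H M ((εt).rTensor M w) := by
  let F : H ⊗[k] H →ₗ[k] H ⊗[k] M →ₗ[k] M :=
    LinearMap.compRight k ((TensorProduct.lid k M).toLinearMap ∘ₗ (ϵ).rTensor M) ∘ₗ
      actBy (LinearMap.mul k H).flip (lact k H M) ∘ₗ (TensorProduct.comm k H H).toLinearMap
  have hF : ∀ (a b x : H) (m : M), F (a ⊗ₜ b) (x ⊗ₜ m) = ϵ (x * b) • a • m := by
    intro a b x m
    simp [F]
  have e₁ : ∀ t : H ⊗[k] H, F t = F ((εt).lTensor H t) := by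
    intro t
    induction t with
    | zero => simp
    | add x y hx hy => simp only [map_add, hx, hy]
    | tmul a b =>
      ext x m
      simp [hF, counit_mul_targetMap]
  have e₂ : F ((𝒮).rTensor H (Δ 1)) = F (TensorProduct.comm k H H (Δ 1)) := by
    conv_lhs => rw [← map_antipode_comm_comul_one]
    refine comul_one_induction (f := F ∘ₗ (𝒮).rTensor H ∘ₗ TensorProduct.map 𝒮 𝒮 ∘ₗ
      (TensorProduct.comm k H H).toLinearMap)
      (g := F ∘ₗ (TensorProduct.comm k H H).toLinearMap) fun y hy z hz => ?_
    ext x m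
    simp [hF, hreg.target hz, antipode_of_source hy, counit_mul_targetMap]
  change F R w = _
  rw [e₁, hR.lTensor_targetMap hreg, e₂]
  obtain ⟨w, rfl⟩ := hw
  induction w with
  | zero => simp
  | add x y hx hy => simp only [map_add, hx, hy]
  | tmul x m =>
    simp only [LinearMap.rTensor_tmul, AlgHom.toLinearMap_apply, Subalgebra.coe_val, actMap_tmul]
    rw [targetMap_eq_sum]
    refine comul_one_induction (f := F.flip ((x : H) ⊗ₜ m) ∘ₗ
      (TensorProduct.comm k H H).toLinearMap)
      (g := (lact k H M).flip m ∘ₗ lift₂ (bilin fun a b => ϵ (a * x) • b)) fun y hy z hz => ?_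
    simp [hF, mem_transmuted.1 x.2 y hy]

/-- `a ⊗ b` acts by `x ⊗ v ↦ xb ⊗ a₁·v₋₁ ⊗ a₂·v₀` for `v ∈ H ⊗ M`, with the adjoint action on the
first factor of `v`. -/
noncomputable def diagAct (M : CoactedModule k H) :
    H ⊗[k] H →ₗ[k] Module.End k (H ⊗[k] (H ⊗[k] M)) :=
  TensorProduct.homTensorHomMap (RingHom.id k) H (H ⊗[k] M) H (H ⊗[k] M) ∘ₗ
    TensorProduct.map (LinearMap.mul k H).flip (actBy (adj k H) (lact k H M) ∘ₗ Δ) ∘ₗ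
    (TensorProduct.comm k H H).toLinearMap

theorem diagAct_tmul (a b x : H) (v : H ⊗[k] M) : diagAct M (a ⊗ₜ b) (x ⊗ₜ v) =
    (x * b) ⊗ₜ[k] (actBy (adj k H) (lact k H M) (Δ a) v) := rfl

/-- `a ⊗ b` acts by `x ⊗ y ⊗ m ↦ xb ⊗ y ⊗ a·m`. -/
noncomputable def twistOuter (M : CoactedModule k H) :
    H ⊗[k] H →ₗ[k] Module.End k (H ⊗[k] (H ⊗[k] M)) :=
  actBy (LinearMap.mul k H).flip (LinearMap.lTensorHom H ∘ₗ lact k H M) ∘ₗ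
    (TensorProduct.comm k H H).toLinearMap

omit [WeakHopfAlgebra k H] in
theorem twistOuter_tmul (a b x y : H) (m : M) : twistOuter M (a ⊗ₜ b) (x ⊗ₜ (y ⊗ₜ m)) =
    (x * b) ⊗ₜ[k] (y ⊗ₜ[k] (a • m)) := rfl

/-- If `(Δ ⊗ id)A = C₁₃D₂₃`, then `xA² ⊗ A¹₁·y ⊗ A¹₂·m = xC²D² ⊗ C¹·y ⊗ D¹·m`. -/
theorem diagAct_twistBy_adj {C D A : H ⊗[k] H} (hA : TensorProduct.assoc k H H H ((Δ).rTensor H A) =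
    leg13 C * leg23 D) (v : H ⊗[k] H) (m : M) :
    diagAct M A (TensorProduct.assoc k H H M (v ⊗ₜ m)) =
      twistOuter M D (TensorProduct.assoc k H H M (twistBy (adj k H) C v ⊗ₜ m)) := by
  induction v with
  | zero => simp
  | add x y hx hy => simp only [map_add, TensorProduct.add_tmul, hx, hy]
  | tmul x y =>
    have e₁ : diagAct M A (TensorProduct.assoc k H H M ((x ⊗ₜ y) ⊗ₜ m)) =
        lift₃ (trilin fun u v t => (x * t) ⊗ₜ[k] ((adj k H u y) ⊗ₜ[k] (v • m)))
          (TensorProduct.assoc k H H H ((Δ).rTensor H A)) := by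
      clear hA
      induction A with
      | zero => simp
      | add a b ha hb => simp only [map_add, LinearMap.add_apply, ha, hb]
      | tmul a b =>
        simp only [TensorProduct.assoc_tmul, diagAct_tmul, LinearMap.rTensor_tmul]
        induction Δ a with
        | zero => simp
        | add p q hp hq =>
          simp only [map_add, TensorProduct.add_tmul, TensorProduct.tmul_add,
            LinearMap.add_apply, hp, hq]
        | tmul p q => simp
    rw [e₁, hA, leg13, leg23]
    clear e₁ hA
    induction C with
    | zero => simp [twistBy_zero]
    | add a b ha hb =>
      simp only [map_add, TensorProduct.tmul_add, TensorProduct.add_tmul, add_mul, twistBy_add,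
        LinearMap.add_apply, ha, hb]
    | tmul c d =>
      induction D with
      | zero => simp
      | add a b ha hb =>
        simp only [map_add, TensorProduct.tmul_add, mul_add, LinearMap.add_apply, ha, hb]
      | tmul p q => simp [twistBy_tmul, twistOuter_tmul, mul_assoc]

/-- If `(id ⊗ Δ)C = A₁₃B₁₂`, then the twists by `A` and `B` together give
`x₁C²₁ ⊗ x₂C²₂ ⊗ C¹·m = Δ(xC²) ⊗ C¹·m`. -/
theorem twistBy_twistOuter {A B C : H ⊗[k] H} (hC : (Δ).lTensor H C = leg13 A * leg12 B)
    (w : H ⊗[k] M) :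
    (twistBy (lact k H M) A).lTensor H (twistOuter M B
      (TensorProduct.assoc k H H M ((Δ).rTensor M w))) =
      TensorProduct.assoc k H H M ((Δ).rTensor M (twistBy (lact k H M) C w)) := by
  let T : H → H → M → H ⊗[k] (H ⊗[k] H) →ₗ[k] H ⊗[k] (H ⊗[k] M) := fun x y m =>
    lift₃ (trilin fun a b c => (x * b) ⊗ₜ[k] ((y * c) ⊗ₜ[k] (a • m)))
  have e₁ : ∀ x y m, (twistBy (lact k H M) A).lTensor H (twistOuter M B (x ⊗ₜ (y ⊗ₜ m))) =
      T x y m (leg13 A * leg12 B) := by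
    intro x y m
    rw [leg13, leg12]
    clear hC
    induction A with
    | zero => simp [twistBy_zero]
    | add a b ha hb =>
      simp only [map_add, TensorProduct.tmul_add, add_mul, twistBy_add, LinearMap.lTensor_add,
        LinearMap.add_apply, ha, hb]
    | tmul c d =>
      induction B with
      | zero => simp
      | add a b ha hb =>
        simp only [map_add, TensorProduct.add_tmul, mul_add, LinearMap.add_apply, ha, hb]
      | tmul p q => simp [T, twistBy_tmul, twistOuter_tmul, mul_smul]
  induction w with
  | zero => simp
  | add x y hx hy => simp only [map_add, hx, hy]
  | tmul x m =>
    have e₂ : ∀ v : H ⊗[k] H, (twistBy (lact k H M) A).lTensor H (twistOuter M B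
        (TensorProduct.assoc k H H M (v ⊗ₜ m))) =
        lift₃ (trilin fun a b c => TensorProduct.assoc k H H M ((v * (b ⊗ₜ c)) ⊗ₜ[k] (a • m)))
          ((Δ).lTensor H C) := by
      intro v
      induction v with
      | zero =>
        simp only [TensorProduct.zero_tmul, map_zero]
        generalize (Δ).lTensor H C = t
        induction t with
        | zero => simp
        | add p q hp hq => rw [map_add, ← hp, ← hq, add_zero]
        | tmul p q =>
          induction q with
          | zero => simp
          | add a b ha hb => rw [TensorProduct.tmul_add, map_add, ← ha, ← hb, add_zero]
          | tmul b c => simp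
      | add x y hx hy =>
        simp only [map_add, TensorProduct.add_tmul, hx, hy]
        generalize (Δ).lTensor H C = t
        induction t with
        | zero => simp
        | add p q hp hq => simp only [map_add, ← hp, ← hq]; abel
        | tmul p q =>
          induction q with
          | zero => simp
          | add a b ha hb => simp only [map_add, TensorProduct.tmul_add, ← ha, ← hb]; abel
          | tmul b c => simp [add_mul, TensorProduct.add_tmul]
      | tmul x y =>
        rw [TensorProduct.assoc_tmul, e₁, ← hC]
        generalize (Δ).lTensor H C = t
        induction t with
        | zero => simp
        | add p q hp hq => simp only [map_add, hp, hq]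
        | tmul p q =>
          induction q with
          | zero => simp
          | add a b ha hb => simp only [map_add, TensorProduct.tmul_add, ha, hb]
          | tmul b c => simp [T]
    rw [LinearMap.rTensor_tmul, e₂]
    clear e₁ e₂ hC
    induction C with
    | zero => simp [twistBy_zero]
    | add a b ha hb => simp only [map_add, twistBy_add, LinearMap.add_apply, ha, hb]
    | tmul a b =>
      simp only [twistBy_tmul, LinearMap.rTensor_tmul, LinearMap.lTensor_tmul, comul_mul,
        lact_apply]
      induction Δ b with
      | zero => simp
      | add p q hp hq =>
        simp only [map_add, TensorProduct.tmul_add, mul_add, TensorProduct.add_tmul, hp, hq]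
      | tmul p q => simp

/-- The twist by `R` recovers `Δ` from the comultiplication of `_R H`. -/
theorem twistBy_adj_transmutedComul (hreg : IsRegular k H) (hR : IsQuasitriangular R) {x : H}
    (hx : x ∈ transmuted k H) : twistBy (adj k H) R (transmutedComul R x) = Δ x := by
  rw [transmutedComul, LinearMap.comp_apply, twistBy_twistBy_antipode adj_mul,
    hR.sum_antipode_mul hreg, twistBy_adj_comul hreg hx]

namespace IsTransmutedComodule

variable (hM : IsTransmutedComodule R M)
include hM

/-- `H`-linearity of the coaction moves the outer twist inside, where it turns the comultiplication of
`_R H` back into `Δ`. -/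
theorem objF_coassoc (hreg : IsRegular k H) (hR : IsQuasitriangular R) (m : M) :
    (objF R M).coact.lTensor H ((objF R M).coact m) =
      TensorProduct.assoc k H H M ((Δ).rTensor M ((objF R M).coact m)) := by
  change (objF R M).coact.lTensor H (twistBy (lact k H M) R (M.coact m)) =
    TensorProduct.assoc k H H M ((Δ).rTensor M (twistBy (lact k H M) R (M.coact m)))
  have e₁ : ∀ (A : H ⊗[k] H) (w : H ⊗[k] M), (objF R M).coact.lTensor H
      (twistBy (lact k H M) A w) = (twistBy (lact k H M) R).lTensor H
        (diagAct M A (M.coact.lTensor H w)) := by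
    intro A w
    induction w with
    | zero => simp
    | add x y hx hy => simp only [map_add, hx, hy]
    | tmul x m =>
      induction A with
      | zero => simp [twistBy_zero]
      | add x y hx hy => simp only [map_add, twistBy_add, LinearMap.add_apply, hx, hy]
      | tmul a b =>
        simp only [LinearMap.lTensor_tmul, twistBy_tmul, diagAct_tmul, lact_apply]
        congr 1
        exact congrArg _ (hM.coact_smul a m)
  have e₂ : ∀ w ∈ LinearMap.range ((transmuted k H).val.toLinearMap.rTensor M),
      diagAct M R (TensorProduct.assoc k H H M ((transmutedComul R).rTensor M w)) =
        twistOuter M R (TensorProduct.assoc k H H M ((Δ).rTensor M w)) := by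
    rintro _ ⟨w, rfl⟩
    induction w with
    | zero => simp
    | add x y hx hy => simp only [map_add, hx, hy]
    | tmul x m =>
      simp only [LinearMap.rTensor_tmul, AlgHom.toLinearMap_apply, Subalgebra.coe_val]
      rw [diagAct_twistBy_adj hR.comul_id, twistBy_adj_transmutedComul hreg hR x.2]
  rw [e₁, hM.coassoc, e₂ _ (hM.coact_mem m), twistBy_twistOuter hR.id_comul]

/-- The functor `F` is well defined on objects. -/
theorem isYetterDrinfeld (hreg : IsRegular k H) (hR : IsQuasitriangular R) :
    IsYetterDrinfeld (objF R M) := by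
  refine IsYetterDrinfeld.of_isCrossed (IsCrossed.of_crossBy
    (fun m => act2_comul_one_twistBy hR (hM.coact_mem m)) fun h m => ?_)
    (fun m => hM.objF_coassoc hreg hR m)
    (fun m => (counit_twistBy hreg hR (hM.coact_mem m)).trans (hM.counit m))
  refine (act2_twistBy hR h (hM.coact_mem m)).trans ?_
  induction Δ h with
  | zero => simp
  | add x y hx hy => simp only [map_add, LinearMap.add_apply, hx, hy]
  | tmul a b =>
    rw [lift₂_tmul, bilin_apply, crossBy_tmul]
    exact congrArg (fun w => rmul M b (twistBy (lact k H M) R w)) (hM.coact_smul a m).symm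

/-- `G ∘ F` leaves the coaction of an `_R H`-comodule unchanged: the two twists combine to the action
of `S(1₁) ⊗ 1₂ = 1₂ ⊗ S(1₁)`, which on `_R H ⊗ M` is the action of `Δ(1)`. -/
theorem objG_objF_coact (hreg : IsRegular k H) (hR : IsQuasitriangular R) (m : M) :
    twistBy (lact k H M) ((𝒮).lTensor H R) (twistBy (lact k H M) R (M.coact m)) = M.coact m := by
  rw [twistBy_antipode_twistBy, hR.sum_mul_antipode hreg]
  conv_rhs => rw [← hM.coact_mem_tensorT]
  rw [twistBy, hreg.comm_rTensor_antipode]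
  refine comul_one_induction
    (f := (actBy (LinearMap.mul k H).flip (lact k H M)).flip (M.coact m) ∘ₗ (𝒮).rTensor H)
    (g := (actBy (adj k H) (lact k H M)).flip (M.coact m)) fun y hy z hz => ?_
  obtain ⟨w, hw⟩ := hM.coact_mem m
  rw [← hw]
  clear hw
  simp only [LinearMap.comp_apply, LinearMap.flip_apply]
  induction w with
  | zero => simp
  | add x y hx hy => simp only [map_add, hx, hy]
  | tmul x m => simp [adj_source_apply hy x.2]

end IsTransmutedComodule

/-- `F ∘ G` leaves the coaction of a Yetter-Drinfeld module unchanged. -/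
theorem IsYetterDrinfeld.objF_objG_coact (hreg : IsRegular k H) (hR : IsQuasitriangular R)
    (hN : IsYetterDrinfeld N) (n : N) :
    twistBy (lact k H N) R (twistBy (lact k H N) ((𝒮).lTensor H R) (N.coact n)) = N.coact n := by
  rw [twistBy_twistBy_antipode lact_mul, hR.sum_antipode_mul hreg, hN.twistBy_coact]

end Transmutation

/-! ### Categories related by a twist of the coactions -/

section CoactionTwist

variable {k : Type w} {H : Type u} [Field k] [Ring H] [Algebra k H]

open CoactionRule

/-- The module `M` with the coaction followed by the twist by `X`. -/
@[reducible] noncomputable def twistObj (X : H ⊗[k] H) (M : CoactedModule k H) :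
    CoactedModule k H where
  carrier := M
  coact := twistBy (lact k H M) X ∘ₗ M.coact

variable [WeakHopfAlgebra k H]

/-- A colinear map stays colinear when both coactions are twisted by `X`. -/
theorem isMorphism_twist {X : H ⊗[k] H} {M N : CoactedModule k H} {f : M →ₗ[k] N}
    (hf : CoactedModule.IsMorphism f) {ρ : M →ₗ[k] H ⊗[k] M} {σ : N →ₗ[k] H ⊗[k] N}
    (hρ : ρ = twistBy (lact k H M) X ∘ₗ M.coact) (hσ : σ = twistBy (lact k H N) X ∘ₗ N.coact) :
    CoactedModule.IsMorphism (M := ⟨M, ρ⟩) (N := ⟨N, σ⟩) f := by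
  subst hρ hσ
  exact ⟨hf.map_smul, fun m => twistBy_map X (⟨f, hf⟩ : M ⟶ N) m⟩

/-- Twisting the coactions by `X` takes the class `P` with the rule `τ` to the class `Q` with the
rule `σ`, and twisting by `Y` is the inverse operation. -/
structure IsTwistEquiv (τ σ : CoactionRule k H) (P Q : ObjectProperty (CoactedModule k H))
    (X Y : H ⊗[k] H) : Prop where
  closed : τ.IsClosed P
  mem : ∀ M, P M → Q (twistObj X M)
  mem_inv : ∀ N, Q N → P (twistObj Y N)
  left_inv : ∀ M, P M → ∀ m : M,
    twistBy (lact k H M) Y (twistBy (lact k H M) X (M.coact m)) = M.coact m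
  right_inv : ∀ N, Q N → ∀ n : N,
    twistBy (lact k H N) X (twistBy (lact k H N) Y (N.coact n)) = N.coact n
  tensor : ∀ U V, P U → P V → σ.tensor (twistObj X U) (twistObj X V) =
    twistBy (lact k H (τ.tens U V)) X ∘ₗ τ.tensor U V
  unit : σ.unit = twistBy (lact k H τ.one) X ∘ₗ τ.unit

namespace IsTwistEquiv

variable {τ σ : CoactionRule k H} {P Q : ObjectProperty (CoactedModule k H)} {X Y : H ⊗[k] H}
  (h : IsTwistEquiv τ σ P Q X Y)
include h

theorem twistObj_right (N : CoactedModule k H) (hN : Q N) : twistObj X (twistObj Y N) = N := by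
  have e := h.right_inv N hN
  obtain ⟨A, ρ⟩ := N
  exact congrArg (CoactedModule.mk A) (LinearMap.ext e)

theorem exists_twistObj (N : CoactedModule k H) (hN : Q N) : ∃ M, P M ∧ twistObj X M = N :=
  ⟨twistObj Y N, h.mem_inv N hN, h.twistObj_right N hN⟩

theorem tens_eq {U V : CoactedModule k H} (hU : P U) (hV : P V) :
    σ.tens (twistObj X U) (twistObj X V) = twistObj X (τ.tens U V) :=
  congrArg (tensorObject (twistObj X U) (twistObj X V)) (h.tensor U V hU hV)

theorem one_eq : σ.one = twistObj X τ.one := congrArg unitObject h.unit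

theorem tensor_left {U V W : CoactedModule k H} (hU : P U) (hV : P V) (hW : P W) :
    σ.tensor (σ.tens (twistObj X U) (twistObj X V)) (twistObj X W) =
      twistBy (lact k H (τ.tens (τ.tens U V) W)) X ∘ₗ τ.tensor (τ.tens U V) W := by
  have key : ∀ ρ, ρ = twistBy (lact k H (τ.tens U V)) X ∘ₗ τ.tensor U V →
      σ.tensor (tensorObject (twistObj X U) (twistObj X V) ρ) (twistObj X W) =
      twistBy (lact k H (τ.tens (τ.tens U V) W)) X ∘ₗ τ.tensor (τ.tens U V) W := by
    rintro _ rfl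
    exact h.tensor (τ.tens U V) W (h.closed.tens U V hU hV) hW
  exact key _ (h.tensor U V hU hV)

theorem tensor_right {U V W : CoactedModule k H} (hU : P U) (hV : P V) (hW : P W) :
    σ.tensor (twistObj X U) (σ.tens (twistObj X V) (twistObj X W)) =
      twistBy (lact k H (τ.tens U (τ.tens V W))) X ∘ₗ τ.tensor U (τ.tens V W) := by
  have key : ∀ ρ, ρ = twistBy (lact k H (τ.tens V W)) X ∘ₗ τ.tensor V W →
      σ.tensor (twistObj X U) (tensorObject (twistObj X V) (twistObj X W) ρ) =
      twistBy (lact k H (τ.tens U (τ.tens V W))) X ∘ₗ τ.tensor U (τ.tens V W) := by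
    rintro _ rfl
    exact h.tensor U (τ.tens V W) hU (h.closed.tens V W hV hW)
  exact key _ (h.tensor V W hV hW)

theorem tensor_one_left {U : CoactedModule k H} (hU : P U) :
    σ.tensor σ.one (twistObj X U) =
      twistBy (lact k H (τ.tens τ.one U)) X ∘ₗ τ.tensor τ.one U := by
  have key : ∀ ρ, ρ = twistBy (lact k H τ.one) X ∘ₗ τ.unit →
      σ.tensor (unitObject ρ) (twistObj X U) =
      twistBy (lact k H (τ.tens τ.one U)) X ∘ₗ τ.tensor τ.one U := by
    rintro _ rfl
    exact h.tensor τ.one U h.closed.one hU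
  exact key _ h.unit

theorem tensor_one_right {U : CoactedModule k H} (hU : P U) :
    σ.tensor (twistObj X U) σ.one =
      twistBy (lact k H (τ.tens U τ.one)) X ∘ₗ τ.tensor U τ.one := by
  have key : ∀ ρ, ρ = twistBy (lact k H τ.one) X ∘ₗ τ.unit →
      σ.tensor (twistObj X U) (unitObject ρ) =
      twistBy (lact k H (τ.tens U τ.one)) X ∘ₗ τ.tensor U τ.one := by
    rintro _ rfl
    exact h.tensor U τ.one hU h.closed.one
  exact key _ h.unit

/-- A colinear map between twisted objects is colinear for the original coactions. -/
theorem isMorphism_untwist {M N : CoactedModule k H} (hM : P M) (hN : P N) {f : M →ₗ[k] N}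
    (hf : CoactedModule.IsMorphism (M := twistObj X M) (N := twistObj X N) f) :
    CoactedModule.IsMorphism f :=
  isMorphism_twist (M := twistObj X M) (N := twistObj X N) (X := Y) hf
    (LinearMap.ext fun m => (h.left_inv M hM m).symm)
    (LinearMap.ext fun n => (h.left_inv N hN n).symm)

/-- Up to equality of objects, everything is obtained from `P` by the twist by `X`. -/
theorem isClosed (hreg : IsRegular k H) : σ.IsClosed Q where
  tens U V hU hV := by
    obtain ⟨U, p, rfl⟩ := h.exists_twistObj U hU
    obtain ⟨V, q, rfl⟩ := h.exists_twistObj V hV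
    rw [h.tens_eq p q]
    exact h.mem _ (h.closed.tens U V p q)
  one := by
    rw [h.one_eq]
    exact h.mem _ h.closed.one
  map := by
    rintro ⟨U, hU⟩ ⟨U', hU'⟩ ⟨V, hV⟩ ⟨V', hV'⟩ ⟨f, hf⟩ ⟨g, hg⟩
    obtain ⟨U, p, rfl⟩ := h.exists_twistObj U hU
    obtain ⟨U', p', rfl⟩ := h.exists_twistObj U' hU'
    obtain ⟨V, q, rfl⟩ := h.exists_twistObj V hV
    obtain ⟨V', q', rfl⟩ := h.exists_twistObj V' hV'
    have hf' := h.isMorphism_untwist p p' hf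
    have hg' := h.isMorphism_untwist q q' hg
    exact isMorphism_twist (h.closed.map ⟨U, p⟩ ⟨U', p'⟩ ⟨V, q⟩ ⟨V', q'⟩ ⟨f, hf'⟩ ⟨g, hg'⟩)
      (h.tensor U V p q) (h.tensor U' V' p' q')
  assoc := by
    rintro ⟨U, hU⟩ ⟨V, hV⟩ ⟨W, hW⟩
    obtain ⟨U, p, rfl⟩ := h.exists_twistObj U hU
    obtain ⟨V, q, rfl⟩ := h.exists_twistObj V hV
    obtain ⟨W, r, rfl⟩ := h.exists_twistObj W hW
    exact isMorphism_twist (h.closed.assoc ⟨U, p⟩ ⟨V, q⟩ ⟨W, r⟩)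
      (h.tensor_left p q r) (h.tensor_right p q r)
  assoc_bijective U V W := assocLin_bijective σ
  left := by
    rintro ⟨U, hU⟩
    obtain ⟨U, p, rfl⟩ := h.exists_twistObj U hU
    exact isMorphism_twist (h.closed.left ⟨U, p⟩) (h.tensor_one_left p) rfl
  left_bijective U := leftLin_bijective σ hreg
  right := by
    rintro ⟨U, hU⟩
    obtain ⟨U, p, rfl⟩ := h.exists_twistObj U hU
    exact isMorphism_twist (h.closed.right ⟨U, p⟩) (h.tensor_one_right p) rfl
  right_bijective U := rightLin_bijective σ hreg

/-- The conditions on tensor products and on the unit object are symmetric, since the twist by `Y` undoes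
the twist by `X`. -/
theorem symm (hreg : IsRegular k H) : IsTwistEquiv σ τ Q P Y X where
  closed := h.isClosed hreg
  mem := h.mem_inv
  mem_inv := h.mem
  left_inv := h.right_inv
  right_inv := h.left_inv
  tensor U V hU hV := by
    obtain ⟨U, p, rfl⟩ := h.exists_twistObj U hU
    obtain ⟨V, q, rfl⟩ := h.exists_twistObj V hV
    have eU : twistBy (lact k H U) Y ∘ₗ twistBy (lact k H U) X ∘ₗ U.coact = U.coact :=
      LinearMap.ext (h.left_inv U p)
    have eV : twistBy (lact k H V) Y ∘ₗ twistBy (lact k H V) X ∘ₗ V.coact = V.coact :=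
      LinearMap.ext (h.left_inv V q)
    have key : ∀ ρ ρ', ρ = U.coact → ρ' = V.coact → τ.tensor ⟨U, ρ⟩ ⟨V, ρ'⟩ = τ.tensor U V := by
      rintro _ _ rfl rfl
      rfl
    refine (key _ _ eU eV).trans (LinearMap.ext fun x => ?_)
    refine (h.left_inv _ (h.closed.tens U V p q) x).symm.trans ?_
    exact congrArg (twistBy (lact k H (τ.tens U V)) Y)
      (LinearMap.congr_fun (h.tensor U V p q) x).symm
  unit := LinearMap.ext fun z => (h.left_inv _ h.closed.one z).symm.trans
    (congrArg (twistBy (lact k H τ.one) Y) (LinearMap.congr_fun h.unit z).symm)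

end IsTwistEquiv

end CoactionTwist

/-! ### The twist of the coactions on tensor products and on the unit object -/

section TransmutedTensor

variable {k : Type w} {H : Type u} [Field k] [Ring H] [Algebra k H] [WeakHopfAlgebra k H]

local notation "Δ" => Coalgebra.comul (R := k) (A := H)
local notation "𝒮" => antipode (k := k) (H := H)
local notation "εt" => targetMap k H
local notation "Hₜ" => targetSpace k H

open CoactionRule

variable {U V : CoactedModule k H} {R : H ⊗[k] H}

/-- `a ⊗ b ⊗ c` acts by `(h ⊗ g) ⊗ (u ⊗ v) ↦ (h ⊗ b g S(c)) ⊗ (a·u ⊗ v)`. -/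
noncomputable def braidAct (U V : CoactedModule k H) :
    H ⊗[k] (H ⊗[k] H) →ₗ[k] Module.End k ((H ⊗[k] H) ⊗[k] (U ⊗[k] V)) :=
  TensorProduct.homTensorHomMap (RingHom.id k) (H ⊗[k] H) (U ⊗[k] V) (H ⊗[k] H) (U ⊗[k] V) ∘ₗ
    TensorProduct.map (LinearMap.lTensorHom H ∘ₗ sandwich k H)
      (LinearMap.rTensorHom V ∘ₗ lact k H U) ∘ₗ
    (TensorProduct.comm k H (H ⊗[k] H)).toLinearMap

theorem braidAct_tmul (a b c h g : H) (u : U) (v : V) :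
    braidAct U V (a ⊗ₜ (b ⊗ₜ c)) ((h ⊗ₜ g) ⊗ₜ (u ⊗ₜ v)) =
      (h ⊗ₜ[k] (b * (g * 𝒮 c))) ⊗ₜ[k] ((a • u) ⊗ₜ[k] v) := rfl

/-- `a ⊗ b ⊗ c` acts by `(h ⊗ g) ⊗ (u ⊗ v) ↦ (h ⊗ g S(c)) ⊗ (a·u ⊗ b·v)`. -/
noncomputable def tripleAct (U V : CoactedModule k H) :
    H ⊗[k] (H ⊗[k] H) →ₗ[k] Module.End k ((H ⊗[k] H) ⊗[k] (U ⊗[k] V)) :=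
  TensorProduct.homTensorHomMap (RingHom.id k) (H ⊗[k] H) (U ⊗[k] V) (H ⊗[k] H) (U ⊗[k] V) ∘ₗ
    TensorProduct.map (LinearMap.lTensorHom H ∘ₗ (LinearMap.mul k H).flip ∘ₗ 𝒮) (act2 k H U V) ∘ₗ
    (TensorProduct.comm k (H ⊗[k] H) H).toLinearMap ∘ₗ
    (TensorProduct.assoc k H H H).symm.toLinearMap

theorem tripleAct_tmul (a b c h g : H) (u : U) (v : V) :
    tripleAct U V (a ⊗ₜ (b ⊗ₜ c)) ((h ⊗ₜ g) ⊗ₜ (u ⊗ₜ v)) =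
      (h ⊗ₜ[k] (g * 𝒮 c)) ⊗ₜ[k] ((a • u) ⊗ₜ[k] (b • v)) := rfl

/-- `h(A²·g) ⊗ (A¹·u ⊗ v)` with the adjoint action written out as `A²₁gS(A²₂)`. -/
theorem braidMul_eq_braidAct (A : H ⊗[k] H) (w : (H ⊗[k] U) ⊗[k] (H ⊗[k] V)) :
    braidMul A U V w = (LinearMap.mul' k H).rTensor (U ⊗[k] V) (braidAct U V ((Δ).lTensor H A)
      (TensorProduct.tensorTensorTensorComm k H U H V w)) := by
  induction w with
  | zero => simp
  | add x y hx hy => simp only [map_add, hx, hy]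
  | tmul x y =>
    induction x with
    | zero => simp
    | add x x' hx hy => simp only [map_add, TensorProduct.add_tmul, hx, hy]
    | tmul h u =>
      induction y with
      | zero => simp
      | add x x' hx hy => simp only [map_add, TensorProduct.tmul_add, hx, hy]
      | tmul g v =>
        induction A with
        | zero => simp [braidMul]
        | add p q hp hq =>
          have e : braidMul (p + q) U V = braidMul p U V + braidMul q U V := by
            simp [braidMul, LinearMap.comp_add, LinearMap.add_comp]
          simp only [e, map_add, LinearMap.add_apply, hp, hq]
        | tmul a b =>
          rw [braidMul_tmul, adj, LinearMap.comp_apply, LinearMap.lTensor_tmul]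
          induction Δ b with
          | zero => simp
          | add p q hp hq =>
            simp only [map_add, LinearMap.add_apply, mul_add, TensorProduct.add_tmul,
              TensorProduct.tmul_add, hp, hq]
          | tmul p q => simp [sandwich_tmul, braidAct_tmul]

/-- With coactions twisted by `C` and `D`, the factor `S(C²)B²` stands between the two coactions, while
`S(D²)S(A²)` stands to the right of them. -/
theorem braidAct_twist (A B C D : H ⊗[k] H) (w : (H ⊗[k] U) ⊗[k] (H ⊗[k] V)) :
    (LinearMap.mul' k H).rTensor (U ⊗[k] V) (braidAct U V (leg13 A * leg12 B)
      (TensorProduct.tensorTensorTensorComm k H U H V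
        (TensorProduct.map (twistBy (lact k H U) ((𝒮).lTensor H C))
          (twistBy (lact k H V) ((𝒮).lTensor H D)) w))) =
    (LinearMap.mul' k H).rTensor (U ⊗[k] V) (tripleAct U V (leg13 A * leg23 D)
      (TensorProduct.tensorTensorTensorComm k H U H V
        ((twistBy (lact k H U) (lift₃ (trilin fun a b c => a ⊗ₜ[k] (𝒮 b * c))
          (leg13 B * leg12 C))).rTensor (H ⊗[k] V) w))) := by
  induction w with
  | zero => simp
  | add x y hx hy => simp only [map_add, hx, hy]
  | tmul x y =>
    induction x with
    | zero => simp
    | add x x' hx hy => simp only [map_add, TensorProduct.add_tmul, hx, hy]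
    | tmul h u =>
      induction y with
      | zero => simp
      | add x x' hx hy => simp only [map_add, TensorProduct.tmul_add, hx, hy]
      | tmul g v =>
        simp only [leg13, leg12, leg23, TensorProduct.map_tmul, LinearMap.rTensor_tmul]
        induction A with
        | zero => simp
        | add p q hp hq =>
          simp only [map_add, TensorProduct.tmul_add, add_mul, LinearMap.add_apply, hp, hq]
        | tmul a a' =>
          induction B with
          | zero => simp [twistBy_zero]
          | add p q hp hq =>
            simp only [map_add, TensorProduct.tmul_add, TensorProduct.add_tmul, add_mul, mul_add,
              twistBy_add, LinearMap.add_apply, hp, hq]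
          | tmul b b' =>
            induction C with
            | zero => simp [twistBy_zero]
            | add p q hp hq =>
              simp only [map_add, TensorProduct.add_tmul, mul_add, twistBy_add,
                LinearMap.add_apply, hp, hq]
            | tmul c c' =>
              induction D with
              | zero => simp [twistBy_zero]
              | add p q hp hq =>
                simp only [map_add, TensorProduct.tmul_add, mul_add, twistBy_add,
                  LinearMap.add_apply, hp, hq]
              | tmul d d' =>
                simp [twistBy_tmul, braidAct_tmul, tripleAct_tmul, antipode_mul_rev, mul_assoc,
                  mul_smul]

/-- By `(Δ ⊗ id)A`, the twist of the codiagonal coaction acts diagonally on `U ⊗_t V`. -/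
theorem lTensor_proj_tripleAct (τ : CoactionRule k H) (A : H ⊗[k] H)
    (w : (H ⊗[k] U) ⊗[k] (H ⊗[k] V)) :
    (τ.proj U V).lTensor H ((LinearMap.mul' k H).rTensor (U ⊗[k] V) (tripleAct U V
      (TensorProduct.assoc k H H H ((Δ).rTensor H A))
      (TensorProduct.tensorTensorTensorComm k H U H V w))) =
    twistBy (lact k H (τ.tens U V)) ((𝒮).lTensor H A) ((τ.proj U V).lTensor H
      (mulTens U V w)) := by
  induction w with
  | zero => simp
  | add x y hx hy => simp only [map_add, hx, hy]
  | tmul x y =>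
    induction x with
    | zero => simp
    | add x x' hx hy => simp only [map_add, TensorProduct.add_tmul, hx, hy]
    | tmul h u =>
      induction y with
      | zero => simp
      | add x x' hx hy => simp only [map_add, TensorProduct.tmul_add, hx, hy]
      | tmul g v =>
        induction A with
        | zero => simp [twistBy_zero]
        | add p q hp hq => simp only [map_add, twistBy_add, LinearMap.add_apply, hp, hq]
        | tmul a b =>
          simp only [mulTens_tmul, LinearMap.lTensor_tmul, twistBy_tmul, LinearMap.rTensor_tmul,
            lact_apply, smul_proj]
          induction Δ a with
          | zero => simp
          | add p q hp hq =>
            simp only [map_add, TensorProduct.tmul_add, TensorProduct.add_tmul,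
              LinearMap.add_apply, hp, hq]
          | tmul p q => simp [tripleAct_tmul, act2, mul_assoc]

/-- `G` takes the coaction of Yetter-Drinfeld modules on a tensor product to that of
`_R H`-comodules. -/
theorem comoduleRule_tensor (hreg : IsRegular k H) (hR : IsQuasitriangular R)
    (hU : IsYetterDrinfeld U) :
    (comoduleRule R).tensor (objG R U) (objG R V) =
      twistBy (lact k H ((ydRule k H).tens U V)) ((𝒮).lTensor H R) ∘ₗ
        (ydRule k H).tensor U V := by
  refine LinearMap.ext fun x => ?_
  have e₁ : ∀ y : U ⊗[k] V, TensorProduct.map (objG R U).coact (objG R V).coact y =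
      TensorProduct.map (twistBy (lact k H U) ((𝒮).lTensor H R))
        (twistBy (lact k H V) ((𝒮).lTensor H R)) (TensorProduct.map U.coact V.coact y) := by
    intro y
    induction y with
    | zero => simp
    | add x y hx hy => simp only [map_add, hx, hy]
    | tmul u v => simp
  have e₂ : ∀ y : U ⊗[k] V, (twistBy (lact k H U) ((𝒮).lTensor H (Δ 1))).rTensor (H ⊗[k] V)
      (TensorProduct.map U.coact V.coact y) = TensorProduct.map U.coact V.coact y := by
    intro y
    induction y with
    | zero => simp
    | add x y hx hy => simp only [map_add, hx, hy]
    | tmul u v => simp [hU.twistBy_coact]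
  change ((ydRule k H).proj U V).lTensor H (braidMul R U V (TensorProduct.map (objG R U).coact
    (objG R V).coact ((ydRule k H).incl U V x))) =
      twistBy (lact k H ((ydRule k H).tens U V)) ((𝒮).lTensor H R) (((ydRule k H).tens U V).coact x)
  -- the factor between the two coactions is `1₁ ⊗ S(1₂)`, which the coaction of `U` absorbs
  rw [e₁, braidMul_eq_braidAct, hR.id_comul, braidAct_twist, ← hR.comul_id, lTensor_proj_tripleAct,
    hR.sum_antipode_mul hreg, e₂]
  exact congrArg _ (ydRule_coact (U := U) (V := V) x).symm

theorem one_mem_transmuted : (1 : H) ∈ transmuted k H := one_mem _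

/-- `G` takes the coaction `Δ` on the unit object to the trivial coaction. -/
theorem comoduleRule_unit (hR : IsQuasitriangular R) :
    (comoduleRule R).unit =
      twistBy (lact k H (ydRule k H).one) ((𝒮).lTensor H R) ∘ₗ (ydRule k H).unit := by
  refine LinearMap.ext fun z => ?_
  have inj : ∀ w w' : H ⊗[k] (ydRule k H).one, ((ydRule k H).oneIncl).lTensor H w =
      ((ydRule k H).oneIncl).lTensor H w' → w = w' := by
    have e : ∀ w : H ⊗[k] (ydRule k H).one, ((ydRule k H).oneProj).lTensor H
        (((ydRule k H).oneIncl).lTensor H w) = w := by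
      intro w
      induction w with
      | zero => simp
      | add x y hx hy => simp only [map_add, hx, hy]
      | tmul h z => simp [oneProj_oneIncl]
    intro w w' hw
    rw [← e w, hw, e]
  apply inj
  have hz : (z : H) ∈ Hₜ := z.2
  let α : H →ₗ[k] Module.End k H := LinearMap.compRight k εt ∘ₗ LinearMap.mul k H
  -- the trivial coaction is `z ↦ 1₁·1 ⊗ 1₂z = S(1₁) ⊗ 1₂z`
  have e₁ : ((ydRule k H).oneIncl).lTensor H ((comoduleRule R).unit z) =
      (𝒮).rTensor H (Δ 1) * (1 ⊗ₜ (z : H)) := by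
    refine comul_one_induction (f := ((ydRule k H).oneIncl).lTensor H ∘ₗ
      (actBy (adj k H) (targetAct k H)).flip (1 ⊗ₜ z))
      (g := LinearMap.mulRight k (1 ⊗ₜ (z : H)) ∘ₗ (𝒮).rTensor H) fun y hy z' hz' => ?_
    have e : εt (z' * z) = z' * z := targetMap_of_mem (target_mul_mem hz' hz)
    change adj k H y 1 ⊗ₜ[k] (εt (z' * z)) = (𝒮).rTensor H (y ⊗ₜ z') * (1 ⊗ₜ (z : H))
    rw [LinearMap.rTensor_tmul, Algebra.TensorProduct.tmul_mul_tmul, e,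
      adj_source_apply hy one_mem_transmuted, one_mul, mul_one]
  have e₂ : ∀ (X : H ⊗[k] H) (w : H ⊗[k] (ydRule k H).one), ((ydRule k H).oneIncl).lTensor H
      (twistBy (lact k H (ydRule k H).one) X w) =
        twistBy α X (((ydRule k H).oneIncl).lTensor H w) := by
    intro X w
    induction X with
    | zero => simp [twistBy_zero]
    | add x y hx hy => simp only [map_add, twistBy_add, LinearMap.add_apply, hx, hy]
    | tmul a b =>
      induction w with
      | zero => simp
      | add x y hx hy => simp only [map_add, hx, hy]
      | tmul h z =>
        rw [twistBy_tmul, LinearMap.lTensor_tmul, LinearMap.lTensor_tmul, twistBy_tmul]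
        rfl
  -- the twist of `Δ(z) = z1₁ ⊗ 1₂` is `z1₁S(R²) ⊗ ε_t(R¹1₂) = z1₁S(1₂)S(1₁') ⊗ 1₂'`, by
  -- `R(1₂ ⊗ 1) = (1 ⊗ 1₂)R` and `ε_t(R¹) ⊗ R² = 1₂ ⊗ 1₁`
  have e₃ : twistBy α ((𝒮).lTensor H R) (((z : H) ⊗ₜ 1) * Δ 1) =
      ((z : H) ⊗ₜ 1) * (𝒮).rTensor H (Δ 1) := by
    have e : twistBy α ((𝒮).lTensor H R) (((z : H) ⊗ₜ 1) * Δ 1) =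
        (((z : H) * LinearMap.mul' k H ((𝒮).lTensor H (Δ 1))) ⊗ₜ 1) * (𝒮).rTensor H (Δ 1) := by
      refine comul_one_induction (f := twistBy α ((𝒮).lTensor H R) ∘ₗ
        LinearMap.mulLeft k ((z : H) ⊗ₜ[k] (1 : H)))
        (g := LinearMap.mulRight k ((𝒮).rTensor H (Δ 1)) ∘ₗ
          (TensorProduct.mk k H H).flip 1 ∘ₗ LinearMap.mulLeft k (z : H) ∘ₗ
          LinearMap.mul' k H ∘ₗ (𝒮).lTensor H) fun y hy z' hz' => ?_
      let E : H ⊗[k] H →ₗ[k] H ⊗[k] H := lift₂ (bilin fun r s => (z * y * 𝒮 s) ⊗ₜ[k] r)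
      have e₄ : ∀ X : H ⊗[k] H, twistBy α ((𝒮).lTensor H X) ((z * y) ⊗ₜ z') =
          E ((εt).rTensor H (X * (z' ⊗ₜ 1))) := by
        intro X
        induction X with
        | zero => simp [twistBy_zero]
        | add x y hx hy => simp only [map_add, add_mul, twistBy_add, LinearMap.add_apply, hx, hy]
        | tmul a b => simp [E, twistBy_tmul, α]
      have e₅ : ∀ X : H ⊗[k] H, E ((εt).rTensor H ((1 ⊗ₜ z') * X)) =
          rmul H (𝒮 z') (E ((εt).rTensor H X)) := by
        intro X
        induction X with
        | zero => simp
        | add x y hx hy => simp only [map_add, mul_add, hx, hy]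
        | tmul a b => simp [E, antipode_mul_rev, mul_assoc]
      simp only [LinearMap.comp_apply, LinearMap.mulLeft_apply, LinearMap.mulRight_apply,
        LinearMap.flip_apply, TensorProduct.mk_apply, LinearMap.lTensor_tmul,
        LinearMap.mul'_apply, Algebra.TensorProduct.tmul_mul_tmul, one_mul]
      rw [e₄, ← hR.target_mul hz', e₅, hR.rTensor_targetMap, comulCop]
      refine comul_one_induction (f := rmul H (𝒮 z') ∘ₗ E ∘ₗ
        (TensorProduct.comm k H H).toLinearMap)
        (g := LinearMap.mulLeft k (((z : H) * (y * 𝒮 z')) ⊗ₜ[k] (1 : H)) ∘ₗ (𝒮).rTensor H)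
        fun a ha b hb => ?_
      simp [E, mul_assoc, target_mul_source (antipode_source_mem ha) (antipode_target_mem hz')]
    rw [e, mul_antipode, targetMap_one, mul_one]
  -- `S(1₁) ⊗ 1₂z = zS(1₁) ⊗ 1₂`
  refine e₁.trans ((target_separability hz).symm.trans (e₃.symm.trans ?_))
  refine Eq.trans (congrArg (twistBy α ((𝒮).lTensor H R)) ?_) (e₂ _ _).symm
  exact (comul_of_mem_target hz).symm.trans (lTensor_oneIncl_coact z).symm

/-- The functors `F` and `G` on objects, as inverse twists of the coactions. -/
theorem isTwistEquiv (hreg : IsRegular k H) (hR : IsQuasitriangular R) :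
    IsTwistEquiv (ydRule k H) (comoduleRule R) IsYetterDrinfeld (IsTransmutedComodule R)
      ((𝒮).lTensor H R) R where
  closed := ydRule_isClosed hreg
  mem _ hN := hN.isTransmutedComodule hreg hR
  mem_inv _ hM := hM.isYetterDrinfeld hreg hR
  left_inv _ hN n := hN.objF_objG_coact hreg hR n
  right_inv _ hM m := hM.objG_objF_coact hreg hR m
  tensor _ _ hU _ := comoduleRule_tensor hreg hR hU
  unit := comoduleRule_unit hR

end TransmutedTensor

/-! ### The twist as a monoidal equivalence -/

section TwistFunctor

variable {k : Type w} {H : Type u} [Field k] [Ring H] [Algebra k H]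

open CoactionRule

theorem isMorphism_of_eq {A B : CoactedModule k H} {f : A →ₗ[k] B} (hf : CoactedModule.IsMorphism f)
    {ρ : A →ₗ[k] H ⊗[k] A} {σ : B →ₗ[k] H ⊗[k] B} (hρ : ρ = A.coact) (hσ : σ = B.coact) :
    CoactedModule.IsMorphism (M := ⟨A, ρ⟩) (N := ⟨B, σ⟩) f := by
  subst hρ hσ
  exact hf

theorem isMorphism_id {A : CoactedModule k H} {ρ σ : A →ₗ[k] H ⊗[k] A} (h : ρ = σ) :
    CoactedModule.IsMorphism (M := ⟨A, ρ⟩) (N := ⟨A, σ⟩) LinearMap.id := by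
  subst h
  exact ⟨fun _ _ => rfl, fun m => by simp⟩

variable [WeakHopfAlgebra k H]

/-- `id ⊗ id = id`, also if the coactions on source and target differ. -/
theorem mapLin_id (τ : CoactionRule k H) {U V : CoactedModule k H} {ρ ρ' : U →ₗ[k] H ⊗[k] U}
    {σ σ' : V →ₗ[k] H ⊗[k] V} (x : τ.tens ⟨U, ρ⟩ ⟨V, σ⟩) :
    τ.mapLin (U := ⟨U, ρ⟩) (U' := ⟨U, ρ'⟩) (V := ⟨V, σ⟩) (V' := ⟨V, σ'⟩) LinearMap.id
      LinearMap.id x = x := by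
  refine Eq.trans (congrArg (τ.proj U V) ?_) (proj_incl τ (U := U) (V := V) x)
  exact LinearMap.congr_fun TensorProduct.map_id _

/-- The functor that twists the coactions by `X` and is the identity on underlying maps. -/
noncomputable def twistFunctor {P Q : ObjectProperty (CoactedModule k H)} (X : H ⊗[k] H)
    (hX : ∀ M, P M → Q (twistObj X M)) : P.FullSubcategory ⥤ Q.FullSubcategory where
  obj M := ⟨twistObj X M.obj, hX M.obj M.property⟩
  map f := ObjectProperty.homMk ⟨f.hom.toLin, isMorphism_twist f.hom.isMorphism rfl rfl⟩

namespace IsTwistEquiv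

variable {τ σ : CoactionRule k H} {P Q : ObjectProperty (CoactedModule k H)} {X Y : H ⊗[k] H}
  (h : IsTwistEquiv τ σ P Q X Y)

/-- Twisting the coactions is an equivalence of categories. -/
noncomputable def equivalence : P.FullSubcategory ≌ Q.FullSubcategory where
  functor := twistFunctor X h.mem
  inverse := twistFunctor Y h.mem_inv
  unitIso := NatIso.ofComponents (fun M => isoMk (U := M)
      (V := ⟨twistObj Y (twistObj X M.obj), h.mem_inv _ (h.mem _ M.property)⟩)
      (LinearMap.id : M.obj →ₗ[k] M.obj)
      (isMorphism_id (A := M.obj) (LinearMap.ext fun m => (h.left_inv _ M.property m).symm))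
      Function.bijective_id)
    fun _ => lin_hom_ext rfl
  counitIso := NatIso.ofComponents (fun N => isoMk
      (U := ⟨twistObj X (twistObj Y N.obj), h.mem _ (h.mem_inv _ N.property)⟩) (V := N)
      (LinearMap.id : N.obj →ₗ[k] N.obj)
      (isMorphism_id (A := N.obj) (ρ := (twistObj X (twistObj Y N.obj)).coact)
        (LinearMap.ext fun n => h.right_inv _ N.property n))
      Function.bijective_id)
    fun _ => lin_hom_ext rfl
  functor_unitIso_comp _ := lin_hom_ext rfl

/-- The associativity square of the twist: the constraint does not depend on the coactions, and the other
maps are identities. -/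
theorem assocLin_mapLin_id (U V W : CoactedModule k H)
    (x : σ.tens (σ.tens (twistObj X U) (twistObj X V)) (twistObj X W)) :
    τ.assocLin U V W (σ.mapLin (U := σ.tens (twistObj X U) (twistObj X V))
      (U' := twistObj X (τ.tens U V)) (V := twistObj X W) (V' := twistObj X W)
      (LinearMap.id : τ.tens U V →ₗ[k] τ.tens U V) LinearMap.id x) =
    σ.mapLin (U := twistObj X U) (U' := twistObj X U)
      (V := σ.tens (twistObj X V) (twistObj X W)) (V' := twistObj X (τ.tens V W)) LinearMap.id
      (LinearMap.id : τ.tens V W →ₗ[k] τ.tens V W)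
      (σ.assocLin (twistObj X U) (twistObj X V) (twistObj X W) x) := by
  have e₁ : σ.mapLin (U := σ.tens (twistObj X U) (twistObj X V))
      (U' := twistObj X (τ.tens U V)) (V := twistObj X W) (V' := twistObj X W)
      (LinearMap.id : τ.tens U V →ₗ[k] τ.tens U V) LinearMap.id x = x :=
    mapLin_id σ (U := τ.tens U V) (V := W) x
  have e₂ : ∀ y : σ.tens (twistObj X U) (σ.tens (twistObj X V) (twistObj X W)),
      σ.mapLin (U := twistObj X U) (U' := twistObj X U)
      (V := σ.tens (twistObj X V) (twistObj X W)) (V' := twistObj X (τ.tens V W)) LinearMap.id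
      (LinearMap.id : τ.tens V W →ₗ[k] τ.tens V W) y = y :=
    fun y => mapLin_id σ (U := U) (V := τ.tens V W) y
  exact (congrArg (fun y : τ.tens (τ.tens U V) W => τ.assocLin U V W y) e₁).trans (e₂ _).symm

/-- Twisting the coactions is a monoidal functor, with identities as structure maps. -/
noncomputable def coreMonoidal (hP : τ.IsMonoidal P) (hQ : σ.IsMonoidal Q) :
    letI : MonoidalCategory P.FullSubcategory := hP.category
    letI : MonoidalCategory Q.FullSubcategory := hQ.category
    (twistFunctor X h.mem).CoreMonoidal :=
  letI : MonoidalCategory P.FullSubcategory := hP.category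
  letI : MonoidalCategory Q.FullSubcategory := hQ.category
  { εIso := isoMk (U := ⟨σ.one, hQ.isClosed.one⟩)
      (V := ⟨twistObj X τ.one, h.mem _ hP.isClosed.one⟩)
      (LinearMap.id : τ.one →ₗ[k] τ.one) (isMorphism_id (A := τ.one) h.unit) Function.bijective_id
    μIso := fun U V => isoMk
      (U := ⟨σ.tens (twistObj X U.obj) (twistObj X V.obj),
        hQ.isClosed.tens _ _ (h.mem _ U.property) (h.mem _ V.property)⟩)
      (V := ⟨twistObj X (τ.tens U.obj V.obj),
        h.mem _ (hP.isClosed.tens _ _ U.property V.property)⟩)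
      (LinearMap.id : τ.tens U.obj V.obj →ₗ[k] τ.tens U.obj V.obj)
      (isMorphism_id (A := τ.tens U.obj V.obj) (h.tensor _ _ U.property V.property))
      Function.bijective_id
    μIso_hom_natural_left := fun _ _ => lin_hom_ext rfl
    μIso_hom_natural_right := fun _ _ => lin_hom_ext rfl
    associativity := fun U V W => by
      refine lin_hom_ext (LinearMap.ext fun (x : σ.tens (σ.tens (twistObj X U.obj) (twistObj X V.obj)) (twistObj X W.obj)) => ?_)
      have e := assocLin_mapLin_id (τ := τ) (σ := σ) (X := X) U.obj V.obj W.obj x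
      refine Eq.trans ?_ (e.trans ?_)
      · rfl
      · rfl
    left_unitality := fun U => by
      refine lin_hom_ext (LinearMap.ext fun (x : σ.tens σ.one (twistObj X U.obj)) => ?_)
      change τ.leftLin U.obj x = τ.leftLin U.obj (σ.mapLin (U := σ.one) (U' := twistObj X τ.one)
        (V := twistObj X U.obj) (V' := twistObj X U.obj) (LinearMap.id : τ.one →ₗ[k] τ.one)
        LinearMap.id x)
      refine congrArg (τ.leftLin U.obj) (Eq.symm ?_)
      exact mapLin_id σ (U := τ.one) (V := U.obj) x
    right_unitality := fun U => by
      refine lin_hom_ext (LinearMap.ext fun (x : σ.tens (twistObj X U.obj) σ.one) => ?_)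
      change τ.rightLin U.obj x = τ.rightLin U.obj (σ.mapLin (U := twistObj X U.obj)
        (U' := twistObj X U.obj) (V := σ.one) (V' := twistObj X τ.one) LinearMap.id
        (LinearMap.id : τ.one →ₗ[k] τ.one) x)
      refine congrArg (τ.rightLin U.obj) (Eq.symm ?_)
      exact mapLin_id σ (U := U.obj) (V := τ.one) x }

end IsTwistEquiv

end TwistFunctor

/-! ### The braided category of `_R H`-comodules -/

section ComoduleBraided

variable {k : Type w} {H : Type u} [Field k] [Ring H] [Algebra k H] [WeakHopfAlgebra k H]

local notation "𝒮" => antipode (k := k) (H := H)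

open CoactionRule

section

variable {M N : Type u} [AddCommGroup M] [Module k M] [Module H M] [IsScalarTower k H M]
  [AddCommGroup N] [Module k N] [Module H N] [IsScalarTower k H N]

/-- The braiding of two modules with given coactions, as a map of their tensor product `⊗_t`. Its type
does not mention the coactions, so that these can be rewritten. -/
noncomputable def braidOf (ρ : M →ₗ[k] H ⊗[k] M) (σ : N →ₗ[k] H ⊗[k] N) :
    tensorT k H M N →ₗ[k] tensorT k H N M :=
  braidLin ⟨M, ρ⟩ ⟨N, σ⟩

variable {R : H ⊗[k] H} {ρ : M →ₗ[k] H ⊗[k] M} {σ : N →ₗ[k] H ⊗[k] N}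

theorem comodule_braidOf_isMorphism (hreg : IsRegular k H) (hR : IsQuasitriangular R)
    (hM : IsTransmutedComodule R ⟨M, ρ⟩) (hN : IsTransmutedComodule R ⟨N, σ⟩) :
    CoactedModule.IsMorphism (M := (comoduleRule R).tens ⟨M, ρ⟩ ⟨N, σ⟩)
      (N := (comoduleRule R).tens ⟨N, σ⟩ ⟨M, ρ⟩)
      (braidOf (twistBy (lact k H M) R ∘ₗ ρ) (twistBy (lact k H N) R ∘ₗ σ)) := by
  have h := (isTwistEquiv hreg hR).symm hreg
  have e := braidLin_isMorphism (hM.isYetterDrinfeld hreg hR) (hN.isYetterDrinfeld hreg hR)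
  exact h.isMorphism_untwist (h.closed.tens _ _ hM hN) (h.closed.tens _ _ hN hM)
    (isMorphism_of_eq e (h.tensor _ _ hM hN).symm (h.tensor _ _ hN hM).symm)

theorem comodule_braidOf_bijective (hreg : IsRegular k H) (hR : IsQuasitriangular R)
    (hM : IsTransmutedComodule R ⟨M, ρ⟩) :
    Function.Bijective (braidOf (twistBy (lact k H M) R ∘ₗ ρ) (twistBy (lact k H N) R ∘ₗ σ)) :=
  braidLin_bijective hR.antipode_bijective (hM.isYetterDrinfeld hreg hR)

end

variable {R : H ⊗[k] H}

/-- The braided monoidal category of `_R H`-comodules, with the braiding of the Yetter-Drinfeld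
modules obtained by `F`. -/
@[reducible] noncomputable def comoduleBraided (hreg : IsRegular k H) (hR : IsQuasitriangular R)
    (hY : (ydRule k H).IsMonoidal IsYetterDrinfeld)
    (hC : (comoduleRule R).IsMonoidal (IsTransmutedComodule R)) :
    letI : MonoidalCategory (TransmutedComodule R) := hC.category
    BraidedCategory (TransmutedComodule R) :=
  letI : MonoidalCategory (YetterDrinfeld k H) := hY.category
  letI : MonoidalCategory (TransmutedComodule R) := hC.category
  letI : BraidedCategory (YetterDrinfeld k H) := ydBraided hreg hR.antipode_bijective hY
  have h := (isTwistEquiv hreg hR).symm hreg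
  letI : (twistFunctor R h.mem).Monoidal := (h.coreMonoidal hC hY).toMonoidal
  haveI : (twistFunctor R h.mem).Faithful :=
    ⟨fun e => lin_hom_ext (congrArg (fun f => f.hom.toLin) e)⟩
  BraidedCategory.ofFaithful (twistFunctor R h.mem)
    (fun U V => isoMk (U := U ⊗ V) (V := V ⊗ U)
      (braidOf (twistBy (lact k H U.obj) R ∘ₗ U.obj.coact)
        (twistBy (lact k H V.obj) R ∘ₗ V.obj.coact))
      (comodule_braidOf_isMorphism hreg hR U.property V.property)
      (comodule_braidOf_bijective hreg hR U.property))
    (by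
      rintro ⟨@⟨M, _, _, _, _, ρ⟩, hM⟩ ⟨@⟨N, _, _, _, _, σ⟩, hN⟩
      exact lin_hom_ext rfl)

/-- `G` is a braided monoidal functor. -/
@[reducible] noncomputable def functorGBraided (hreg : IsRegular k H) (hR : IsQuasitriangular R)
    (hY : (ydRule k H).IsMonoidal IsYetterDrinfeld)
    (hC : (comoduleRule R).IsMonoidal (IsTransmutedComodule R))
    (hG : ∀ N : CoactedModule k H, IsYetterDrinfeld N → IsTransmutedComodule R (objG R N)) :
    letI : MonoidalCategory (YetterDrinfeld k H) := hY.category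
    letI : MonoidalCategory (TransmutedComodule R) := hC.category
    letI : BraidedCategory (YetterDrinfeld k H) := ydBraided hreg hR.antipode_bijective hY
    letI : BraidedCategory (TransmutedComodule R) := comoduleBraided hreg hR hY hC
    (functorG R hG).Braided :=
  letI : MonoidalCategory (YetterDrinfeld k H) := hY.category
  letI : MonoidalCategory (TransmutedComodule R) := hC.category
  letI : BraidedCategory (YetterDrinfeld k H) := ydBraided hreg hR.antipode_bijective hY
  letI : BraidedCategory (TransmutedComodule R) := comoduleBraided hreg hR hY hC
  letI m : (functorG R hG).Monoidal := ((isTwistEquiv hreg hR).coreMonoidal hY hC).toMonoidal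
  { m with
    braided := by
      rintro ⟨@⟨M, _, _, _, _, ρ⟩, hM⟩ ⟨@⟨N, _, _, _, _, σ⟩, hN⟩
      have e₁ : twistBy (lact k H M) R ∘ₗ twistBy (lact k H M) ((𝒮).lTensor H R) ∘ₗ ρ = ρ :=
        LinearMap.ext (hM.objF_objG_coact hreg hR)
      have e₂ : twistBy (lact k H N) R ∘ₗ twistBy (lact k H N) ((𝒮).lTensor H R) ∘ₗ σ = σ :=
        LinearMap.ext (hN.objF_objG_coact hreg hR)
      have e : @Eq (tensorT k H M N →ₗ[k] tensorT k H N M) (braidLin ⟨M, ρ⟩ ⟨N, σ⟩)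
          (braidOf (twistBy (lact k H M) R ∘ₗ twistBy (lact k H M) ((𝒮).lTensor H R) ∘ₗ ρ)
            (twistBy (lact k H N) R ∘ₗ twistBy (lact k H N) ((𝒮).lTensor H R) ∘ₗ σ)) :=
        (congrArg₂ braidOf e₁ e₂).symm
      exact lin_hom_ext e }

end ComoduleBraided

end WeakHopfAlgebra

open WeakHopfAlgebra in
theorem corollary2p6 {k : Type w} {H : Type u} [Field k] [Ring H] [Algebra k H]
    [WeakHopfAlgebra k H] (hreg : IsRegular k H) (R : H ⊗[k] H) (hR : IsQuasitriangular R) :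
    -- both categories are monoidal under `⊗_t`, with unit object `H_t`
    ∃ (hY : (ydRule k H).IsMonoidal IsYetterDrinfeld)
      (hC : (comoduleRule R).IsMonoidal (IsTransmutedComodule R)),
    letI : MonoidalCategory (YetterDrinfeld k H) := hY.category
    letI : MonoidalCategory (TransmutedComodule R) := hC.category
    ∃ (_ : BraidedCategory (YetterDrinfeld k H)) (_ : BraidedCategory (TransmutedComodule R)),
      -- the braiding of Yetter-Drinfeld modules is `u ⊗ v ↦ u₋₁·v ⊗ u₀`
      (∀ (U V : YetterDrinfeld k H) (x : tensorT k H U.obj V.obj),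
        (tensorT k H V.obj U.obj).subtype ((β_ U V).hom.hom.toLin x) =
          ydBraiding U.obj V.obj x) ∧
      -- the braiding of `_R H`-comodules and its inverse
      (∀ (U V : TransmutedComodule R) (x : tensorT k H U.obj V.obj),
        (tensorT k H V.obj U.obj).subtype ((β_ U V).hom.hom.toLin x) =
          comoduleBraiding R U.obj V.obj x) ∧
      (∀ (U V : TransmutedComodule R) (y : tensorT k H V.obj U.obj),
        (tensorT k H U.obj V.obj).subtype ((β_ U V).inv.hom.toLin y) =
          comoduleBraidingInv R hR.antipode_bijective U.obj V.obj y) ∧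
      -- `G` is an equivalence with quasi-inverse `F`, and is braided with identities as
      -- structure maps
      ∃ (hF : ∀ M : CoactedModule k H, IsTransmutedComodule R M → IsYetterDrinfeld (objF R M))
        (hG : ∀ N : CoactedModule k H, IsYetterDrinfeld N → IsTransmutedComodule R (objG R N)),
        (∃ e : YetterDrinfeld k H ≌ TransmutedComodule R,
          e.functor = functorG R hG ∧ e.inverse = functorF R hF) ∧
        ∃ _ : (functorG R hG).Braided,
          (∀ z : targetSpace k H,
            ((Functor.LaxMonoidal.ε (functorG R hG)).hom.toLin z : targetSpace k H) = z) ∧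
          (∀ (U V : YetterDrinfeld k H) (x : tensorT k H U.obj V.obj),
            ((Functor.LaxMonoidal.μ (functorG R hG) U V).hom.toLin x :
              tensorT k H U.obj V.obj) = x) := by
  have h := isTwistEquiv hreg hR
  have hY : (ydRule k H).IsMonoidal IsYetterDrinfeld := (ydRule_isClosed hreg).isMonoidal hreg
  have hC : (comoduleRule R).IsMonoidal (IsTransmutedComodule R) :=
    (h.isClosed hreg).isMonoidal hreg
  refine ⟨hY, hC, ydBraided hreg hR.antipode_bijective hY, comoduleBraided hreg hR hY hC,
    fun U V x => incl_braidLin U.property x,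
    fun U V x => incl_braidLin (U.property.isYetterDrinfeld hreg hR) x, ?_,
    fun M hM => hM.isYetterDrinfeld hreg hR, fun N hN => hN.isTransmutedComodule hreg hR,
    ⟨h.equivalence, rfl, rfl⟩, functorGBraided hreg hR hY hC _, fun _ => rfl, fun _ _ _ => rfl⟩
  intro U V y
  obtain ⟨x, rfl⟩ := braidLin_bijective hR.antipode_bijective
    (V := objF R V.obj) (U.property.isYetterDrinfeld hreg hR) |>.surjective y
  refine (congrArg (tensorT k H U.obj V.obj).subtype
    (CoactionRule.isoMk_inv_apply (g := fun _ => x) rfl)).trans ?_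
  exact (ydBraidingInv_incl_braidLin hR.antipode_bijective
    (U.property.isYetterDrinfeld hreg hR) x).symm
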